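/- Let $x_L<x_R$, $L=x_R-x_L$, $\mu=2\pi/L$, $T>0$, $a,\sigma,\gamma>0$, $F(u)=\gamma u^3/6$ and $r>1/2$. For $s\ge 0$ let $H_p^{s}$ be the periodic Sobolev space of functions on $[x_L,x_R]$ with norm $\big(\sum_{k\in\mathbb Z}(1+(\mu k)^2)^{s}|\hat u_k|^2\big)^{1/2}$, where $\hat u_k$ are the Fourier coefficients. Let the real function $u$ be a solution of the regularized long-wave problem $$u_t+au_x-\sigma u_{xxt}+\big(F'(u)\big)_x=0,\qquad u(x,0)=u_0(x),\qquad u(x,t)=u(x+L,t),\qquad t\in[0,T],$$ (the equation may be understood in the sense of periodic distributions in $x$) with $u\in C^3([0,T];H_p^{r+1})$, where $u(\cdot,t)$ is the continuous representative. For an even integer $N\ge 2$ let $h=L/N$, $x_j=x_L+jh$ $(0\le j\le N-1)$, $$g_j(x)=\frac1N\sum_{k=-N/2}^{N/2}\frac1{c_k}e^{ik\mu(x-x_j)},\qquad c_{\pm N/2}=2,\quad c_k=1\ (|k|\ne N/2),$$ let $\mathbb D_k$ be the matrix with entries $(\mathbb D_k)_{jl}=g_l^{(k)}(x_j)$, and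 for $\mathbf U\in\mathbb R^N$ let $$\mathbb D(\mathbf U)=a\mathbb D_1+\frac{\gamma}{3}\big(\mathrm{diag}(\mathbf U)\,\mathbb D_1+\mathbb D_1\,\mathrm{diag}(\mathbf U)\big).$$ For a positive integer $N_t$ let $\tau=T/N_t$ and $t_n=n\tau$. The linear-implicit leap-frog momentum-preserving scheme (LLF-MP) computes $\mathbf U^n\in\mathbb R^N$, $0\le n\le N_t$, from $U^0_j=u_0(x_j)$, $$(\mathbb I-\sigma\mathbb D_2)\frac{\mathbf U^{1}-\mathbf U^{0}}{\tau}+\mathbb D\Big(\frac{\mathbf U^1+\mathbf U^0}{2}\Big)\frac{\mathbf U^1+\mathbf U^0}{2}=0,$$ $$(\mathbb I-\sigma\mathbb D_2)\frac{\mathbf U^{n+1}-\mathbf U^{n-1}}{2\tau}+\mathbb D(\mathbf U^n)\frac{\mathbf U^{n+1}+\mathbf U^{n-1}}{2}=0,\qquad 1\le n\le N_t-1.$$ Then there is a constant $C>0$, independent of $N$ and $N_t$, such that for every even $N\ge2$, every $N_t\ge1$ (with no restriction relating $\tau$ and $h$) and every numerical solution $\mathbf U^0,\dots,\mathbf U^{N_t}$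 of LLF-MP, $$\max_{0\le j\le N-1}|u(x_j,t_n)-U_j^n|\le C\,(\tau^2+N^{-r}),\qquad 0\le n\le N_t.$$ -/

import Mathlib

namespace RLW

/-! The periodic interval is `[xL, xR]`, of length `L = xR - xL`. -/

/-- The potential `F(u) = γ u³ / 6` of the RLW equation. -/
noncomputable def potential (γ : ℝ) (v : ℝ) : ℝ := γ * v ^ 3 / 6

/-- The fundamental frequency `μ = 2π / (xR - xL)`. -/
noncomputable def freq (xL xR : ℝ) : ℝ := 2 * Real.pi / (xR - xL)

/-- The Fourier coefficients of `f` on `[xL, xR]`, weighted by `(1 + (μ k)²)^(s/2)`. The periodic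
Sobolev space `H_p^s` consists of the functions for which this family is square summable, and its
norm is the `ℓ²` norm of this family. -/
noncomputable def sobolevCoeff {xL xR : ℝ} (hx : xL < xR) (s : ℝ) (f : ℝ → ℝ) (k : ℤ) : ℂ :=
  (((1 + (freq xL xR * k) ^ 2) ^ (s / 2) : ℝ) : ℂ) *
    fourierCoeffOn hx (fun x => (f x : ℂ)) k

/-- `u ∈ C³([0, T]; H_p^s)` for a function `u = u(x, t)` of period `xR - xL` in `x`, which at every
time is the continuous representative of its class (this is no restriction for `s > 1/2`).
The space `H_p^s` is identified with `ℓ²(ℤ)` by the isometry `sobolevCoeff`, so that the curve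
`t ↦ u(·, t)` in `H_p^s` is the curve `v` in `ℓ²(ℤ)`; derivatives at `t = 0` and `t = T` are
one-sided. -/
structure IsC3Sobolev {xL xR : ℝ} (hx : xL < xR) (T s : ℝ) (u : ℝ → ℝ → ℝ) : Prop where
  continuous : ∀ t ∈ Set.Icc 0 T, Continuous fun x => u x t
  periodic : ∀ t ∈ Set.Icc 0 T, Function.Periodic (fun x => u x t) (xR - xL)
  contDiff : ∃ v : ℝ → lp (fun _ : ℤ => ℂ) 2, ContDiffOn ℝ 3 v (Set.Icc 0 T) ∧
    ∀ t ∈ Set.Icc 0 T, ∀ k : ℤ, v t k = sobolevCoeff hx s (fun x => u x t) k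

/-- `u` solves `u_t + a u_x - σ u_xxt + (F'(u))_x = 0`, `u(x, 0) = u₀(x)`, `u(x, t) = u(x + L, t)`
on `[0, T]`. The equation is understood in the sense of periodic distributions in `x` at every
time `t ∈ [0, T]`: tested with a smooth `L`-periodic function `φ`, it reads
`d/dt ∫ u (φ - σ φ'') dx = ∫ (a u + F'(u)) φ' dx`. -/
structure IsSolution (xL xR T a σ γ : ℝ) (u₀ : ℝ → ℝ) (u : ℝ → ℝ → ℝ) : Prop where
  equation : ∀ φ : ℝ → ℝ, ContDiff ℝ (⊤ : ℕ∞) φ → Function.Periodic φ (xR - xL) →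
    ∀ t ∈ Set.Icc 0 T,
      HasDerivWithinAt (fun t' => ∫ x in xL..xR, u x t' * (φ x - σ * iteratedDeriv 2 φ x))
        (∫ x in xL..xR, (a * u x t + deriv (potential γ) (u x t)) * deriv φ x)
        (Set.Icc 0 T) t
  initial : ∀ x ∈ Set.Icc xL xR, u x 0 = u₀ x
  periodic : ∀ t ∈ Set.Icc 0 T, Function.Periodic (fun x => u x t) (xR - xL)

/-- The grid point `x_j = xL + j h`, `h = (xR - xL) / N`. -/
noncomputable def node (xL xR : ℝ) (N : ℕ) (j : Fin N) : ℝ := xL + (j : ℝ) * ((xR - xL) / N)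

/-- The number `c_k`: it is `2` if `|k| = N / 2` and `1` otherwise. -/
noncomputable def modeWeight (N : ℕ) (k : ℤ) : ℝ := if |k| = (N : ℤ) / 2 then 2 else 1

/-- The trigonometric polynomial
`g_j(x) = (1 / N) ∑_{k = -N/2}^{N/2} (1 / c_k) exp (i k μ (x - x_j))`. -/
noncomputable def basisFnC (xL xR : ℝ) (N : ℕ) (j : Fin N) (x : ℝ) : ℂ :=
  (1 / (N : ℂ)) * ∑ k ∈ Finset.Icc (-((N : ℤ) / 2)) ((N : ℤ) / 2),
    (1 / (modeWeight N k : ℂ)) *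
      Complex.exp (Complex.I * k * freq xL xR * (x - node xL xR N j : ℝ))

/-- The function `g_j`, which takes real values, as a real function. -/
noncomputable def basisFn (xL xR : ℝ) (N : ℕ) (j : Fin N) (x : ℝ) : ℝ :=
  (basisFnC xL xR N j x).re

theorem basisFn_eq (xL xR : ℝ) (N : ℕ) (j : Fin N) (x : ℝ) :
    (basisFn xL xR N j x : ℂ) = basisFnC xL xR N j x := by
  rw [basisFn, ← Complex.conj_eq_iff_re, basisFnC, map_mul, map_sum]
  congr 1
  · simp
  · refine Finset.sum_nbij' (fun k => -k) (fun k => -k) ?_ ?_ (by simp) (by simp) ?_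
    · intro k hk
      simp only [Finset.mem_Icc] at hk ⊢
      omega
    · intro k hk
      simp only [Finset.mem_Icc] at hk ⊢
      omega
    · intro k _
      simp [modeWeight, abs_neg, ← Complex.exp_conj]

/-- The spectral differentiation matrix of order `k`, with entries `d^k g_l / dx^k (x_j)`. -/
noncomputable def diffMatrix (xL xR : ℝ) (N k : ℕ) : Matrix (Fin N) (Fin N) ℝ :=
  Matrix.of fun j l => iteratedDeriv k (basisFn xL xR N l) (node xL xR N j)

/-- The matrix `𝔻(U) = a 𝔻₁ + (γ / 3) (diag(U) 𝔻₁ + 𝔻₁ diag(U))`. -/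
noncomputable def advMatrix (xL xR a γ : ℝ) {N : ℕ} (U : Fin N → ℝ) :
    Matrix (Fin N) (Fin N) ℝ :=
  a • diffMatrix xL xR N 1 + (γ / 3) •
    (Matrix.diagonal U * diffMatrix xL xR N 1 + diffMatrix xL xR N 1 * Matrix.diagonal U)

open Matrix in
/-- `U⁰, …, U^{Nt}` is a numerical solution of the linear-implicit leap-frog momentum-preserving
scheme with `N` grid points and time step `τ`, started from the grid values of `u₀`. -/
structure IsLLFMP (xL xR a σ γ : ℝ) (u₀ : ℝ → ℝ) (N Nt : ℕ) (τ : ℝ)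
    (U : ℕ → Fin N → ℝ) : Prop where
  initial : ∀ j, U 0 j = u₀ (node xL xR N j)
  /-- The first step is a Crank-Nicolson step. -/
  first : (1 - σ • diffMatrix xL xR N 2) *ᵥ ((1 / τ) • (U 1 - U 0)) +
    advMatrix xL xR a γ ((1 / 2 : ℝ) • (U 1 + U 0)) *ᵥ ((1 / 2 : ℝ) • (U 1 + U 0)) = 0
  step : ∀ n, 1 ≤ n → n < Nt →
    (1 - σ • diffMatrix xL xR N 2) *ᵥ ((1 / (2 * τ)) • (U (n + 1) - U (n - 1))) +
      advMatrix xL xR a γ (U n) *ᵥ ((1 / 2 : ℝ) • (U (n + 1) + U (n - 1))) = 0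

/-- The discrete maximum norm `max_j |U_j|` of a grid function. -/
noncomputable def maxNorm {N : ℕ} (U : Fin N → ℝ) : ℝ := ⨆ j, |U j|

end RLW

/-!
The error is measured in the discrete energy norm `‖V‖² = (1/N) ⟨(1 - σ 𝔻₂) V, V⟩`, a weighted
`ℓ²` norm of the discrete Fourier coefficients (`energyMap`), which dominates the maximum norm
(`abs_le_energy`) and the mean squares of `V` and `𝔻₁ V`.

*Stability.* The numerical solution is compared with grid functions `Wⁿ`, and the error equation is
tested with the mean of two consecutive errors. As `𝔻(Z)` is skew-symmetric for every `Z`, the terms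
with the new error cancel whatever the numerical solution is; what remains is a multiple of
`‖Uⁿ - Wⁿ‖` and the residual of `Wⁿ` (`IsAdvectionForm.error_step`). The leap-frog steps are then
explicit inequalities and a Gronwall argument needs no bound on `τ`. In the Crank-Nicolson step the
coefficients are implicit: for small `τ` that term is absorbed, and for `τ` bounded below the
conservation of the energy bounds the error by a constant, hence by a multiple of `τ²`
(`IsAdvectionForm.error_bound`).

*Consistency.* `Wⁿ` consists of the grid values of the Fourier series of `u(·, tₙ)`, truncated to
`|k| < N / 4`. The square of the truncated series `w` is then resolved by the grid, so that
`𝔻₁ (w²) = 2 w 𝔻₁ w` holds there and the nonlinearity equals `(γ/2) 𝔻₁ (w²)` without aliasing error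
(`weakForm_of_modes`). The equation holds for each Fourier coefficient of `u`
(`IsSolution.hasDerivWithinAt_coeff`). It is used for all `|k| < N / 2`: in this way the residual
only contains the tails of `u` and `u_t` in the energy norm, which are `O(N⁻ʳ)` since both lie in
`H_p^{r+1}`, and the error of `w²` in `L²`, which is `O(N⁻ʳ)` by Bessel's inequality, as the Fourier
coefficients of `u` are summable with tails `O(N⁻ʳ)` (`abs_weakForm_le_of_modes`). The differences
in time are expanded by Taylor's formula in `H_p^{r+1}`, identified with `ℓ²`, and contribute `O(τ²)`.

*Initial error.* `U⁰ - W⁰` is the tail of the Fourier series of `u₀` on the grid. Its discrete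
Fourier coefficients collect the aliased coefficients of `u₀`; the Cauchy-Schwarz inequality over each class
of aliased wave numbers bounds its energy norm by `O(N⁻ʳ)` (`norm_energyMap_tail_le`).
-/

namespace RLW

/-! ### Energy estimate for linearly implicit skew schemes -/

section Energy

variable {X : Type*} [AddCommGroup X] [Module ℝ X]
  {E : Type*} [NormedAddCommGroup E] [InnerProductSpace ℝ E]

/-- The weak form `A Z V η = ⟨𝔻(Z) V, η⟩` of an advection operator whose coefficients depend on `Z`:
it is skew-symmetric in `(V, η)`, and bounded and Lipschitz in `Z` with constant `K` for the energy
seminorm `‖J ·‖`. -/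
structure IsAdvectionForm (J : X →ₗ[ℝ] E) (A : X → X → X → ℝ) (K : ℝ) : Prop where
  nonneg : 0 ≤ K
  add : ∀ Z V V' η, A Z (V + V') η = A Z V η + A Z V' η
  skew : ∀ Z V, A Z V V = 0
  lipschitz : ∀ Z Z' V η, |A Z V η - A Z' V η| ≤ K * ‖J (Z - Z')‖ * ‖J V‖ * ‖J η‖
  bounded : ∀ V η, |A 0 V η| ≤ K * ‖J V‖ * ‖J η‖

/-- The residual, tested with `η`, of a step from `V⁻` to `V⁺` over a time `κ`, in which the
advection coefficients are frozen at `Z` and the advected quantity is `(V⁺ + V⁻) / 2`. -/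
noncomputable def stepResidual (J : X →ₗ[ℝ] E) (A : X → X → X → ℝ) (κ : ℝ) (Z Vp Vm η : X) : ℝ :=
  inner ℝ (J ((1 / κ) • (Vp - Vm))) (J η) + A Z ((1 / 2 : ℝ) • (Vp + Vm)) η

variable {J : X →ₗ[ℝ] E} {A : X → X → X → ℝ} {K : ℝ}

theorem IsAdvectionForm.zero_middle (hA : IsAdvectionForm J A K) (Z η : X) : A Z 0 η = 0 := by
  have := hA.add Z 0 0 η
  rw [add_zero] at this
  linarith

/-- The energy norm of the error grows in one step by a multiple of the step size only. The error
equation is tested with the mean of the new and the old error: since `A` is skew, the implicit terms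
drop out whatever the numerical solution is, and no smallness of `κ` is needed. -/
theorem IsAdvectionForm.error_step (hA : IsAdvectionForm J A K) {κ ρ M : ℝ} (hκ : 0 < κ)
    (hρ : 0 ≤ ρ) {Z Zw Up Um Wp Wm : X} (hU : ∀ η, stepResidual J A κ Z Up Um η = 0)
    (hW : ∀ η, |stepResidual J A κ Zw Wp Wm η| ≤ ρ * ‖J η‖)
    (hM : ‖J ((1 / 2 : ℝ) • (Wp + Wm))‖ ≤ M) :
    ‖J (Up - Wp)‖ ≤ ‖J (Um - Wm)‖ + κ * (K * M * ‖J (Z - Zw)‖ + ρ) := by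
  set W := (1 / 2 : ℝ) • (Wp + Wm) with hWdef
  set η := (1 / 2 : ℝ) • ((Up - Wp) + (Um - Wm)) with hη
  have hK := hA.nonneg
  have hM0 : 0 ≤ M := (norm_nonneg _).trans hM
  have h1 := hU η
  have h2 := hW η
  have hmid : (1 / 2 : ℝ) • (Up + Um) = W + η := by
    rw [hWdef, hη, ← smul_add]; congr 1; abel
  rw [stepResidual, hmid, hA.add, hA.skew, add_zero] at h1
  rw [stepResidual, ← hWdef] at h2
  have h3 := hA.lipschitz Z Zw W η
  have hin : inner ℝ (J ((1 / κ) • (Up - Um))) (J η) - inner ℝ (J ((1 / κ) • (Wp - Wm))) (J η)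
      = (‖J (Up - Wp)‖ ^ 2 - ‖J (Um - Wm)‖ ^ 2) / (2 * κ) := by
    rw [← inner_sub_left, ← map_sub, ← smul_sub]
    have : Up - Um - (Wp - Wm) = (Up - Wp) - (Um - Wm) := by abel
    rw [this, hη]
    generalize Up - Wp = p
    generalize Um - Wm = q
    simp only [map_smul, map_sub, map_add, real_inner_smul_left, real_inner_smul_right,
      inner_sub_left, inner_add_right, real_inner_self_eq_norm_sq, real_inner_comm (J p) (J q)]
    field_simp
    ring
  have hηn : ‖J η‖ ≤ (‖J (Up - Wp)‖ + ‖J (Um - Wm)‖) / 2 := by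
    rw [hη, map_smul, map_add, norm_smul, Real.norm_of_nonneg (by norm_num)]
    have := norm_add_le (J (Up - Wp)) (J (Um - Wm))
    linarith
  set a := ‖J (Up - Wp)‖ with ha
  set b := ‖J (Um - Wm)‖ with hb
  have ha0 : 0 ≤ a := norm_nonneg _
  have hb0 : 0 ≤ b := norm_nonneg _
  set G := K * M * ‖J (Z - Zw)‖ + ρ with hG
  have hG0 : 0 ≤ G := by positivity
  have h4 : (a ^ 2 - b ^ 2) / (2 * κ) ≤ G * ‖J η‖ := by
    rw [← hin]
    have h5 : K * ‖J (Z - Zw)‖ * ‖J W‖ * ‖J η‖ ≤ K * M * ‖J (Z - Zw)‖ * ‖J η‖ := by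
      have : K * ‖J (Z - Zw)‖ * ‖J W‖ ≤ K * ‖J (Z - Zw)‖ * M := by gcongr
      calc _ ≤ K * ‖J (Z - Zw)‖ * M * ‖J η‖ := by gcongr
        _ = _ := by ring
    have := abs_le.1 h2
    have := abs_le.1 (h3.trans h5)
    rw [hG, add_mul]
    linarith
  have h6 : a ^ 2 - b ^ 2 ≤ κ * G * (a + b) := by
    rw [div_le_iff₀ (by positivity)] at h4
    calc _ ≤ _ := h4
      _ ≤ G * ((a + b) / 2) * (2 * κ) := by gcongr
      _ = _ := by ring
  by_contra! h
  have : 0 ≤ κ * G := by positivity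
  have : 0 < a + b := by linarith
  nlinarith

/-- A step of the scheme does not increase the energy norm. -/
theorem IsAdvectionForm.norm_step_le (hA : IsAdvectionForm J A K) {κ : ℝ} (hκ : 0 < κ)
    {Z Up Um : X} (hU : ∀ η, stepResidual J A κ Z Up Um η = 0) : ‖J Up‖ ≤ ‖J Um‖ := by
  have := hA.error_step (ρ := 0) (M := 0) (Zw := 0) (Wp := 0) (Wm := 0) hκ le_rfl hU
    (by intro η; simp [stepResidual, hA.zero_middle]) (by simp)
  simpa using this

/-- The residual of a step for the exact solution: it is controlled by the residual `ρ₀` of the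
equation at an intermediate time, and by the errors of the difference quotient and of the means. -/
theorem IsAdvectionForm.abs_stepResidual_le (hA : IsAdvectionForm J A K)
    {κ ρ₀ ρ₁ ρ₂ M : ℝ} {Z Vp Vm W W' : X} (hM : ‖J W‖ ≤ M) (hMZ : ‖J Z‖ ≤ M)
    (heq : ∀ η, |inner ℝ (J W') (J η) + A W W η| ≤ ρ₀ * ‖J η‖)
    (hdiff : ‖J ((1 / κ) • (Vp - Vm) - W')‖ ≤ ρ₁)
    (hmean : ‖J ((1 / 2 : ℝ) • (Vp + Vm) - W)‖ ≤ ρ₂) (hZ : ‖J (Z - W)‖ ≤ ρ₂) (η : X) :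
    |stepResidual J A κ Z Vp Vm η| ≤ (ρ₀ + ρ₁ + K * (1 + 2 * M) * ρ₂) * ‖J η‖ := by
  have hK := hA.nonneg
  have hM0 : 0 ≤ M := (norm_nonneg _).trans hM
  have hρ₂ : 0 ≤ ρ₂ := (norm_nonneg _).trans hmean
  set δ := (1 / 2 : ℝ) • (Vp + Vm) - W with hδ
  have e1 : (1 / 2 : ℝ) • (Vp + Vm) = W + δ := by rw [hδ]; abel
  have e2 : (1 / κ) • (Vp - Vm) = W' + ((1 / κ) • (Vp - Vm) - W') := by abel
  rw [stepResidual, e1, hA.add, e2, map_add, inner_add_left]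
  have h1 := heq η
  have h2 : |inner ℝ (J ((1 / κ) • (Vp - Vm) - W')) (J η)| ≤ ρ₁ * ‖J η‖ :=
    (abs_real_inner_le_norm _ _).trans (by gcongr)
  have h3 : |A Z W η - A W W η| ≤ K * ρ₂ * M * ‖J η‖ :=
    (hA.lipschitz Z W W η).trans (by gcongr)
  have h4 : |A Z δ η - A 0 δ η| ≤ K * M * ρ₂ * ‖J η‖ :=
    (hA.lipschitz Z 0 δ η).trans (by rw [sub_zero]; gcongr)
  have h5 : |A 0 δ η| ≤ K * ρ₂ * ‖J η‖ := (hA.bounded δ η).trans (by gcongr)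
  rw [abs_le] at *
  constructor <;> nlinarith

/-- A two-step Gronwall inequality. -/
theorem two_step_gronwall {e : ℕ → ℝ} {c d : ℝ} (hc : 0 ≤ c) (hd : 0 ≤ d) (he : ∀ n, 0 ≤ e n)
    (Nt : ℕ) (h : ∀ n, 1 ≤ n → n < Nt → e (n + 1) ≤ e (n - 1) + c * e n + d) (n : ℕ)
    (hn : n + 1 ≤ Nt) : e (n + 1) + e n ≤ Real.exp (n * c) * (e 1 + e 0 + n * d) := by
  induction n with
  | zero => simp
  | succ n ih =>
    have h1 := h (n + 1) (by omega) (by omega)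
    rw [Nat.add_sub_cancel] at h1
    have h2 := ih (by omega)
    have h3 : 1 + c ≤ Real.exp c := by linarith [Real.add_one_le_exp c]
    have h4 : 1 ≤ Real.exp ((n + 1 : ℕ) * c) := Real.one_le_exp (by positivity)
    calc e (n + 1 + 1) + e (n + 1) ≤ (1 + c) * (e (n + 1) + e n) + d := by
          nlinarith [he n, he (n + 1)]
      _ ≤ Real.exp c * (Real.exp (n * c) * (e 1 + e 0 + n * d)) + d := by
          gcongr
          have := he n; have := he (n + 1); positivity
      _ = Real.exp ((n + 1 : ℕ) * c) * (e 1 + e 0 + n * d) + d := by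
          rw [← mul_assoc, ← Real.exp_add]; congr 3; push_cast; ring
      _ ≤ Real.exp ((n + 1 : ℕ) * c) * (e 1 + e 0 + (n + 1 : ℕ) * d) := by
          push_cast at *; nlinarith

/-- Energy estimate for the error of the leap-frog scheme with a Crank-Nicolson first step. -/
theorem IsAdvectionForm.error_bound (hA : IsAdvectionForm J A K) {τ T ρ M : ℝ} (hτ : 0 < τ)
    (hρ : 0 ≤ ρ) {Nt : ℕ} (hNt : 0 < Nt) (hT : Nt * τ ≤ T) {U W : ℕ → X}
    (hU1 : ∀ η, stepResidual J A τ ((1 / 2 : ℝ) • (U 1 + U 0)) (U 1) (U 0) η = 0)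
    (hU : ∀ n, 1 ≤ n → n < Nt → ∀ η,
      stepResidual J A (2 * τ) (U n) (U (n + 1)) (U (n - 1)) η = 0)
    (hW1 : ∀ η, |stepResidual J A τ ((1 / 2 : ℝ) • (W 1 + W 0)) (W 1) (W 0) η| ≤ ρ * ‖J η‖)
    (hW : ∀ n, 1 ≤ n → n < Nt → ∀ η,
      |stepResidual J A (2 * τ) (W n) (W (n + 1)) (W (n - 1)) η| ≤ ρ * ‖J η‖)
    (hM : ∀ n, n ≤ Nt → ‖J (W n)‖ ≤ M) (n : ℕ) (hn : n ≤ Nt) :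
    ‖J (U n - W n)‖ ≤ Real.exp (2 * K * M * T) *
      (4 * ‖J (U 0 - W 0)‖ + 4 * T * ρ + 2 * K ^ 2 * M ^ 3 * τ ^ 2) := by
  have hK := hA.nonneg
  have hM0 : 0 ≤ M := (norm_nonneg _).trans (hM 0 (Nat.zero_le _))
  have hmean : ∀ m m', m ≤ Nt → m' ≤ Nt → ‖J ((1 / 2 : ℝ) • (W m + W m'))‖ ≤ M := by
    intro m m' h h'
    rw [map_smul, map_add, norm_smul, Real.norm_of_nonneg (by norm_num)]
    have := norm_add_le (J (W m)) (J (W m'))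
    have := hM m h
    have := hM m' h'
    linarith
  set e : ℕ → ℝ := fun n => ‖J (U n - W n)‖ with he
  have he0 : ∀ n, 0 ≤ e n := fun n => norm_nonneg _
  have hNtτ : τ ≤ T := by
    have : (1 : ℝ) ≤ Nt := by exact_mod_cast hNt
    nlinarith
  have hT0 : 0 < T := hτ.trans_le hNtτ
  -- For `K M τ ≤ 1` the implicit term is absorbed; for larger `τ` the energy is merely bounded,
  -- which is a bound of order `τ²` since `1 ≤ (K M τ)²`.
  have h1 : e 1 ≤ 3 * e 0 + 2 * T * ρ + 2 * K ^ 2 * M ^ 3 * τ ^ 2 := by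
    rcases le_or_gt (K * M * τ) 1 with h | h
    · have hs := hA.error_step hτ hρ hU1 hW1 (hmean 1 0 hNt (Nat.zero_le _))
      have hz : ‖J ((1 / 2 : ℝ) • (U 1 + U 0) - (1 / 2 : ℝ) • (W 1 + W 0))‖
          ≤ (e 1 + e 0) / 2 := by
        rw [← smul_sub, add_sub_add_comm, map_smul, map_add, norm_smul,
          Real.norm_of_nonneg (by norm_num)]
        have := norm_add_le (J (U 1 - W 1)) (J (U 0 - W 0))
        simp only [he]
        linarith
      have h2 : e 1 ≤ e 0 + (K * M * τ * ((e 1 + e 0) / 2) + τ * ρ) := by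
        refine hs.trans ?_
        have : K * M * τ * ‖J ((1 / 2 : ℝ) • (U 1 + U 0) - (1 / 2 : ℝ) • (W 1 + W 0))‖ ≤
          K * M * τ * ((e 1 + e 0) / 2) := by gcongr
        simp only [he] at *
        linarith
      have h3 : K * M * τ * ((e 1 + e 0) / 2) ≤ 1 * ((e 1 + e 0) / 2) := by
        have := he0 0; have := he0 1; gcongr
      have h4 : τ * ρ ≤ T * ρ := by gcongr
      have : 0 ≤ 2 * K ^ 2 * M ^ 3 * τ ^ 2 := by positivity
      linarith
    · have h2 := hA.norm_step_le hτ hU1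
      have h3 : e 1 ≤ e 0 + 2 * M := by
        have t1 : e 1 ≤ ‖J (U 1)‖ + ‖J (W 1)‖ := by
          simp only [he, map_sub]; exact norm_sub_le _ _
        have t2 : ‖J (U 0)‖ ≤ e 0 + ‖J (W 0)‖ := by
          have : J (U 0) = J (U 0 - W 0) + J (W 0) := by rw [← map_add, sub_add_cancel]
          rw [this]; exact norm_add_le _ _
        linarith [hM 0 (Nat.zero_le _), hM 1 hNt]
      have h4 : 2 * M ≤ 2 * K ^ 2 * M ^ 3 * τ ^ 2 := by
        have : 1 ≤ (K * M * τ) ^ 2 := by nlinarith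
        nlinarith
      have : 0 ≤ 2 * T * ρ := by positivity
      linarith [he0 0]
  have hstep : ∀ n, 1 ≤ n → n < Nt → e (n + 1) ≤ e (n - 1) + 2 * τ * K * M * e n + 2 * τ * ρ := by
    intro n h h'
    have := hA.error_step (κ := 2 * τ) (by positivity) hρ (hU n h h') (hW n h h')
      (hmean (n + 1) (n - 1) (by omega) (by omega))
    simp only [he] at *
    linarith
  have hpos : 0 ≤ 4 * e 0 + 4 * T * ρ + 2 * K ^ 2 * M ^ 3 * τ ^ 2 := by
    have := he0 0; positivity
  rcases n with _ | n
  · have : 1 ≤ Real.exp (2 * K * M * T) := Real.one_le_exp (by positivity)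
    have h2 : 0 ≤ 4 * T * ρ + 2 * K ^ 2 * M ^ 3 * τ ^ 2 := by positivity
    change e 0 ≤ Real.exp (2 * K * M * T) *
      (4 * e 0 + 4 * T * ρ + 2 * K ^ 2 * M ^ 3 * τ ^ 2)
    nlinarith [he0 0]
  · have hg := two_step_gronwall (by positivity) (by positivity) he0 Nt hstep n hn
    have hnτ : n * τ ≤ T := by
      refine le_trans ?_ hT
      have : (n : ℝ) ≤ Nt := by exact_mod_cast (by omega : n ≤ Nt)
      gcongr
    change e (n + 1) ≤ _
    calc e (n + 1) ≤ e (n + 1) + e n := by linarith [he0 n]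
      _ ≤ _ := hg
      _ ≤ _ := by
        have := he0 0
        have := he0 1
        gcongr ?_ * ?_
        · apply Real.exp_le_exp.2
          calc n * (2 * τ * K * M) = 2 * K * M * (n * τ) := by ring
            _ ≤ _ := by gcongr
        · have : n * (2 * τ * ρ) ≤ 2 * T * ρ := by
            calc n * (2 * τ * ρ) = 2 * (n * τ) * ρ := by ring
              _ ≤ _ := by gcongr
          change _ ≤ 4 * e 0 + 4 * T * ρ + 2 * K ^ 2 * M ^ 3 * τ ^ 2
          linarith

end Energy

/-! ### Fourier modes on the grid -/

/-- The Fourier mode `exp (i k μ x)`. -/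
noncomputable def mode (xL xR : ℝ) (k : ℤ) (x : ℝ) : ℂ :=
  Complex.exp (Complex.I * k * freq xL xR * (x : ℂ))

section Mode

variable (xL xR : ℝ)

@[simp] theorem mode_zero (x : ℝ) : mode xL xR 0 x = 1 := by simp [mode]

theorem mode_add (k l : ℤ) (x : ℝ) : mode xL xR (k + l) x = mode xL xR k x * mode xL xR l x := by
  simp only [mode, ← Complex.exp_add]; congr 1; push_cast; ring

theorem mode_neg (k : ℤ) (x : ℝ) : mode xL xR (-k) x = (starRingEnd ℂ) (mode xL xR k x) := by
  simp [mode, ← Complex.exp_conj]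

theorem mode_sub_arg (k : ℤ) (x y : ℝ) :
    mode xL xR k (x - y) = mode xL xR k x * mode xL xR (-k) y := by
  simp only [mode, ← Complex.exp_add]; congr 1; push_cast; ring

@[simp] theorem norm_mode (k : ℤ) (x : ℝ) : ‖mode xL xR k x‖ = 1 := by
  rw [mode, Complex.norm_exp]
  simp

theorem continuous_mode (k : ℤ) : Continuous (mode xL xR k) := by
  unfold mode; fun_prop

theorem hasDerivAt_mode (k : ℤ) (x : ℝ) :
    HasDerivAt (mode xL xR k) (Complex.I * k * freq xL xR * mode xL xR k x) x := by
  have h : HasDerivAt (fun x : ℝ => Complex.I * k * freq xL xR * (x : ℂ))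
      (Complex.I * k * freq xL xR * 1) x := (Complex.ofRealCLM.hasDerivAt (x := x)).const_mul _
  have h2 := h.cexp
  rw [mul_one, mul_comm (Complex.exp _)] at h2
  exact h2

variable {xL xR}

theorem mode_node (hx : xL < xR) {N : ℕ} (hN : 0 < N) (k : ℤ) (j : Fin N) :
    mode xL xR k (node xL xR N j) =
      mode xL xR k xL * Complex.exp (2 * Real.pi * Complex.I * (k / N)) ^ (j : ℕ) := by
  have h1 : (xR : ℂ) - xL ≠ 0 := by
    rw [← Complex.ofReal_sub, Complex.ofReal_ne_zero]; linarith
  have h2 : (N : ℂ) ≠ 0 := by exact_mod_cast hN.ne'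
  rw [← Complex.exp_nat_mul, mode, mode, ← Complex.exp_add]
  congr 1
  simp only [node, freq]
  push_cast
  field_simp

/-- The rotation `exp (2πi k / N)` is trivial exactly if `N ∣ k`. -/
theorem exp_div_eq_one_iff {N : ℕ} (hN : 0 < N) (k : ℤ) :
    Complex.exp (2 * Real.pi * Complex.I * (k / N)) = 1 ↔ (N : ℤ) ∣ k := by
  have h2 : (N : ℂ) ≠ 0 := by exact_mod_cast hN.ne'
  have h3 : (2 * Real.pi * Complex.I : ℂ) ≠ 0 := Complex.two_pi_I_ne_zero
  rw [Complex.exp_eq_one_iff]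
  constructor
  · rintro ⟨n, hn⟩
    refine ⟨n, ?_⟩
    rw [mul_comm (n : ℂ), mul_right_inj' h3, div_eq_iff h2] at hn
    have : k = n * N := by exact_mod_cast hn
    rw [this, mul_comm]
  · rintro ⟨n, rfl⟩
    refine ⟨n, ?_⟩
    push_cast
    field_simp

theorem exp_div_pow_eq_one {N : ℕ} (hN : 0 < N) (k : ℤ) :
    Complex.exp (2 * Real.pi * Complex.I * (k / N)) ^ N = 1 := by
  have h2 : (N : ℂ) ≠ 0 := by exact_mod_cast hN.ne'
  rw [← Complex.exp_nat_mul, Complex.exp_eq_one_iff]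
  exact ⟨k, by field_simp⟩

/-- Discrete orthogonality of the modes. -/
theorem sum_mode_node (hx : xL < xR) {N : ℕ} (hN : 0 < N) (k : ℤ) :
    ∑ j : Fin N, mode xL xR k (node xL xR N j) =
      if (N : ℤ) ∣ k then N * mode xL xR k xL else 0 := by
  simp_rw [mode_node hx hN, ← Finset.mul_sum]
  rw [Fin.sum_univ_eq_sum_range (fun j => Complex.exp (2 * Real.pi * Complex.I * (k / N)) ^ j)]
  split_ifs with h
  · rw [(exp_div_eq_one_iff hN k).2 h]; simp [mul_comm]
  · rw [geom_sum_eq (fun h' => h ((exp_div_eq_one_iff hN k).1 h')), exp_div_pow_eq_one hN]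
    simp

end Mode

/-- The wave numbers `-N/2, …, N/2` resolved by the grid. -/
noncomputable def band (N : ℕ) : Finset ℤ := Finset.Icc (-((N : ℤ) / 2)) ((N : ℤ) / 2)

theorem modeWeight_pos (N : ℕ) (k : ℤ) : 0 < modeWeight N k := by
  unfold modeWeight; split_ifs <;> norm_num

theorem modeWeight_neg (N : ℕ) (k : ℤ) : modeWeight N (-k) = modeWeight N k := by
  simp [modeWeight]

theorem modeWeight_of_lt {N : ℕ} (he : Even N) {k : ℤ} (hk : 2 * |k| < N) : modeWeight N k = 1 := by
  unfold modeWeight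
  rw [if_neg]
  intro h
  rw [h] at hk
  obtain ⟨M, rfl⟩ := he
  omega

theorem mem_band_of_lt {N : ℕ} {k : ℤ} (hk : 2 * |k| < N) : k ∈ band N := by
  rw [band, Finset.mem_Icc]
  constructor <;> cases abs_cases k <;> omega

theorem two_mul_abs_le_of_mem_band {N : ℕ} {k : ℤ} (hk : k ∈ band N) : 2 * |k| ≤ N := by
  rw [band, Finset.mem_Icc] at hk
  cases abs_cases k <;> omega

/-- The weights `1 / c_k` average the sums over the two half-open ranges of wave numbers. -/
theorem sum_band {N : ℕ} (hN : 0 < N) (he : Even N) (f : ℤ → ℂ) :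
    ∑ k ∈ band N, (1 / (modeWeight N k : ℂ)) * f k =
      1 / 2 * (∑ k ∈ Finset.Ico (-((N : ℤ) / 2)) ((N : ℤ) / 2), f k +
        ∑ k ∈ Finset.Ioc (-((N : ℤ) / 2)) ((N : ℤ) / 2), f k) := by
  obtain ⟨M, rfl⟩ := he
  have e1 : Finset.Ico (-(((M + M : ℕ) : ℤ) / 2)) (((M + M : ℕ) : ℤ) / 2) =
      (band (M + M)).filter (fun k => k < ((M + M : ℕ) : ℤ) / 2) := by
    ext k; simp only [band, Finset.mem_filter, Finset.mem_Icc, Finset.mem_Ico]; omega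
  have e2 : Finset.Ioc (-(((M + M : ℕ) : ℤ) / 2)) (((M + M : ℕ) : ℤ) / 2) =
      (band (M + M)).filter (fun k => -(((M + M : ℕ) : ℤ) / 2) < k) := by
    ext k; simp only [band, Finset.mem_filter, Finset.mem_Icc, Finset.mem_Ioc]; omega
  rw [e1, e2, Finset.sum_filter, Finset.sum_filter, ← Finset.sum_add_distrib, Finset.mul_sum]
  refine Finset.sum_congr rfl fun k hk => ?_
  rw [band, Finset.mem_Icc] at hk
  unfold modeWeight
  split_ifs with h1 h2 h3 h3 h2 h3 h3
  all_goals first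
    | (exfalso; cases abs_cases k <;> omega)
    | (push_cast; ring)

/-- The functions `g_l` are the cardinal functions of the grid. -/
theorem sum_band_mode_sub (hx : xL < xR) {N : ℕ} (hN : 0 < N) (he : Even N) (j l : Fin N) :
    ∑ k ∈ band N, (1 / (modeWeight N k : ℂ)) *
      (mode xL xR k (node xL xR N j) * mode xL xR (-k) (node xL xR N l)) =
      if j = l then (N : ℂ) else 0 := by
  have h2 : (N : ℂ) ≠ 0 := by exact_mod_cast hN.ne'
  set ζ := Complex.exp (2 * Real.pi * Complex.I * (((j : ℤ) - (l : ℤ) : ℤ) / N)) with hζ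
  have hζ0 : ζ ≠ 0 := Complex.exp_ne_zero _
  have hm : ∀ k : ℤ, mode xL xR k (node xL xR N j) * mode xL xR (-k) (node xL xR N l) = ζ ^ k := by
    intro k
    have h1 : (xR : ℂ) - xL ≠ 0 := by
      rw [← Complex.ofReal_sub, Complex.ofReal_ne_zero]; linarith
    rw [hζ, ← Complex.exp_int_mul, mode, mode, ← Complex.exp_add]
    congr 1
    simp only [node, freq]
    push_cast
    field_simp
    ring
  simp_rw [hm]
  rw [sum_band hN he]
  have hs : ∀ m : ℤ, ∑ k ∈ Finset.Ico m (m + N), ζ ^ k = ζ ^ m * ∑ i ∈ Finset.range N, ζ ^ i := by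
    intro m
    rw [Finset.mul_sum]
    symm
    refine Finset.sum_nbij' (fun i => m + i) (fun k => (k - m).toNat) ?_ ?_ ?_ ?_ ?_
    · intro i hi; simp only [Finset.mem_range, Finset.mem_Ico] at *; omega
    · intro i hi; simp only [Finset.mem_range, Finset.mem_Ico] at *; omega
    · intro i hi; simp
    · intro i hi; simp only [Finset.mem_Ico] at *; omega
    · intro i hi; rw [zpow_add₀ hζ0, zpow_natCast]
  have e1 : Finset.Ico (-((N : ℤ) / 2)) ((N : ℤ) / 2) =
      Finset.Ico (-((N : ℤ) / 2)) (-((N : ℤ) / 2) + N) := by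
    ext k; simp only [Finset.mem_Ico]; obtain ⟨M, rfl⟩ := he; omega
  have e2 : Finset.Ioc (-((N : ℤ) / 2)) ((N : ℤ) / 2) =
      Finset.Ico (-((N : ℤ) / 2) + 1) (-((N : ℤ) / 2) + 1 + N) := by
    ext k; simp only [Finset.mem_Ico, Finset.mem_Ioc]; obtain ⟨M, rfl⟩ := he; omega
  rw [e1, e2, hs, hs]
  split_ifs with h
  · have : ζ = 1 := by simp [hζ, h]
    simp [this]; ring
  · have hne : ζ ≠ 1 := by
      rw [hζ, Ne, exp_div_eq_one_iff hN]
      intro hd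
      apply h
      have h3 := Int.eq_zero_of_abs_lt_dvd hd (by
        have := j.2; have := l.2
        rw [abs_lt]; omega)
      ext; omega
    have : ζ ^ N = 1 := exp_div_pow_eq_one hN _
    rw [geom_sum_eq hne, this]
    simp

/-- The discrete Fourier coefficient of a real grid function. -/
noncomputable def dft (xL xR : ℝ) {N : ℕ} (V : Fin N → ℝ) (k : ℤ) : ℂ :=
  (1 / (N : ℂ)) * ∑ j, (V j : ℂ) * mode xL xR (-k) (node xL xR N j)

section Dft

variable {xL xR : ℝ} {N : ℕ}

theorem dft_add (V W : Fin N → ℝ) (k : ℤ) :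
    dft xL xR (V + W) k = dft xL xR V k + dft xL xR W k := by
  simp only [dft, Pi.add_apply, Complex.ofReal_add, add_mul, Finset.sum_add_distrib, mul_add]

theorem dft_smul (c : ℝ) (V : Fin N → ℝ) (k : ℤ) :
    dft xL xR (c • V) k = c * dft xL xR V k := by
  simp only [dft, Pi.smul_apply, smul_eq_mul, Complex.ofReal_mul, mul_assoc, ← Finset.mul_sum]
  ring

theorem conj_dft (V : Fin N → ℝ) (k : ℤ) :
    (starRingEnd ℂ) (dft xL xR V k) =
      (1 / (N : ℂ)) * ∑ j, (V j : ℂ) * mode xL xR k (node xL xR N j) := by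
  simp [dft, mode_neg]

/-- The mean product of two grid functions, the second one given by its modes. -/
theorem mean_mul_eq_re_sum {ι : Type*} (η G : Fin N → ℝ) (s : Finset ι) (b : ι → ℂ) (κ : ι → ℤ)
    (hG : ∀ j, G j = (∑ i ∈ s, b i * mode xL xR (κ i) (node xL xR N j)).re) :
    (1 / (N : ℝ)) * ∑ j, η j * G j =
      (∑ i ∈ s, b i * (starRingEnd ℂ) (dft xL xR η (κ i))).re := by
  have h : ∑ i ∈ s, b i * (starRingEnd ℂ) (dft xL xR η (κ i)) =
      ((1 / (N : ℝ) : ℝ) : ℂ) * ∑ j, (η j : ℂ) *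
        ∑ i ∈ s, b i * mode xL xR (κ i) (node xL xR N j) := by
    simp_rw [conj_dft, Finset.mul_sum]
    rw [Finset.sum_comm]
    refine Finset.sum_congr rfl fun j _ => Finset.sum_congr rfl fun i _ => ?_
    push_cast; ring
  rw [h, Complex.re_ofReal_mul, Complex.re_sum]
  congr 1
  refine Finset.sum_congr rfl fun j _ => ?_
  rw [Complex.re_ofReal_mul, hG]

/-- Fourier inversion on the grid. -/
theorem dft_inversion (hx : xL < xR) (hN : 0 < N) (he : Even N) (V : Fin N → ℝ) (j : Fin N) :
    (V j : ℂ) = ∑ k ∈ band N, (1 / (modeWeight N k : ℂ)) * dft xL xR V k *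
      mode xL xR k (node xL xR N j) := by
  have h2 : (N : ℂ) ≠ 0 := by exact_mod_cast hN.ne'
  have : ∑ k ∈ band N, (1 / (modeWeight N k : ℂ)) * dft xL xR V k *
      mode xL xR k (node xL xR N j) = ∑ l, (1 / (N : ℂ)) * V l *
        ∑ k ∈ band N, (1 / (modeWeight N k : ℂ)) *
          (mode xL xR k (node xL xR N j) * mode xL xR (-k) (node xL xR N l)) := by
    simp_rw [dft, Finset.mul_sum, Finset.sum_mul]
    rw [Finset.sum_comm]
    refine Finset.sum_congr rfl fun j _ => Finset.sum_congr rfl fun i _ => ?_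
    ring
  rw [this]
  simp_rw [sum_band_mode_sub hx hN he]
  simp only [mul_ite, mul_zero, Finset.sum_ite_eq, Finset.mem_univ, if_true]
  field_simp

/-- The mean product of a grid function with a sum of modes, in terms of Parseval. -/
theorem mean_mul_eq (hx : xL < xR) (hN : 0 < N) (he : Even N) (η V : Fin N → ℝ) :
    (1 / (N : ℝ)) * ∑ j, η j * V j =
      (∑ k ∈ band N, (1 / (modeWeight N k : ℂ)) * dft xL xR V k *
        (starRingEnd ℂ) (dft xL xR η k)).re :=
  mean_mul_eq_re_sum η V (band N) (fun k => (1 / (modeWeight N k : ℂ)) * dft xL xR V k) id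
    (fun j => by
      have := dft_inversion hx hN he V j
      simp only [id]
      rw [← this, Complex.ofReal_re])

theorem mean_sq_eq (hx : xL < xR) (hN : 0 < N) (he : Even N) (V : Fin N → ℝ) :
    (1 / (N : ℝ)) * ∑ j, V j ^ 2 =
      ∑ k ∈ band N, 1 / modeWeight N k * ‖dft xL xR V k‖ ^ 2 := by
  simp_rw [sq (V _)]
  rw [mean_mul_eq hx hN he, Complex.re_sum]
  refine Finset.sum_congr rfl fun k _ => ?_
  rw [mul_assoc, Complex.mul_conj, Complex.normSq_eq_norm_sq]
  have : (1 / (modeWeight N k : ℂ)) * ((‖dft xL xR V k‖ ^ 2 : ℝ) : ℂ) =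
    ((1 / modeWeight N k * ‖dft xL xR V k‖ ^ 2 : ℝ) : ℂ) := by push_cast; ring
  rw [this, Complex.ofReal_re]

end Dft

/-! ### The spectral differentiation matrices -/

section Diff

variable {xL xR : ℝ} {N : ℕ}

/-- The modal form of the `p`-th derivative of `g_l`. -/
noncomputable def basisDeriv (xL xR : ℝ) (N p : ℕ) (l : Fin N) (x : ℝ) : ℂ :=
  (1 / (N : ℂ)) * ∑ k ∈ band N, (1 / (modeWeight N k : ℂ)) *
    ((Complex.I * k * freq xL xR) ^ p * (mode xL xR k x * mode xL xR (-k) (node xL xR N l)))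

theorem ofReal_re_basisDeriv (p : ℕ) (l : Fin N) (x : ℝ) :
    ((basisDeriv xL xR N p l x).re : ℂ) = basisDeriv xL xR N p l x := by
  rw [← Complex.conj_eq_iff_re, basisDeriv, map_mul, map_sum]
  congr 1
  · simp
  · refine Finset.sum_nbij' (fun k => -k) (fun k => -k) ?_ ?_ (by simp) (by simp) ?_
    · intro k hk
      simp only [band, Finset.mem_Icc] at hk ⊢
      omega
    · intro k hk
      simp only [band, Finset.mem_Icc] at hk ⊢
      omega
    · intro k _
      simp [modeWeight_neg, mode_neg]

theorem hasDerivAt_basisDeriv (p : ℕ) (l : Fin N) (x : ℝ) :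
    HasDerivAt (basisDeriv xL xR N p l) (basisDeriv xL xR N (p + 1) l x) x := by
  unfold basisDeriv
  refine HasDerivAt.const_mul _ ?_
  refine HasDerivAt.fun_sum fun k _ => ?_
  refine HasDerivAt.const_mul _ ?_
  convert ((hasDerivAt_mode xL xR k x).mul_const (mode xL xR (-k) (node xL xR N l))).const_mul
    ((Complex.I * k * freq xL xR) ^ p) using 1
  ring

theorem iteratedDeriv_basisFn (p : ℕ) (l : Fin N) :
    iteratedDeriv p (basisFn xL xR N l) = fun x => (basisDeriv xL xR N p l x).re := by
  induction p with
  | zero =>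
    ext x
    simp only [iteratedDeriv_zero, basisFn, basisFnC, basisDeriv, pow_zero, one_mul]
    congr 2
    refine Finset.sum_congr rfl fun k _ => ?_
    rw [← mode_sub_arg, mode]
  | succ p ih =>
    rw [iteratedDeriv_succ, ih]
    ext x
    exact (Complex.reCLM.hasFDerivAt.comp_hasDerivAt x (hasDerivAt_basisDeriv p l x)).deriv

theorem diffMatrix_apply (p : ℕ) (j l : Fin N) :
    (diffMatrix xL xR N p j l : ℂ) = basisDeriv xL xR N p l (node xL xR N j) := by
  rw [diffMatrix, Matrix.of_apply, iteratedDeriv_basisFn, ofReal_re_basisDeriv]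

/-- The differentiation matrix of order `p` has the parity of `p`. -/
theorem diffMatrix_swap (p : ℕ) (j l : Fin N) :
    diffMatrix xL xR N p l j = (-1) ^ p * diffMatrix xL xR N p j l := by
  rw [← Complex.ofReal_inj]
  push_cast
  rw [diffMatrix_apply, diffMatrix_apply, basisDeriv, basisDeriv, mul_left_comm]
  congr 1
  rw [Finset.mul_sum]
  refine Finset.sum_nbij' (fun k => -k) (fun k => -k) ?_ ?_ (by simp) (by simp) ?_
  · intro k hk
    simp only [band, Finset.mem_Icc] at hk ⊢
    omega
  · intro k hk
    simp only [band, Finset.mem_Icc] at hk ⊢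
    omega
  · intro k _
    rw [modeWeight_neg, neg_neg]
    have : (Complex.I * ((-k : ℤ) : ℂ) * freq xL xR) ^ p =
        (-1) ^ p * (Complex.I * k * freq xL xR) ^ p := by
      rw [← mul_pow]; congr 1; push_cast; ring
    rw [this]
    have h1 : ((-1 : ℂ) ^ p) * (-1) ^ p = 1 := by rw [← mul_pow]; simp
    linear_combination (-(1 / (modeWeight N k : ℂ)) * (Complex.I * k * freq xL xR) ^ p *
      (mode xL xR k (node xL xR N l) * mode xL xR (-k) (node xL xR N j))) * h1

theorem sum_mul_diffMatrix_mulVec (p : ℕ) (η V : Fin N → ℝ) :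
    ∑ j, η j * (diffMatrix xL xR N p).mulVec V j =
      (-1) ^ p * ∑ j, (diffMatrix xL xR N p).mulVec η j * V j := by
  simp only [Matrix.mulVec, dotProduct, Finset.mul_sum, Finset.sum_mul]
  rw [Finset.sum_comm]
  refine Finset.sum_congr rfl fun j _ => Finset.sum_congr rfl fun l _ => ?_
  rw [diffMatrix_swap p j l]
  ring

theorem diffMatrix_mulVec (p : ℕ) (V : Fin N → ℝ) (j : Fin N) :
    ((diffMatrix xL xR N p).mulVec V j : ℂ) = ∑ k ∈ band N, (1 / (modeWeight N k : ℂ)) *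
      ((Complex.I * k * freq xL xR) ^ p * dft xL xR V k) * mode xL xR k (node xL xR N j) := by
  simp only [Matrix.mulVec, dotProduct]
  push_cast
  simp_rw [diffMatrix_apply, basisDeriv, dft, Finset.mul_sum, Finset.sum_mul]
  rw [Finset.sum_comm]
  refine Finset.sum_congr rfl fun k _ => Finset.sum_congr rfl fun l _ => ?_
  ring

/-- The differentiation matrices act exactly on trigonometric polynomials of degree less than
`N / 2`. -/
theorem diffMatrix_mulVec_of_modes (hx : xL < xR) (hN : 0 < N) (he : Even N) (p : ℕ) {ι : Type*}
    (s : Finset ι) (b : ι → ℂ) (κ : ι → ℤ) (hs : ∀ i ∈ s, 2 * |κ i| < N) {W : Fin N → ℝ}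
    (hW : ∀ j, W j = (∑ i ∈ s, b i * mode xL xR (κ i) (node xL xR N j)).re) (j : Fin N) :
    (diffMatrix xL xR N p).mulVec W j =
      (∑ i ∈ s, b i * (Complex.I * κ i * freq xL xR) ^ p *
        mode xL xR (κ i) (node xL xR N j)).re := by
  have h2 : (N : ℂ) ≠ 0 := by exact_mod_cast hN.ne'
  have key : ∀ i ∈ s, ∑ l, (diffMatrix xL xR N p j l : ℂ) * mode xL xR (κ i) (node xL xR N l) =
      (Complex.I * κ i * freq xL xR) ^ p * mode xL xR (κ i) (node xL xR N j) := by
    intro i hi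
    have hi' := hs i hi
    simp_rw [diffMatrix_apply, basisDeriv, Finset.mul_sum, Finset.sum_mul]
    rw [Finset.sum_comm]
    have : ∀ k ∈ band N, ∑ l : Fin N, 1 / (N : ℂ) * (1 / (modeWeight N k : ℂ) *
        ((Complex.I * k * freq xL xR) ^ p * (mode xL xR k (node xL xR N j) *
          mode xL xR (-k) (node xL xR N l)))) * mode xL xR (κ i) (node xL xR N l) =
        if k = κ i then (Complex.I * k * freq xL xR) ^ p * mode xL xR k (node xL xR N j)
          else 0 := by
      intro k hk
      have hk' := two_mul_abs_le_of_mem_band hk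
      have e : ∀ l : Fin N, 1 / (N : ℂ) * (1 / (modeWeight N k : ℂ) *
        ((Complex.I * k * freq xL xR) ^ p * (mode xL xR k (node xL xR N j) *
          mode xL xR (-k) (node xL xR N l)))) * mode xL xR (κ i) (node xL xR N l) =
          1 / (N : ℂ) * (1 / (modeWeight N k : ℂ) *
        ((Complex.I * k * freq xL xR) ^ p * mode xL xR k (node xL xR N j))) *
          mode xL xR (-k + κ i) (node xL xR N l) := by
        intro l; rw [mode_add]; ring
      simp_rw [e]
      rw [← Finset.mul_sum, sum_mode_node hx hN]
      by_cases hkc : k = κ i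
      · have h3 := modeWeight_of_lt he hi'
        rw [← hkc] at h3
        rw [if_pos hkc, ← hkc, neg_add_cancel, if_pos (dvd_zero _), mode_zero, h3]
        push_cast
        field_simp
      · rw [if_neg hkc, if_neg, mul_zero]
        intro hd
        have := Int.eq_zero_of_abs_lt_dvd hd (by
          rw [abs_lt]
          cases abs_cases k <;> cases abs_cases (κ i) <;> omega)
        omega
    rw [Finset.sum_congr rfl this, Finset.sum_ite_eq' , if_pos (mem_band_of_lt hi')]
  have : (∑ i ∈ s, b i * (Complex.I * κ i * freq xL xR) ^ p *
        mode xL xR (κ i) (node xL xR N j)) =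
      ∑ l, (diffMatrix xL xR N p j l : ℂ) *
        ∑ i ∈ s, b i * mode xL xR (κ i) (node xL xR N l) := by
    simp_rw [Finset.mul_sum]
    rw [Finset.sum_comm]
    refine Finset.sum_congr rfl fun i hi => ?_
    rw [mul_assoc, ← key i hi, Finset.mul_sum]
    refine Finset.sum_congr rfl fun l _ => ?_
    ring
  rw [this, Complex.re_sum]
  simp only [Matrix.mulVec, dotProduct]
  refine Finset.sum_congr rfl fun l _ => ?_
  rw [Complex.re_ofReal_mul, hW]

end Diff

/-! ### The discrete energy norm -/

/-- The symbol `1 + σ (μ k)²` of `1 - σ ∂²`. -/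
noncomputable def symbol (xL xR σ : ℝ) (k : ℤ) : ℝ := 1 + σ * (freq xL xR * k) ^ 2

theorem one_le_symbol (xL xR : ℝ) {σ : ℝ} (hσ : 0 ≤ σ) (k : ℤ) : 1 ≤ symbol xL xR σ k := by
  unfold symbol
  have : 0 ≤ σ * (freq xL xR * k) ^ 2 := by positivity
  linarith

theorem symbol_pos (xL xR : ℝ) {σ : ℝ} (hσ : 0 ≤ σ) (k : ℤ) : 0 < symbol xL xR σ k :=
  one_pos.trans_le (one_le_symbol xL xR hσ k)

theorem freq_pos {xL xR : ℝ} (hx : xL < xR) : 0 < freq xL xR := by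
  have : 0 < xR - xL := by linarith
  unfold freq; positivity

theorem summable_one_div_one_add_mul_sq {c : ℝ} (hc : 0 < c) :
    Summable fun k : ℤ => 1 / (1 + c * (k : ℝ) ^ 2) := by
  have h := ((Real.summable_one_div_int_pow (p := 2)).2 (by norm_num)).mul_left (1 / c)
  refine Summable.of_norm_bounded_eventually h ?_
  filter_upwards [Filter.eventually_cofinite_ne (0 : ℤ)] with k hk
  have hk' : (k : ℝ) ≠ 0 := by exact_mod_cast hk
  have hk2 : 0 < (k : ℝ) ^ 2 := by positivity
  rw [Real.norm_of_nonneg (by positivity), one_div_mul_one_div]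
  exact one_div_le_one_div_of_le (by positivity) (by linarith)

theorem summable_inv_symbol {xL xR : ℝ} (hx : xL < xR) {σ : ℝ} (hσ : 0 < σ) :
    Summable fun k : ℤ => 1 / symbol xL xR σ k := by
  have hμ := freq_pos hx
  refine (summable_one_div_one_add_mul_sq (c := σ * freq xL xR ^ 2) (by positivity)).congr ?_
  intro k
  rw [symbol, mul_pow, mul_assoc]

/-- The map whose Euclidean norm is the discrete energy norm: the discrete Fourier coefficients,
with the weights that turn `⟨(1 - σ 𝔻₂) V, V⟩` into a sum of squares. -/
noncomputable def energyMap (xL xR σ : ℝ) (N : ℕ) :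
    (Fin N → ℝ) →ₗ[ℝ] EuclideanSpace ℂ (band N) where
  toFun V := WithLp.toLp 2 fun k : band N =>
    (Real.sqrt (1 / modeWeight N k * symbol xL xR σ k) : ℂ) * dft xL xR V k
  map_add' V W := by
    ext k
    simp [dft_add, mul_add]
  map_smul' c V := by
    ext k
    simp [dft_smul]
    ring

section EnergyMap

variable {xL xR σ : ℝ} {N : ℕ}

theorem energyMap_apply (V : Fin N → ℝ) (k : band N) : energyMap xL xR σ N V k =
    (Real.sqrt (1 / modeWeight N k * symbol xL xR σ k) : ℂ) * dft xL xR V k := rfl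

theorem norm_energyMap_sq (hσ : 0 ≤ σ) (V : Fin N → ℝ) : ‖energyMap xL xR σ N V‖ ^ 2 =
    ∑ k ∈ band N, 1 / modeWeight N k * symbol xL xR σ k * ‖dft xL xR V k‖ ^ 2 := by
  rw [EuclideanSpace.norm_sq_eq, ← Finset.sum_coe_sort (band N)]
  refine Finset.sum_congr rfl fun k _ => ?_
  have h1 := modeWeight_pos N k
  have h2 := symbol_pos xL xR hσ k
  rw [energyMap_apply, norm_mul, mul_pow, Complex.norm_real,
    Real.norm_of_nonneg (Real.sqrt_nonneg _), Real.sq_sqrt (by positivity)]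

/-- The energy inner product is the one of the matrix `1 - σ 𝔻₂`. -/
theorem inner_energyMap (hx : xL < xR) (hN : 0 < N) (he : Even N) (hσ : 0 ≤ σ)
    (V η : Fin N → ℝ) :
    inner ℝ (energyMap xL xR σ N V) (energyMap xL xR σ N η) =
      (1 / (N : ℝ)) * ∑ j, η j * (1 - σ • diffMatrix xL xR N 2).mulVec V j := by
  rw [mean_mul_eq_re_sum (xL := xL) (xR := xR) η _ (band N)
    (fun k => (1 / (modeWeight N k : ℂ)) * symbol xL xR σ k * dft xL xR V k) id ?_]
  · rw [PiLp.inner_apply, Complex.re_sum, ← Finset.sum_coe_sort (band N)]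
    refine Finset.sum_congr rfl fun k _ => ?_
    have h1 := modeWeight_pos N k
    have h2 := symbol_pos xL xR hσ k
    rw [energyMap_apply, energyMap_apply, Complex.inner]
    simp only [map_mul, Complex.conj_ofReal, id]
    set s := Real.sqrt (1 / modeWeight N k * symbol xL xR σ k) with hs
    have hs2 : (s : ℂ) * s = (1 / (modeWeight N k : ℂ)) * symbol xL xR σ k := by
      rw [← Complex.ofReal_mul, Real.mul_self_sqrt (by positivity)]
      push_cast; rfl
    rw [← hs2, ← Complex.conj_re]
    congr 1
    simp only [map_mul, Complex.conj_conj, Complex.conj_ofReal]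
    ring
  · intro j
    rw [Matrix.sub_mulVec, Matrix.one_mulVec, Matrix.smul_mulVec, Pi.sub_apply, Pi.smul_apply,
      smul_eq_mul]
    rw [← Complex.ofReal_re (V j - σ * _)]
    congr 1
    push_cast
    rw [diffMatrix_mulVec]
    rw [dft_inversion hx hN he V j, Finset.mul_sum, ← Finset.sum_sub_distrib]
    refine Finset.sum_congr rfl fun k _ => ?_
    simp only [symbol, id]
    push_cast
    linear_combination (-(1 / (modeWeight N k : ℂ)) * σ * (k * freq xL xR) ^ 2 * dft xL xR V k *
      mode xL xR k (node xL xR N j)) * Complex.I_sq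

theorem mean_sq_le_energy (hx : xL < xR) (hN : 0 < N) (he : Even N) (hσ : 0 ≤ σ)
    (V : Fin N → ℝ) : (1 / (N : ℝ)) * ∑ j, V j ^ 2 ≤ ‖energyMap xL xR σ N V‖ ^ 2 := by
  rw [mean_sq_eq hx hN he, norm_energyMap_sq hσ]
  refine Finset.sum_le_sum fun k _ => ?_
  have h1 := modeWeight_pos N k
  have h2 := one_le_symbol xL xR hσ k
  gcongr
  exact le_mul_of_one_le_right (by positivity) h2

theorem mean_sq_diffMatrix_le_energy (hx : xL < xR) (hN : 0 < N) (he : Even N) (hσ : 0 < σ)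
    (V : Fin N → ℝ) : (1 / (N : ℝ)) * ∑ j, (diffMatrix xL xR N 1).mulVec V j ^ 2 ≤
      ‖energyMap xL xR σ N V‖ ^ 2 / σ := by
  set G := (diffMatrix xL xR N 1).mulVec V with hG
  have h1 : (1 / (N : ℝ)) * ∑ j, G j ^ 2 = (∑ k ∈ band N, (1 / (modeWeight N k : ℂ)) *
      ((Complex.I * k * freq xL xR) ^ 1 * dft xL xR V k) *
        (starRingEnd ℂ) (dft xL xR G k)).re := by
    simp_rw [sq]
    exact mean_mul_eq_re_sum (xL := xL) (xR := xR) G G (band N)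
      (fun k => (1 / (modeWeight N k : ℂ)) * ((Complex.I * k * freq xL xR) ^ 1 * dft xL xR V k)) id (fun j => by
        rw [← Complex.ofReal_re (G j), hG, diffMatrix_mulVec]; rfl)
  have h2 := mean_sq_eq hx hN he G
  -- `𝔻₁` is a Fourier multiplier followed by the projection onto the grid modes, so `‖𝔻₁ V‖²` is a
  -- mean product of `𝔻₁ V` with the multiplier; Young's inequality absorbs the first factor.
  have h3 : (1 / (N : ℝ)) * ∑ j, G j ^ 2 ≤ ∑ k ∈ band N,
      (1 / 2 * (1 / modeWeight N k * symbol xL xR σ k *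
        ‖dft xL xR V k‖ ^ 2 / σ) + 1 / 2 * (1 / modeWeight N k * ‖dft xL xR G k‖ ^ 2)) := by
    rw [h1, Complex.re_sum]
    refine Finset.sum_le_sum fun k _ => ?_
    have hc := modeWeight_pos N k
    refine (Complex.re_le_norm _).trans ?_
    have e : ‖(1 / (modeWeight N k : ℂ)) * ((Complex.I * k * freq xL xR) ^ 1 * dft xL xR V k) *
        (starRingEnd ℂ) (dft xL xR G k)‖ = 1 / modeWeight N k *
          (|freq xL xR * k| * ‖dft xL xR V k‖ * ‖dft xL xR G k‖) := by
      simp [abs_of_pos hc, abs_mul]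
      ring
    rw [e]
    have h4 : (freq xL xR * k) ^ 2 ≤ symbol xL xR σ k / σ := by
      rw [le_div_iff₀ hσ, symbol]; linarith
    have h5 : |freq xL xR * k| * ‖dft xL xR V k‖ * ‖dft xL xR G k‖ ≤
        1 / 2 * ((freq xL xR * k) ^ 2 * ‖dft xL xR V k‖ ^ 2) + 1 / 2 * ‖dft xL xR G k‖ ^ 2 := by
      rw [← sq_abs (freq xL xR * k)]
      nlinarith [sq_nonneg (|freq xL xR * k| * ‖dft xL xR V k‖ - ‖dft xL xR G k‖)]
    have h6 : (freq xL xR * k) ^ 2 * ‖dft xL xR V k‖ ^ 2 ≤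
        symbol xL xR σ k / σ * ‖dft xL xR V k‖ ^ 2 := by gcongr
    calc _ ≤ 1 / modeWeight N k * (1 / 2 * (symbol xL xR σ k / σ * ‖dft xL xR V k‖ ^ 2) +
        1 / 2 * ‖dft xL xR G k‖ ^ 2) := by gcongr; linarith
      _ = _ := by ring
  rw [Finset.sum_add_distrib, ← Finset.mul_sum, ← Finset.mul_sum, ← h2] at h3
  rw [← Finset.sum_div, ← norm_energyMap_sq hσ.le] at h3
  linarith

/-- The constant of the discrete Sobolev inequality. -/
noncomputable def sobolevConst (xL xR σ : ℝ) : ℝ :=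
  Real.sqrt (∑' k : ℤ, 1 / symbol xL xR σ k)

/-- The discrete Sobolev inequality. -/
theorem abs_le_energy (hx : xL < xR) (hN : 0 < N) (he : Even N) (hσ : 0 < σ)
    (V : Fin N → ℝ) (j : Fin N) : |V j| ≤ sobolevConst xL xR σ * ‖energyMap xL xR σ N V‖ := by
  have h1 : |V j| ≤ ∑ k ∈ band N, 1 / modeWeight N k * ‖dft xL xR V k‖ := by
    rw [← Real.norm_eq_abs, ← Complex.norm_real, dft_inversion hx hN he V j]
    refine (norm_sum_le _ _).trans (Finset.sum_le_sum fun k _ => ?_)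
    simp [abs_of_pos (modeWeight_pos N k)]
  refine h1.trans (abs_le_of_sq_le_sq' ?_ (by unfold sobolevConst; positivity)).2
  rw [mul_pow, norm_energyMap_sq hσ.le, sobolevConst, Real.sq_sqrt
    (tsum_nonneg fun k => (one_div_pos.2 (symbol_pos xL xR hσ.le k)).le)]
  have h2 := Finset.sum_sq_le_sum_mul_sum_of_sq_le_mul (band N)
    (r := fun k => 1 / modeWeight N k * ‖dft xL xR V k‖)
    (f := fun k => 1 / modeWeight N k * (1 / symbol xL xR σ k))
    (g := fun k => 1 / modeWeight N k * symbol xL xR σ k * ‖dft xL xR V k‖ ^ 2)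
    (fun k _ => by
      have := modeWeight_pos N k; have := symbol_pos xL xR hσ.le k; positivity)
    (fun k _ => by
      have := modeWeight_pos N k; have := symbol_pos xL xR hσ.le k; positivity)
    (fun k _ => le_of_eq (by
      have := (modeWeight_pos N k).ne'; have := (symbol_pos xL xR hσ.le k).ne'; field_simp))
  refine h2.trans ?_
  gcongr
  · exact Finset.sum_nonneg fun k _ => by
      have := modeWeight_pos N k; have := symbol_pos xL xR hσ.le k; positivity
  · refine le_trans (Finset.sum_le_sum fun k _ => ?_)
      ((summable_inv_symbol hx hσ).sum_le_tsum (band N)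
        fun k _ => (one_div_pos.2 (symbol_pos xL xR hσ.le k)).le)
    have := symbol_pos xL xR hσ.le k
    apply mul_le_of_le_one_left (by positivity)
    rw [modeWeight]; split_ifs <;> norm_num

end EnergyMap

/-! ### The scheme in weak form -/

/-- The advection form `⟨𝔻(Z) V, η⟩`, with the mean product on the grid. -/
noncomputable def advForm (xL xR a γ : ℝ) {N : ℕ} (Z V η : Fin N → ℝ) : ℝ :=
  (1 / (N : ℝ)) * ∑ j, η j * (advMatrix xL xR a γ Z).mulVec V j

section AdvForm

variable {xL xR σ a γ : ℝ} {N : ℕ}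

theorem advMatrix_mulVec (Z V : Fin N → ℝ) (j : Fin N) :
    (advMatrix xL xR a γ Z).mulVec V j = a * (diffMatrix xL xR N 1).mulVec V j +
      γ / 3 * (Z j * (diffMatrix xL xR N 1).mulVec V j +
        (diffMatrix xL xR N 1).mulVec (fun i => Z i * V i) j) := by
  have h1 : (Matrix.diagonal Z).mulVec ((diffMatrix xL xR N 1).mulVec V) j =
      Z j * (diffMatrix xL xR N 1).mulVec V j := Matrix.mulVec_diagonal _ _ _
  have h2 : (Matrix.diagonal Z).mulVec V = fun i => Z i * V i :=
    funext fun i => Matrix.mulVec_diagonal _ _ _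
  simp only [advMatrix, Matrix.add_mulVec, Matrix.smul_mulVec, Pi.add_apply, Pi.smul_apply,
    smul_eq_mul, ← Matrix.mulVec_mulVec, h1, h2]

theorem advForm_eq (Z V η : Fin N → ℝ) : advForm xL xR a γ Z V η =
    a * ((1 / (N : ℝ)) * ∑ j, η j * (diffMatrix xL xR N 1).mulVec V j) +
      γ / 3 * ((1 / (N : ℝ)) * ∑ j, η j * Z j * (diffMatrix xL xR N 1).mulVec V j -
        (1 / (N : ℝ)) * ∑ j, (diffMatrix xL xR N 1).mulVec η j * Z j * V j) := by
  have h := sum_mul_diffMatrix_mulVec (xL := xL) (xR := xR) 1 η (fun i => Z i * V i)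
  have e : ∀ j, η j * (advMatrix xL xR a γ Z).mulVec V j =
      a * (η j * (diffMatrix xL xR N 1).mulVec V j) + (γ / 3 * (η j * Z j *
        (diffMatrix xL xR N 1).mulVec V j) + γ / 3 * (η j *
          (diffMatrix xL xR N 1).mulVec (fun i => Z i * V i) j)) := by
    intro j; rw [advMatrix_mulVec]; ring
  simp_rw [advForm, e, Finset.sum_add_distrib, ← Finset.mul_sum, h, mul_assoc]
  ring

/-- Cauchy-Schwarz for mean products on the grid, with a bounded factor. -/
theorem abs_mean_mul_mul_le {A Z B : Fin N → ℝ} {α z β : ℝ} (hα : 0 ≤ α) (hβ : 0 ≤ β)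
    (hz : 0 ≤ z) (hA : (1 / (N : ℝ)) * ∑ j, A j ^ 2 ≤ α ^ 2)
    (hB : (1 / (N : ℝ)) * ∑ j, B j ^ 2 ≤ β ^ 2) (hZ : ∀ j, |Z j| ≤ z) :
    |(1 / (N : ℝ)) * ∑ j, A j * Z j * B j| ≤ z * α * β := by
  have h1 : |∑ j, A j * Z j * B j| ≤ z * ∑ j, |A j| * |B j| := by
    rw [Finset.mul_sum]
    refine (Finset.abs_sum_le_sum_abs _ _).trans (Finset.sum_le_sum fun j _ => ?_)
    rw [abs_mul, abs_mul]
    nlinarith [mul_le_mul_of_nonneg_left (hZ j) (mul_nonneg (abs_nonneg (A j)) (abs_nonneg (B j)))]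
  have h2 : (1 / (N : ℝ)) * ∑ j, |A j| * |B j| ≤ α * β := by
    refine (abs_le_of_sq_le_sq' ?_ (by positivity)).2
    have h3 := Finset.sum_mul_sq_le_sq_mul_sq Finset.univ (fun j => |A j|) (fun j => |B j|)
    simp only [sq_abs] at h3
    calc ((1 / (N : ℝ)) * ∑ j, |A j| * |B j|) ^ 2
        = (1 / (N : ℝ)) ^ 2 * (∑ j, |A j| * |B j|) ^ 2 := by ring
      _ ≤ (1 / (N : ℝ)) ^ 2 * ((∑ j, A j ^ 2) * ∑ j, B j ^ 2) := by gcongr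
      _ = ((1 / (N : ℝ)) * ∑ j, A j ^ 2) * ((1 / (N : ℝ)) * ∑ j, B j ^ 2) := by ring
      _ ≤ α ^ 2 * β ^ 2 := by
        gcongr
      _ = (α * β) ^ 2 := by ring
  rw [abs_mul, abs_of_nonneg (by positivity)]
  calc _ ≤ (1 / (N : ℝ)) * (z * ∑ j, |A j| * |B j|) := by gcongr
    _ = z * ((1 / (N : ℝ)) * ∑ j, |A j| * |B j|) := by ring
    _ ≤ z * (α * β) := by gcongr
    _ = _ := by ring

/-- The Lipschitz constant of the advection form in the energy norm. -/
noncomputable def advConst (xL xR a σ γ : ℝ) : ℝ :=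
  (a + 2 * γ / 3 * sobolevConst xL xR σ) / Real.sqrt σ

theorem isAdvectionForm_advForm (hx : xL < xR) (hN : 0 < N) (he : Even N) (hσ : 0 < σ)
    (ha : 0 ≤ a) (hγ : 0 ≤ γ) :
    IsAdvectionForm (energyMap xL xR σ N) (advForm xL xR a γ) (advConst xL xR a σ γ) := by
  have hS : 0 ≤ sobolevConst xL xR σ := Real.sqrt_nonneg _
  have hsσ : 0 < Real.sqrt σ := Real.sqrt_pos.2 hσ
  have hdiff : ∀ V : Fin N → ℝ, (1 / (N : ℝ)) * ∑ j, (diffMatrix xL xR N 1).mulVec V j ^ 2 ≤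
      (‖energyMap xL xR σ N V‖ / Real.sqrt σ) ^ 2 := by
    intro V
    rw [div_pow, Real.sq_sqrt hσ.le]
    exact mean_sq_diffMatrix_le_energy hx hN he hσ V
  refine ⟨by unfold advConst; positivity, ?_, ?_, ?_, ?_⟩
  · intro Z V V' η
    simp only [advForm, Matrix.mulVec_add, Pi.add_apply, mul_add, Finset.sum_add_distrib]
  · intro Z V
    have h := sum_mul_diffMatrix_mulVec (xL := xL) (xR := xR) 1 V V
    have h2 : ∑ j, (diffMatrix xL xR N 1).mulVec V j * V j =
        ∑ j, V j * (diffMatrix xL xR N 1).mulVec V j :=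
      Finset.sum_congr rfl fun j _ => mul_comm _ _
    have h3 : ∑ j, (diffMatrix xL xR N 1).mulVec V j * Z j * V j =
        ∑ j, V j * Z j * (diffMatrix xL xR N 1).mulVec V j :=
      Finset.sum_congr rfl fun j _ => by ring
    rw [h2, pow_one] at h
    have h4 : ∑ j, V j * (diffMatrix xL xR N 1).mulVec V j = 0 := by linarith
    rw [advForm_eq, h3, h4]
    ring
  · intro Z Z' V η
    have e : advForm xL xR a γ Z V η - advForm xL xR a γ Z' V η =
        γ / 3 * ((1 / (N : ℝ)) * ∑ j, η j * (Z - Z') j * (diffMatrix xL xR N 1).mulVec V j -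
        (1 / (N : ℝ)) * ∑ j, (diffMatrix xL xR N 1).mulVec η j * (Z - Z') j * V j) := by
      simp only [advForm_eq, Pi.sub_apply, mul_sub, sub_mul, Finset.sum_sub_distrib]
      ring
    have hζ := fun j => abs_le_energy hx hN he hσ (Z - Z') j
    have h1 := abs_mean_mul_mul_le (norm_nonneg _)
      (div_nonneg (norm_nonneg _) hsσ.le) (by positivity)
      (mean_sq_le_energy hx hN he hσ.le η) (hdiff V) hζ
    have h2 := abs_mean_mul_mul_le (div_nonneg (norm_nonneg _) hsσ.le) (norm_nonneg _)
      (by positivity) (hdiff η) (mean_sq_le_energy hx hN he hσ.le V) hζ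
    rw [e, abs_mul, abs_of_nonneg (by positivity : 0 ≤ γ / 3)]
    have h3 := (abs_sub _ _).trans (add_le_add h1 h2)
    calc _ ≤ γ / 3 * _ := mul_le_mul_of_nonneg_left h3 (by positivity)
      _ = 2 * γ / 3 * sobolevConst xL xR σ / Real.sqrt σ * ‖energyMap xL xR σ N (Z - Z')‖ *
          ‖energyMap xL xR σ N V‖ * ‖energyMap xL xR σ N η‖ := by ring
      _ ≤ _ := by
        unfold advConst
        gcongr
        linarith
  · intro V η
    have h1 := abs_mean_mul_mul_le (Z := fun _ => 1) (z := 1) (norm_nonneg _)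
      (div_nonneg (norm_nonneg _) hsσ.le) (by positivity)
      (mean_sq_le_energy hx hN he hσ.le η) (hdiff V) (by simp)
    simp only [mul_one, one_mul] at h1
    rw [advForm_eq]
    simp only [Pi.zero_apply, mul_zero, zero_mul, Finset.sum_const_zero, sub_zero, add_zero]
    rw [abs_mul, abs_of_nonneg ha]
    calc _ ≤ a * _ := mul_le_mul_of_nonneg_left h1 ha
      _ = a / Real.sqrt σ * ‖energyMap xL xR σ N V‖ * ‖energyMap xL xR σ N η‖ := by ring
      _ ≤ _ := by
        unfold advConst
        gcongr
        have : 0 ≤ 2 * γ / 3 * sobolevConst xL xR σ := by positivity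
        linarith

/-- A step of the scheme has zero residual in the weak form. -/
theorem stepResidual_eq_zero (hx : xL < xR) (hN : 0 < N) (he : Even N) (hσ : 0 ≤ σ) {κ : ℝ}
    {Z Up Um : Fin N → ℝ}
    (h : (1 - σ • diffMatrix xL xR N 2).mulVec ((1 / κ) • (Up - Um)) +
      (advMatrix xL xR a γ Z).mulVec ((1 / 2 : ℝ) • (Up + Um)) = 0) (η : Fin N → ℝ) :
    stepResidual (energyMap xL xR σ N) (advForm xL xR a γ) κ Z Up Um η = 0 := by
  rw [stepResidual, inner_energyMap hx hN he hσ, advForm, ← mul_add, ← Finset.sum_add_distrib]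
  simp_rw [← mul_add, ← Pi.add_apply (f := fun _ => _)]
  rw [h]
  simp

end AdvForm

/-! ### Trigonometric polynomials on the grid -/

section Trig

variable {xL xR σ a γ : ℝ} {N : ℕ}

theorem energy_sum_le (hσ : 0 ≤ σ) (he : Even N) (η : Fin N → ℝ) {s : Finset ℤ}
    (hs : ∀ k ∈ s, 2 * |k| < N) :
    ∑ k ∈ s, symbol xL xR σ k * ‖dft xL xR η k‖ ^ 2 ≤ ‖energyMap xL xR σ N η‖ ^ 2 := by
  rw [norm_energyMap_sq hσ]
  refine le_trans (Finset.sum_le_sum fun k hk => ?_) (Finset.sum_le_sum_of_subset_of_nonneg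
    (fun k hk => mem_band_of_lt (hs k hk)) fun k _ _ => ?_)
  · rw [modeWeight_of_lt he (hs k hk)]; simp
  · have := modeWeight_pos N k
    have := symbol_pos xL xR hσ k
    positivity

/-- Duality between the energy norm and its dual norm on trigonometric polynomials. -/
theorem abs_re_sum_mul_conj_dft_le (hσ : 0 ≤ σ) (he : Even N) (η : Fin N → ℝ) {s : Finset ℤ}
    (hs : ∀ k ∈ s, 2 * |k| < N) (b : ℤ → ℂ) {ρ : ℝ} (hρ : 0 ≤ ρ)
    (hb : ∑ k ∈ s, ‖b k‖ ^ 2 / symbol xL xR σ k ≤ ρ ^ 2) :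
    |(∑ k ∈ s, b k * (starRingEnd ℂ) (dft xL xR η k)).re| ≤
      ρ * ‖energyMap xL xR σ N η‖ := by
  refine (Complex.abs_re_le_norm _).trans ((norm_sum_le _ _).trans
    (abs_le_of_sq_le_sq' ?_ (by positivity)).2)
  rw [mul_pow]
  have h2 := Finset.sum_sq_le_sum_mul_sum_of_sq_le_mul s
    (r := fun k => ‖b k * (starRingEnd ℂ) (dft xL xR η k)‖)
    (f := fun k => ‖b k‖ ^ 2 / symbol xL xR σ k)
    (g := fun k => symbol xL xR σ k * ‖dft xL xR η k‖ ^ 2)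
    (fun k _ => by have := symbol_pos xL xR hσ k; positivity)
    (fun k _ => by have := symbol_pos xL xR hσ k; positivity)
    (fun k _ => le_of_eq (by
      have := (symbol_pos xL xR hσ k).ne'
      rw [norm_mul, RCLike.norm_conj]; field_simp))
  refine h2.trans (mul_le_mul hb (energy_sum_le hσ he η hs) ?_ (by positivity))
  exact Finset.sum_nonneg fun k _ => by have := symbol_pos xL xR hσ k; positivity

theorem inner_energyMap_of_modes (hx : xL < xR) (hN : 0 < N) (he : Even N) (hσ : 0 ≤ σ)
    {s : Finset ℤ} (hs : ∀ k ∈ s, 2 * |k| < N) (c : ℤ → ℂ) {W : Fin N → ℝ}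
    (hW : ∀ j, W j = (∑ k ∈ s, c k * mode xL xR k (node xL xR N j)).re) (η : Fin N → ℝ) :
    inner ℝ (energyMap xL xR σ N W) (energyMap xL xR σ N η) =
      (∑ k ∈ s, symbol xL xR σ k * c k * (starRingEnd ℂ) (dft xL xR η k)).re := by
  rw [inner_energyMap hx hN he hσ]
  refine mean_mul_eq_re_sum η _ s (fun k => symbol xL xR σ k * c k) id fun j => ?_
  rw [Matrix.sub_mulVec, Matrix.one_mulVec, Matrix.smul_mulVec, Pi.sub_apply, Pi.smul_apply,
      smul_eq_mul, hW, diffMatrix_mulVec_of_modes hx hN he 2 s c id hs hW, ← Complex.re_ofReal_mul,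
      ← Complex.sub_re, Finset.mul_sum, ← Finset.sum_sub_distrib]
  congr 1
  refine Finset.sum_congr rfl fun k _ => ?_
  simp only [symbol, id]
  push_cast
  linear_combination (-(σ : ℂ) * (k * freq xL xR) ^ 2 * c k *
      mode xL xR k (node xL xR N j)) * Complex.I_sq

theorem norm_energyMap_sq_le_of_modes (hx : xL < xR) (hN : 0 < N) (he : Even N) (hσ : 0 ≤ σ)
    {s : Finset ℤ} (hs : ∀ k ∈ s, 2 * |k| < N) (c : ℤ → ℂ) {W : Fin N → ℝ}
    (hW : ∀ j, W j = (∑ k ∈ s, c k * mode xL xR k (node xL xR N j)).re) {ρ : ℝ} (hρ : 0 ≤ ρ)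
    (hc : ∑ k ∈ s, symbol xL xR σ k * ‖c k‖ ^ 2 ≤ ρ ^ 2) :
    ‖energyMap xL xR σ N W‖ ≤ ρ := by
  have h1 := inner_energyMap_of_modes hx hN he hσ hs c hW W
  rw [real_inner_self_eq_norm_sq] at h1
  have h2 := abs_re_sum_mul_conj_dft_le hσ he W hs (fun k => symbol xL xR σ k * c k) hρ (by
    refine le_trans (le_of_eq (Finset.sum_congr rfl fun k _ => ?_)) hc
    have h := symbol_pos xL xR hσ k
    rw [norm_mul, Complex.norm_real, Real.norm_of_nonneg h.le]
    field_simp)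
  rw [← h1, abs_of_nonneg (sq_nonneg _)] at h2
  by_contra! h
  nlinarith

/-- The weak form of the equation for a trigonometric polynomial `w` of degree less than `N / 4`.
The product `w²` has degree less than `N / 2`, so that it is not aliased and the product rule
`𝔻₁ (w²) = 2 w 𝔻₁ w` holds on the grid. -/
theorem weakForm_of_modes (hx : xL < xR) (hN : 0 < N) (he : Even N) (hσ : 0 ≤ σ)
    {s S : Finset ℤ} (hs : ∀ k ∈ s, 4 * |k| < N) (hS : ∀ k, k ∈ S ↔ 2 * |k| < N)
    (c c' : ℤ → ℂ) {W W' : Fin N → ℝ}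
    (hW : ∀ j, (W j : ℂ) = ∑ k ∈ s, c k * mode xL xR k (node xL xR N j))
    (hW' : ∀ j, W' j = (∑ k ∈ s, c' k * mode xL xR k (node xL xR N j)).re) (η : Fin N → ℝ) :
    inner ℝ (energyMap xL xR σ N W') (energyMap xL xR σ N η) + advForm xL xR a γ W W η =
      (∑ k ∈ s, (symbol xL xR σ k * c' k + a * (Complex.I * k * freq xL xR) * c k) *
          (starRingEnd ℂ) (dft xL xR η k)).re +
        (∑ m ∈ S, γ / 2 * (Complex.I * m * freq xL xR) *
          (∑ k ∈ s, ∑ l ∈ s, c k * c l * if m = k + l then 1 else 0) *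
            (starRingEnd ℂ) (dft xL xR η m)).re := by
  have hs2 : ∀ k ∈ s, 2 * |k| < N := fun k hk => by
    have := hs k hk; have := abs_nonneg k; omega
  have hWre : ∀ j, W j = (∑ k ∈ s, c k * mode xL xR k (node xL xR N j)).re := fun j => by
    rw [← hW, Complex.ofReal_re]
  have hsum : ∀ i ∈ s ×ˢ s, 2 * |i.1 + i.2| < N := fun i hi => by
    rw [Finset.mem_product] at hi
    have := hs _ hi.1; have := hs _ hi.2; have := abs_add_le i.1 i.2; omega
  have hD := diffMatrix_mulVec_of_modes hx hN he 1 s c id hs2 hWre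
  have hsq : ∀ j, W j * W j = (∑ i ∈ s ×ˢ s, c i.1 * c i.2 *
      mode xL xR (i.1 + i.2) (node xL xR N j)).re := by
    intro j
    rw [← Complex.ofReal_re (W j * W j), Complex.ofReal_mul, hW, Finset.sum_mul_sum,
      ← Finset.sum_product']
    congr 1
    refine Finset.sum_congr rfl fun i _ => ?_
    rw [mode_add]; ring
  have hD2 := diffMatrix_mulVec_of_modes hx hN he 1 (s ×ˢ s) (fun i => c i.1 * c i.2)
    (fun i => i.1 + i.2) hsum hsq
  have hprod : ∀ j, W j * (diffMatrix xL xR N 1).mulVec W j =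
      1 / 2 * (diffMatrix xL xR N 1).mulVec (fun i => W i * W i) j := by
    intro j
    rw [hD, hD2, ← Complex.re_ofReal_mul]
    have : (∑ i ∈ s ×ˢ s, c i.1 * c i.2 * (Complex.I * ((i.1 + i.2 : ℤ) : ℂ) * freq xL xR) ^ 1 *
        mode xL xR (i.1 + i.2) (node xL xR N j)) = 2 * ((W j : ℂ) *
          ∑ k ∈ s, c k * (Complex.I * k * freq xL xR) ^ 1 * mode xL xR k (node xL xR N j)) := by
      have e1 : (W j : ℂ) * ∑ k ∈ s, c k * (Complex.I * k * freq xL xR) ^ 1 *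
          mode xL xR k (node xL xR N j) = ∑ i ∈ s ×ˢ s, c i.1 * c i.2 *
            (Complex.I * i.2 * freq xL xR) * mode xL xR (i.1 + i.2) (node xL xR N j) := by
        rw [hW, Finset.sum_mul_sum, ← Finset.sum_product']
        refine Finset.sum_congr rfl fun i _ => ?_
        rw [mode_add]; ring
      have e2 : (W j : ℂ) * ∑ k ∈ s, c k * (Complex.I * k * freq xL xR) ^ 1 *
          mode xL xR k (node xL xR N j) = ∑ i ∈ s ×ˢ s, c i.1 * c i.2 *
            (Complex.I * i.1 * freq xL xR) * mode xL xR (i.1 + i.2) (node xL xR N j) := by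
        rw [hW, mul_comm, Finset.sum_mul_sum, ← Finset.sum_product']
        refine Finset.sum_congr rfl fun i _ => ?_
        rw [mode_add]; ring
      rw [two_mul]
      nth_rewrite 1 [e2]
      rw [e1, ← Finset.sum_add_distrib]
      refine Finset.sum_congr rfl fun i _ => ?_
      push_cast; ring
    rw [this, Complex.re_ofReal_mul, ← Complex.ofReal_ofNat, Complex.re_ofReal_mul,
      Complex.re_ofReal_mul]
    simp only [id]
    ring
  have hadv : ∀ j, (advMatrix xL xR a γ W).mulVec W j =
      a * (diffMatrix xL xR N 1).mulVec W j +
        γ / 2 * (diffMatrix xL xR N 1).mulVec (fun i => W i * W i) j := by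
    intro j
    rw [advMatrix_mulVec, hprod]; ring
  have h1 := mean_mul_eq_re_sum (xL := xL) (xR := xR) η _ s
    (fun k => c k * (Complex.I * k * freq xL xR) ^ 1) id hD
  have h2 := mean_mul_eq_re_sum (xL := xL) (xR := xR) η _ (s ×ˢ s)
    (fun i => c i.1 * c i.2 * (Complex.I * ((i.1 + i.2 : ℤ) : ℂ) * freq xL xR) ^ 1)
    (fun i => i.1 + i.2) hD2
  have h3 : advForm xL xR a γ W W η =
      a * ((1 / (N : ℝ)) * ∑ j, η j * (diffMatrix xL xR N 1).mulVec W j) + γ / 2 *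
        ((1 / (N : ℝ)) * ∑ j, η j * (diffMatrix xL xR N 1).mulVec (fun i => W i * W i) j) := by
    simp only [advForm, hadv, Finset.mul_sum, ← Finset.sum_add_distrib]
    refine Finset.sum_congr rfl fun j _ => ?_
    ring
  rw [inner_energyMap_of_modes hx hN he hσ hs2 c' hW', h3, h1, h2, ← add_assoc,
    ← Complex.re_ofReal_mul, ← Complex.re_ofReal_mul, ← Complex.add_re, Finset.mul_sum,
    ← Finset.sum_add_distrib]
  congr 2
  · refine Finset.sum_congr rfl fun k _ => ?_
    simp only [id]
    ring
  · rw [Finset.sum_product, Finset.mul_sum]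
    simp_rw [Finset.mul_sum, Finset.sum_mul]
    rw [Finset.sum_comm (s := S)]
    refine Finset.sum_congr rfl fun k hk => ?_
    rw [Finset.sum_comm (s := S)]
    refine Finset.sum_congr rfl fun l hl => ?_
    have hm : k + l ∈ S := (hS _).2 (hsum (k, l) (Finset.mk_mem_product hk hl))
    rw [Finset.sum_eq_single_of_mem (k + l) hm]
    · simp; ring
    · intro m _ hne; simp [hne]

/-- The residual of the semi-discrete equation for the truncated Fourier series of a solution. The
mode equations `hode` hold for all the wave numbers `|k| < N / 2`, hence only the tails of the
series and the error `q - p` of the squares contribute. -/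
theorem abs_weakForm_le_of_modes (hx : xL < xR) (hN : 0 < N) (he : Even N) (hσ : 0 < σ)
    (ha : 0 ≤ a) (hγ : 0 ≤ γ)
    {s S : Finset ℤ} (hs : ∀ k, k ∈ s ↔ 4 * |k| < N) (hS : ∀ k, k ∈ S ↔ 2 * |k| < N)
    (c c' p q : ℤ → ℂ) {W W' : Fin N → ℝ}
    (hW : ∀ j, (W j : ℂ) = ∑ k ∈ s, c k * mode xL xR k (node xL xR N j))
    (hW' : ∀ j, W' j = (∑ k ∈ s, c' k * mode xL xR k (node xL xR N j)).re)
    (hq : ∀ m, q m = ∑ k ∈ s, ∑ l ∈ s, c k * c l * if m = k + l then 1 else 0)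
    (hode : ∀ k, symbol xL xR σ k * c' k =
      -(Complex.I * k * freq xL xR) * (a * c k + γ / 2 * p k))
    {ε₀ ε₁ ε₂ : ℝ} (hε₀ : 0 ≤ ε₀) (hε₁ : 0 ≤ ε₁) (hε₂ : 0 ≤ ε₂)
    (h₀ : ∑ m ∈ S, ‖q m - p m‖ ^ 2 ≤ ε₀ ^ 2)
    (h₁ : ∑ k ∈ S \ s, symbol xL xR σ k * ‖c' k‖ ^ 2 ≤ ε₁ ^ 2)
    (h₂ : ∑ k ∈ S \ s, ‖c k‖ ^ 2 ≤ ε₂ ^ 2) (η : Fin N → ℝ) :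
    |inner ℝ (energyMap xL xR σ N W') (energyMap xL xR σ N η) + advForm xL xR a γ W W η| ≤
      (γ / 2 / Real.sqrt σ * ε₀ + ε₁ + a / Real.sqrt σ * ε₂) * ‖energyMap xL xR σ N η‖ := by
  have hsσ : 0 < Real.sqrt σ := Real.sqrt_pos.2 hσ
  have hsS : s ⊆ S := fun k hk => by
    rw [hS]; have := (hs k).1 hk; have := abs_nonneg k; omega
  have hS2 : ∀ k ∈ S, 2 * |k| < N := fun k hk => (hS k).1 hk
  have hS3 : ∀ k ∈ S \ s, 2 * |k| < N := fun k hk => hS2 k (Finset.sdiff_subset hk)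
  have hmul : ∀ k : ℤ, (freq xL xR * k) ^ 2 / symbol xL xR σ k ≤ 1 / σ := by
    intro k
    rw [div_le_div_iff₀ (symbol_pos xL xR hσ.le k) hσ, symbol]; linarith
  have hnorm : ∀ (k : ℤ) (z : ℂ) (b : ℝ), 0 ≤ b → ‖(b : ℂ) * (Complex.I * k * freq xL xR) * z‖ ^ 2 /
      symbol xL xR σ k ≤ (b / Real.sqrt σ) ^ 2 * ‖z‖ ^ 2 := by
    intro k z b hb
    have h := hmul k
    have e : ‖(b : ℂ) * (Complex.I * k * freq xL xR) * z‖ ^ 2 / symbol xL xR σ k =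
        b ^ 2 * ‖z‖ ^ 2 * ((freq xL xR * k) ^ 2 / symbol xL xR σ k) := by
      simp only [norm_mul, Complex.norm_real, Complex.norm_I, Complex.norm_intCast,
        Real.norm_eq_abs, mul_pow, sq_abs]
      ring
    rw [e, div_pow, Real.sq_sqrt hσ.le]
    calc _ ≤ b ^ 2 * ‖z‖ ^ 2 * (1 / σ) := by gcongr
      _ = _ := by ring
  rw [weakForm_of_modes hx hN he hσ.le (fun k hk => (hs k).1 hk) hS c c' hW hW' η]
  simp_rw [← hq]
  have e : (∑ k ∈ s, (symbol xL xR σ k * c' k + a * (Complex.I * k * freq xL xR) * c k) *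
          (starRingEnd ℂ) (dft xL xR η k)) +
        (∑ m ∈ S, γ / 2 * (Complex.I * m * freq xL xR) * q m *
            (starRingEnd ℂ) (dft xL xR η m)) =
      (∑ m ∈ S, ((γ / 2 : ℝ) * (Complex.I * m * freq xL xR) * (q m - p m)) *
            (starRingEnd ℂ) (dft xL xR η m)) -
      (∑ k ∈ S \ s, symbol xL xR σ k * c' k * (starRingEnd ℂ) (dft xL xR η k)) -
      (∑ k ∈ S \ s, a * (Complex.I * k * freq xL xR) * c k *
        (starRingEnd ℂ) (dft xL xR η k)) := by
    have e1 := Finset.sum_sdiff (f := fun k => (symbol xL xR σ k * c' k +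
      a * (Complex.I * k * freq xL xR) * c k) * (starRingEnd ℂ) (dft xL xR η k)) hsS
    have e2 : (∑ m ∈ S, γ / 2 * (Complex.I * m * freq xL xR) * q m *
            (starRingEnd ℂ) (dft xL xR η m)) =
        (∑ m ∈ S, ((γ / 2 : ℝ) * (Complex.I * m * freq xL xR) * (q m - p m)) *
            (starRingEnd ℂ) (dft xL xR η m)) - ∑ k ∈ S, (symbol xL xR σ k * c' k +
      a * (Complex.I * k * freq xL xR) * c k) * (starRingEnd ℂ) (dft xL xR η k) := by
      rw [← Finset.sum_sub_distrib]
      refine Finset.sum_congr rfl fun m _ => ?_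
      rw [hode m]
      push_cast; ring
    rw [e2, ← e1]
    simp only [add_mul, Finset.sum_add_distrib]
    ring
  rw [← Complex.add_re, e, Complex.sub_re, Complex.sub_re]
  have t0 := abs_re_sum_mul_conj_dft_le hσ.le he η hS2
    (fun m => ((γ / 2 : ℝ) * (Complex.I * m * freq xL xR) * (q m - p m)))
    (ρ := γ / 2 / Real.sqrt σ * ε₀) (by positivity) (by
      refine (Finset.sum_le_sum fun m _ => hnorm m (q m - p m) (γ / 2) (by positivity)).trans ?_
      rw [← Finset.mul_sum, mul_pow]
      gcongr)
  have t1 := abs_re_sum_mul_conj_dft_le hσ.le he η hS3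
    (fun k => symbol xL xR σ k * c' k) (ρ := ε₁) (by positivity) (by
      refine le_trans (le_of_eq (Finset.sum_congr rfl fun k _ => ?_)) h₁
      have h := symbol_pos xL xR hσ.le k
      rw [norm_mul, Complex.norm_real, Real.norm_of_nonneg h.le]
      field_simp)
  have t2 := abs_re_sum_mul_conj_dft_le hσ.le he η hS3
    (fun k => a * (Complex.I * k * freq xL xR) * c k)
    (ρ := a / Real.sqrt σ * ε₂) (by positivity) (by
      refine (Finset.sum_le_sum fun m _ => hnorm m (c m) a ha).trans ?_
      rw [← Finset.mul_sum, mul_pow]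
      gcongr)
  rw [abs_le] at *
  constructor <;> linarith [t0.1, t0.2, t1.1, t1.2, t2.1, t2.2]

end Trig

/-! ### Fourier series of continuous periodic functions -/

section FourierSeries

variable {xL xR : ℝ}

theorem fourier_coe_eq_mode (k : ℤ) (x : ℝ) :
    fourier k (x : AddCircle (xR - xL)) = mode xL xR k x := by
  rw [fourier_coe_apply, mode, freq]
  congr 1
  push_cast
  ring

theorem fourierCoeffOn_eq (hx : xL < xR) (f : ℝ → ℂ) (k : ℤ) : fourierCoeffOn hx f k =
    (1 / (xR - xL) : ℝ) • ∫ x in xL..xR, mode xL xR (-k) x * f x := by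
  rw [fourierCoeffOn_eq_integral]
  simp_rw [fourier_coe_eq_mode, smul_eq_mul]

theorem conj_fourierCoeffOn (hx : xL < xR) (f : ℝ → ℝ) (k : ℤ) :
    (starRingEnd ℂ) (fourierCoeffOn hx (fun x => (f x : ℂ)) k) =
      fourierCoeffOn hx (fun x => (f x : ℂ)) (-k) := by
  rw [fourierCoeffOn_eq, fourierCoeffOn_eq, Complex.real_smul, map_mul, Complex.conj_ofReal,
    Complex.real_smul, intervalIntegral.integral_of_le hx.le,
    intervalIntegral.integral_of_le hx.le, ← integral_conj]
  simp [mode_neg]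

/-- A continuous periodic function with summable Fourier coefficients is the sum of its Fourier
series. -/
theorem hasSum_fourierCoeffOn (hx : xL < xR) {f : ℝ → ℝ} (hf : Continuous f)
    (hp : Function.Periodic f (xR - xL))
    (hs : Summable fun k => ‖fourierCoeffOn hx (fun x => (f x : ℂ)) k‖) (x : ℝ) :
    HasSum (fun k => fourierCoeffOn hx (fun x => (f x : ℂ)) k * mode xL xR k x) (f x) := by
  have : Fact (0 < xR - xL) := ⟨by linarith⟩
  have hp' : Function.Periodic (fun x => (f x : ℂ)) (xR - xL) := fun y => by simp [hp y]
  let F : C(AddCircle (xR - xL), ℂ) :=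
    ⟨hp'.lift, continuous_coinduced_dom.2 (Complex.continuous_ofReal.comp hf)⟩
  have hF : ∀ y : ℝ, F (y : AddCircle (xR - xL)) = f y := fun y => hp'.lift_coe y
  have hc : ∀ k, fourierCoeff F k = fourierCoeffOn hx (fun x => (f x : ℂ)) k := by
    intro k
    rw [fourierCoeffOn_eq_integral, fourierCoeff_eq_intervalIntegral _ _ xL, add_sub_cancel]
    simp_rw [hF]
  have h := has_pointwise_sum_fourier_series_of_summable (f := F)
    (by simp_rw [← hc] at hs; exact hs.of_norm) (x : AddCircle (xR - xL))
  simp_rw [hc, fourier_coe_eq_mode, hF, smul_eq_mul] at h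
  exact h

theorem mode_right_eq_left (hx : xL < xR) (k : ℤ) : mode xL xR k xR = mode xL xR k xL := by
  have h1 : (xR : ℂ) - xL ≠ 0 := by
    rw [← Complex.ofReal_sub, Complex.ofReal_ne_zero]; linarith
  have : Complex.I * k * freq xL xR * (xR : ℂ) =
      Complex.I * k * freq xL xR * (xL : ℂ) + k * (2 * Real.pi * Complex.I) := by
    simp only [freq]; push_cast; field_simp; ring
  rw [mode, mode, this, Complex.exp_periodic.int_mul k]

theorem integral_mode (hx : xL < xR) (k : ℤ) :
    ∫ x in xL..xR, mode xL xR k x = if k = 0 then ((xR - xL : ℝ) : ℂ) else 0 := by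
  split_ifs with h
  · subst h; simp
  · have h0 : Complex.I * k * freq xL xR ≠ 0 := by
      have h1 : (k : ℂ) ≠ 0 := by exact_mod_cast h
      have h2 : (freq xL xR : ℂ) ≠ 0 := by exact_mod_cast (freq_pos hx).ne'
      simp [h1, h2]
    have h1 := intervalIntegral.integral_eq_sub_of_hasDerivAt (a := xL) (b := xR)
      (f := mode xL xR k) (f' := fun x => Complex.I * k * freq xL xR * mode xL xR k x)
      (fun x _ => hasDerivAt_mode xL xR k x)
      ((continuous_const.mul (continuous_mode xL xR k)).intervalIntegrable _ _)
    rw [mode_right_eq_left hx, sub_self, intervalIntegral.integral_const_mul] at h1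
    exact (mul_eq_zero.1 h1).resolve_left h0

theorem fourierCoeffOn_sub (hx : xL < xR) {f g : ℝ → ℂ} (hf : Continuous f) (hg : Continuous g)
    (k : ℤ) : fourierCoeffOn hx (fun x => f x - g x) k =
      fourierCoeffOn hx f k - fourierCoeffOn hx g k := by
  simp_rw [fourierCoeffOn_eq, mul_sub]
  rw [intervalIntegral.integral_sub, smul_sub]
  · exact ((continuous_mode xL xR _).mul hf).intervalIntegrable _ _
  · exact ((continuous_mode xL xR _).mul hg).intervalIntegrable _ _

theorem fourierCoeffOn_sq_of_modes (hx : xL < xR) (s : Finset ℤ) (c : ℤ → ℂ) (m : ℤ) :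
    fourierCoeffOn hx (fun x => (∑ k ∈ s, c k * mode xL xR k x) ^ 2) m =
      ∑ k ∈ s, ∑ l ∈ s, c k * c l * if m = k + l then 1 else 0 := by
  have h0 : ((xR - xL : ℝ) : ℂ) ≠ 0 := by
    rw [Complex.ofReal_ne_zero]; linarith
  have e : ∀ x, mode xL xR (-m) x * (∑ k ∈ s, c k * mode xL xR k x) ^ 2 =
      ∑ k ∈ s, ∑ l ∈ s, c k * c l * mode xL xR (k + l - m) x := by
    intro x
    rw [sq, Finset.sum_mul_sum, Finset.mul_sum]
    refine Finset.sum_congr rfl fun k _ => ?_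
    rw [Finset.mul_sum]
    refine Finset.sum_congr rfl fun l _ => ?_
    rw [sub_eq_add_neg, mode_add, mode_add]; ring
  have hc : ∀ k l, Continuous fun x => c k * c l * mode xL xR (k + l - m) x := fun k l =>
    continuous_const.mul (continuous_mode xL xR _)
  rw [fourierCoeffOn_eq]
  simp_rw [e]
  rw [intervalIntegral.integral_finsetSum fun k _ =>
    (continuous_finsetSum s fun l _ => hc k l).intervalIntegrable _ _, Finset.smul_sum]
  refine Finset.sum_congr rfl fun k _ => ?_
  rw [intervalIntegral.integral_finsetSum fun l _ => (hc k l).intervalIntegrable _ _,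
    Finset.smul_sum]
  refine Finset.sum_congr rfl fun l _ => ?_
  rw [intervalIntegral.integral_const_mul, integral_mode hx, Complex.real_smul]
  have : k + l - m = 0 ↔ m = k + l := by omega
  simp only [this]
  split_ifs
  · push_cast at *; field_simp
  · simp

/-- Bessel's inequality for a bounded continuous function. -/
theorem sum_norm_sq_fourierCoeffOn_le (hx : xL < xR) {g : ℝ → ℂ} (hg : Continuous g) {B : ℝ}
    (hB : ∀ x, ‖g x‖ ≤ B) (S : Finset ℤ) :
    ∑ k ∈ S, ‖fourierCoeffOn hx g k‖ ^ 2 ≤ B ^ 2 := by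
  have hB0 : 0 ≤ B := (norm_nonneg _).trans (hB 0)
  have hL : 0 < xR - xL := by linarith
  have hL2 : MeasureTheory.MemLp g 2 (MeasureTheory.volume.restrict (Set.Ioc xL xR)) :=
    MeasureTheory.MemLp.of_bound hg.aestronglyMeasurable B (Filter.Eventually.of_forall hB)
  have h := hasSum_sq_fourierCoeffOn hx hL2
  refine (sum_le_hasSum S (fun k _ => sq_nonneg _) h).trans ?_
  have h2 : ∫ x in xL..xR, ‖g x‖ ^ 2 ≤ ∫ _ in xL..xR, B ^ 2 := by
    refine intervalIntegral.integral_mono_on hx.le (hg.norm.pow 2 |>.intervalIntegrable _ _)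
      (by simp) fun x _ => ?_
    have := hB x
    gcongr
  rw [intervalIntegral.integral_const, smul_eq_mul] at h2
  rw [smul_eq_mul, inv_mul_le_iff₀ hL]
  exact h2

/-- The error of a truncated Fourier series is at most the sum of the neglected coefficients. -/
theorem norm_sub_truncation_le {f : ℝ → ℝ} {c : ℤ → ℂ} (hs : Summable fun k => ‖c k‖)
    (hsum : ∀ x, HasSum (fun k => c k * mode xL xR k x) (f x)) (s : Finset ℤ) (x : ℝ) :
    ‖(f x : ℂ) - ∑ k ∈ s, c k * mode xL xR k x‖ ≤ ∑' k : {k // k ∉ s}, ‖c k‖ := by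
  have h1 := (hsum x).summable.sum_add_tsum_subtype_compl s
  rw [(hsum x).tsum_eq] at h1
  rw [← h1, add_sub_cancel_left]
  have h2 : Summable fun k : {k // k ∉ s} => ‖c k * mode xL xR k x‖ := by
    simp only [norm_mul, norm_mode, mul_one]
    exact hs.subtype _
  refine (norm_tsum_le_tsum_norm h2).trans (le_of_eq ?_)
  simp only [norm_mul, norm_mode, mul_one]

/-- The Fourier coefficients of the square of a truncated Fourier series. -/
theorem sum_norm_sq_fourierCoeffOn_sq_sub_le (hx : xL < xR) {f : ℝ → ℝ} (hf : Continuous f)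
    {c : ℤ → ℂ} (hs : Summable fun k => ‖c k‖)
    (hsum : ∀ x, HasSum (fun k => c k * mode xL xR k x) (f x)) (s S : Finset ℤ) {A t : ℝ}
    (hA : ∑' k, ‖c k‖ ≤ A) (ht : ∑' k : {k // k ∉ s}, ‖c k‖ ≤ t) :
    ∑ m ∈ S, ‖(∑ k ∈ s, ∑ l ∈ s, c k * c l * if m = k + l then 1 else 0) -
      fourierCoeffOn hx (fun x => (((f x) ^ 2 : ℝ) : ℂ)) m‖ ^ 2 ≤ (2 * A * t) ^ 2 := by
  have hc1 : Continuous fun x => (∑ k ∈ s, c k * mode xL xR k x) ^ 2 :=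
    (continuous_finsetSum s fun k _ => continuous_const.mul (continuous_mode xL xR k)).pow 2
  have hc2 : Continuous fun x => (((f x) ^ 2 : ℝ) : ℂ) :=
    Complex.continuous_ofReal.comp (hf.pow 2)
  simp_rw [← fourierCoeffOn_sq_of_modes hx, ← fourierCoeffOn_sub hx hc1 hc2]
  refine sum_norm_sq_fourierCoeffOn_le hx (hc1.sub hc2) (fun x => ?_) S
  have h1 := (norm_sub_truncation_le hs hsum s x).trans ht
  have h2 : ‖(f x : ℂ)‖ ≤ A := by
    rw [← (hsum x).tsum_eq]
    refine (norm_tsum_le_tsum_norm (by simpa using hs)).trans ?_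
    simpa using hA
  have h3 : ‖∑ k ∈ s, c k * mode xL xR k x‖ ≤ A := by
    refine (norm_sum_le _ _).trans (le_trans ?_ hA)
    simp only [norm_mul, norm_mode, mul_one]
    exact hs.sum_le_tsum s fun k _ => norm_nonneg _
  have e : (∑ k ∈ s, c k * mode xL xR k x) ^ 2 - (((f x) ^ 2 : ℝ) : ℂ) =
      -(((f x : ℂ) + ∑ k ∈ s, c k * mode xL xR k x) *
        ((f x : ℂ) - ∑ k ∈ s, c k * mode xL xR k x)) := by
    push_cast; ring
  simp only [Pi.sub_apply]
  rw [e, norm_neg, norm_mul]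
  have h4 := (norm_add_le (f x : ℂ) (∑ k ∈ s, c k * mode xL xR k x))
  have hA0 : 0 ≤ A := (norm_nonneg _).trans h2
  gcongr
  linarith

/-- A truncated Fourier series of a real function, over a symmetric range, is real. -/
theorem ofReal_re_truncation {c : ℤ → ℂ} (hc : ∀ k, (starRingEnd ℂ) (c k) = c (-k))
    {s : Finset ℤ} (hs : ∀ k ∈ s, -k ∈ s) (x : ℝ) :
    ((∑ k ∈ s, c k * mode xL xR k x).re : ℂ) = ∑ k ∈ s, c k * mode xL xR k x := by
  rw [← Complex.conj_eq_iff_re, map_sum]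
  refine Finset.sum_nbij' (fun k => -k) (fun k => -k) hs hs (by simp) (by simp) ?_
  intro k _
  rw [map_mul, hc, mode_neg]

end FourierSeries

/-! ### Decay of the Fourier coefficients and aliasing -/

/-- Cauchy-Schwarz for series of nonnegative terms. -/
theorem summable_and_tsum_sq_le {ι : Type*} {f F G : ι → ℝ} (hf : ∀ k, 0 ≤ f k)
    (hF : ∀ k, 0 ≤ F k) (hG : ∀ k, 0 ≤ G k) (h : ∀ k, f k ^ 2 ≤ F k * G k)
    (hsF : Summable F) (hsG : Summable G) :
    Summable f ∧ (∑' k, f k) ^ 2 ≤ (∑' k, F k) * ∑' k, G k := by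
  have hF0 : 0 ≤ ∑' k, F k := tsum_nonneg hF
  have hG0 : 0 ≤ ∑' k, G k := tsum_nonneg hG
  have hu : ∀ u : Finset ι, ∑ k ∈ u, f k ≤ Real.sqrt ((∑' k, F k) * ∑' k, G k) := by
    intro u
    apply Real.le_sqrt_of_sq_le
    refine (Finset.sum_sq_le_sum_mul_sum_of_sq_le_mul u (fun k _ => hF k) (fun k _ => hG k)
      fun k _ => h k).trans ?_
    exact mul_le_mul (hsF.sum_le_tsum u fun k _ => hF k) (hsG.sum_le_tsum u fun k _ => hG k)
      (Finset.sum_nonneg fun k _ => hG k) hF0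
  have hs := summable_of_sum_le hf hu
  refine ⟨hs, ?_⟩
  rw [← Real.sq_sqrt (mul_nonneg hF0 hG0)]
  have := hs.tsum_le_of_sum_le hu
  have h0 : 0 ≤ ∑' k, f k := tsum_nonneg hf
  gcongr

theorem hasSum_norm_sq (w : lp (fun _ : ℤ => ℂ) 2) : HasSum (fun k => ‖w k‖ ^ 2) (‖w‖ ^ 2) := by
  have := lp.hasSum_norm (p := 2) (by norm_num) w
  simpa using this

/-- The weight `(1 + (μ k)²)^(s/2)` of the Sobolev space of order `s`. -/
noncomputable def sobolevWeight (xL xR s : ℝ) (k : ℤ) : ℝ := (1 + (freq xL xR * k) ^ 2) ^ (s / 2)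

/-- The gain `(μ N / 4)^(-r)` from `r` derivatives at the wave numbers `|k| ≥ N / 4`. -/
noncomputable def tailGain (xL xR r : ℝ) (N : ℕ) : ℝ := (freq xL xR / 4) ^ (-r) * (N : ℝ) ^ (-r)

section Decay

variable {xL xR r σ : ℝ} {N : ℕ}

theorem sobolevWeight_pos (s : ℝ) (k : ℤ) : 0 < sobolevWeight xL xR s k := by
  unfold sobolevWeight; positivity

theorem tailGain_nonneg (hx : xL < xR) : 0 ≤ tailGain xL xR r N := by
  have := freq_pos hx
  unfold tailGain; positivity

theorem norm_sq_weight_mul (k : ℤ) (z : ℂ) : ‖(sobolevWeight xL xR (r + 1) k : ℂ) * z‖ ^ 2 =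
    symbol xL xR 1 k ^ r * (symbol xL xR 1 k * ‖z‖ ^ 2) := by
  have h := symbol_pos xL xR zero_le_one k
  have e : sobolevWeight xL xR (r + 1) k ^ 2 = symbol xL xR 1 k ^ r * symbol xL xR 1 k := by
    have e0 : 1 + (freq xL xR * k) ^ 2 = symbol xL xR 1 k := by rw [symbol, one_mul]
    rw [sobolevWeight, e0, ← Real.rpow_natCast, ← Real.rpow_mul h.le, ← Real.rpow_add_one h.ne']
    congr 1
    push_cast; ring
  rw [norm_mul, Complex.norm_real, Real.norm_of_nonneg (sobolevWeight_pos _ _).le, mul_pow, e]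
  ring

theorem symbol_mul_norm_sq_le (hr : 0 ≤ r) (k : ℤ) (z : ℂ) :
    symbol xL xR 1 k * ‖z‖ ^ 2 ≤ ‖(sobolevWeight xL xR (r + 1) k : ℂ) * z‖ ^ 2 := by
  rw [norm_sq_weight_mul]
  have := symbol_pos xL xR zero_le_one k
  exact le_mul_of_one_le_left (by positivity)
    (Real.one_le_rpow (one_le_symbol xL xR zero_le_one k) hr)

theorem symbol_mul_norm_sq_le_of_tail (hx : xL < xR) (hN : 0 < N) (hr : 0 ≤ r) {k : ℤ}
    (hk : (N : ℤ) ≤ 4 * |k|) (z : ℂ) : symbol xL xR 1 k * ‖z‖ ^ 2 ≤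
      tailGain xL xR r N ^ 2 * ‖(sobolevWeight xL xR (r + 1) k : ℂ) * z‖ ^ 2 := by
  have hμ := freq_pos hx
  have hN' : (0 : ℝ) < N := by exact_mod_cast hN
  have hs := symbol_pos xL xR zero_le_one k
  have h1 : (freq xL xR / 4 * N) ^ 2 ≤ symbol xL xR 1 k := by
    have hk' : (N : ℝ) ≤ 4 * |(k : ℝ)| := by exact_mod_cast hk
    have h2 : (freq xL xR / 4 * N) ^ 2 ≤ (freq xL xR * |(k : ℝ)|) ^ 2 := by
      have : freq xL xR / 4 * N ≤ freq xL xR * |(k : ℝ)| := by nlinarith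
      gcongr
    rw [mul_pow, mul_pow, sq_abs] at h2
    rw [symbol]
    nlinarith
  have h2 : ((freq xL xR / 4 * N) ^ r) ^ 2 ≤ symbol xL xR 1 k ^ r := by
    have e : ((freq xL xR / 4 * N) ^ r) ^ 2 = ((freq xL xR / 4 * N) ^ 2) ^ r := by
      rw [← Real.rpow_natCast, ← Real.rpow_mul (by positivity), ← Real.rpow_natCast,
        ← Real.rpow_mul (by positivity), mul_comm r]
    rw [e]
    gcongr
  have h3 : tailGain xL xR r N * (freq xL xR / 4 * N) ^ r = 1 := by
    rw [tailGain, ← Real.mul_rpow (by positivity) (by positivity),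
      ← Real.rpow_add (by positivity), neg_add_cancel, Real.rpow_zero]
  rw [norm_sq_weight_mul, ← mul_assoc]
  refine le_mul_of_one_le_left (by positivity) ?_
  calc (1 : ℝ) = tailGain xL xR r N ^ 2 * ((freq xL xR / 4 * N) ^ r) ^ 2 := by
        rw [← mul_pow, h3, one_pow]
    _ ≤ _ := by gcongr

theorem symbol_le_mul_symbol_one (k : ℤ) :
    symbol xL xR σ k ≤ (1 + |σ|) * symbol xL xR 1 k := by
  unfold symbol
  have h1 := le_abs_self σ
  have h2 := abs_nonneg σ
  have h3 := sq_nonneg (freq xL xR * (k : ℝ))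
  nlinarith [mul_le_mul_of_nonneg_right h1 h3]

variable {c : ℤ → ℂ} {w : lp (fun _ : ℤ => ℂ) 2}

/-- The functions of `H_p^{r+1}` have bounded energy. -/
theorem sum_symbol_mul_norm_sq_le (hr : 0 ≤ r)
    (hcw : ∀ k, w k = (sobolevWeight xL xR (r + 1) k : ℂ) * c k) (s : Finset ℤ) :
    ∑ k ∈ s, symbol xL xR σ k * ‖c k‖ ^ 2 ≤ (Real.sqrt (1 + |σ|) * ‖w‖) ^ 2 := by
  rw [mul_pow, Real.sq_sqrt (by positivity)]
  have h1 := sum_le_hasSum s (fun k _ => sq_nonneg _) (hasSum_norm_sq w)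
  refine le_trans ?_ (mul_le_mul_of_nonneg_left h1 (by positivity))
  rw [Finset.mul_sum]
  refine Finset.sum_le_sum fun k _ => ?_
  have h2 := symbol_mul_norm_sq_le (xL := xL) (xR := xR) hr k (c k)
  rw [← hcw] at h2
  calc _ ≤ (1 + |σ|) * symbol xL xR 1 k * ‖c k‖ ^ 2 := by
        gcongr; exact symbol_le_mul_symbol_one k
    _ = (1 + |σ|) * (symbol xL xR 1 k * ‖c k‖ ^ 2) := by ring
    _ ≤ _ := by gcongr

theorem sum_symbol_mul_norm_sq_le_of_tail (hx : xL < xR) (hN : 0 < N) (hr : 0 ≤ r)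
    (hcw : ∀ k, w k = (sobolevWeight xL xR (r + 1) k : ℂ) * c k) {s : Finset ℤ}
    (hs : ∀ k ∈ s, (N : ℤ) ≤ 4 * |k|) :
    ∑ k ∈ s, symbol xL xR σ k * ‖c k‖ ^ 2 ≤
      (Real.sqrt (1 + |σ|) * ‖w‖ * tailGain xL xR r N) ^ 2 := by
  rw [mul_pow, mul_pow, Real.sq_sqrt (by positivity), mul_right_comm]
  have h1 := sum_le_hasSum s (fun k _ => sq_nonneg _) (hasSum_norm_sq w)
  refine le_trans ?_ (mul_le_mul_of_nonneg_left h1 (by positivity))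
  rw [Finset.mul_sum]
  refine Finset.sum_le_sum fun k hk => ?_
  have h2 := symbol_mul_norm_sq_le_of_tail (xL := xL) (xR := xR) hx hN hr (hs k hk) (c k)
  rw [← hcw] at h2
  calc _ ≤ (1 + |σ|) * symbol xL xR 1 k * ‖c k‖ ^ 2 := by
        gcongr; exact symbol_le_mul_symbol_one k
    _ = (1 + |σ|) * (symbol xL xR 1 k * ‖c k‖ ^ 2) := by ring
    _ ≤ (1 + |σ|) * (tailGain xL xR r N ^ 2 * ‖w k‖ ^ 2) := by gcongr
    _ = _ := by ring

/-- The embedding of `H_p^{r+1}` into the functions with summable Fourier coefficients. -/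
theorem summable_norm_coeff (hx : xL < xR) (hr : 0 ≤ r)
    (hcw : ∀ k, w k = (sobolevWeight xL xR (r + 1) k : ℂ) * c k) :
    Summable (fun k => ‖c k‖) ∧ ∑' k, ‖c k‖ ≤ sobolevConst xL xR 1 * ‖w‖ := by
  have hsp := fun k => symbol_pos xL xR zero_le_one k
  have h := summable_and_tsum_sq_le (f := fun k => ‖c k‖) (F := fun k => 1 / symbol xL xR 1 k)
    (G := fun k => ‖w k‖ ^ 2) (fun k => norm_nonneg _) (fun k => (one_div_pos.2 (hsp k)).le)
    (fun k => sq_nonneg _) (fun k => by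
      have h2 := symbol_mul_norm_sq_le (xL := xL) (xR := xR) hr k (c k)
      rw [← hcw] at h2
      rw [one_div_mul_eq_div, le_div_iff₀ (hsp k), mul_comm]
      exact h2)
    (summable_inv_symbol hx one_pos) (hasSum_norm_sq w).summable
  refine ⟨h.1, (abs_le_of_sq_le_sq' ?_ (by unfold sobolevConst; positivity)).2⟩
  rw [mul_pow, sobolevConst, Real.sq_sqrt (tsum_nonneg fun k => (one_div_pos.2 (hsp k)).le),
    ← (hasSum_norm_sq w).tsum_eq]
  exact h.2

theorem tsum_norm_coeff_tail_le (hx : xL < xR) (hN : 0 < N) (hr : 0 ≤ r)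
    (hcw : ∀ k, w k = (sobolevWeight xL xR (r + 1) k : ℂ) * c k) {s : Finset ℤ}
    (hs : ∀ k, k ∈ s ↔ 4 * |k| < N) :
    ∑' k : {k // k ∉ s}, ‖c k‖ ≤ sobolevConst xL xR 1 * ‖w‖ * tailGain xL xR r N := by
  have hsp := fun k => symbol_pos xL xR zero_le_one k
  have hg := tailGain_nonneg (r := r) (N := N) hx
  have h := summable_and_tsum_sq_le (f := fun k : {k // k ∉ s} => ‖c k‖)
    (F := fun k : {k // k ∉ s} => 1 / symbol xL xR 1 k)
    (G := fun k : {k // k ∉ s} => tailGain xL xR r N ^ 2 * ‖w k‖ ^ 2) (fun k => norm_nonneg _)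
    (fun k => (one_div_pos.2 (hsp k)).le)
    (fun k => by positivity) (fun k => by
      have h2 := symbol_mul_norm_sq_le_of_tail (xL := xL) (xR := xR) hx hN hr (k := k)
        (by have := k.2; rw [hs] at this; omega) (c k)
      rw [← hcw] at h2
      rw [one_div_mul_eq_div, le_div_iff₀ (hsp k), mul_comm]
      exact h2)
    ((summable_inv_symbol hx one_pos).subtype _)
    (((hasSum_norm_sq w).summable.subtype _).mul_left _)
  refine (abs_le_of_sq_le_sq' (h.2.trans ?_) (by unfold sobolevConst; positivity)).2
  rw [mul_pow, mul_pow, sobolevConst,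
    Real.sq_sqrt (tsum_nonneg fun k => (one_div_pos.2 (hsp k)).le), mul_assoc]
  have h1 : ∑' k : {k // k ∉ s}, 1 / symbol xL xR 1 k ≤ ∑' k, 1 / symbol xL xR 1 k :=
    (summable_inv_symbol hx one_pos).tsum_subtype_le _ _
      fun k => (one_div_pos.2 (hsp k)).le
  have h2 : ∑' k : {k // k ∉ s}, ‖w k‖ ^ 2 ≤ ‖w‖ ^ 2 := by
    rw [← (hasSum_norm_sq w).tsum_eq]
    exact (hasSum_norm_sq w).summable.tsum_subtype_le _ _ fun k => sq_nonneg _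
  rw [tsum_mul_left, mul_comm (‖w‖ ^ 2)]
  refine mul_le_mul h1 (by gcongr) ?_ (tsum_nonneg fun k => (one_div_pos.2 (hsp k)).le)
  exact mul_nonneg (sq_nonneg _) (tsum_nonneg fun k => sq_nonneg _)

/-- The wave numbers `|k| ≥ N / 4` that are aliased to `m` are at least as sparse as the multiples
of `N / 4`. -/
theorem tsum_alias_le (hN : 0 < N) {m : ℤ} (hm : 2 * |m| ≤ N) :
    Summable (fun k : ℤ => if (N : ℤ) ≤ 4 * |k| ∧ (N : ℤ) ∣ k - m then 1 / (k : ℝ) ^ 2 else 0) ∧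
    ∑' k : ℤ, (if (N : ℤ) ≤ 4 * |k| ∧ (N : ℤ) ∣ k - m then 1 / (k : ℝ) ^ 2 else 0) ≤
      16 / (N : ℝ) ^ 2 * ∑' p : ℤ, 1 / (1 + 1 * (p : ℝ) ^ 2) := by
  have hN' : (0 : ℝ) < N := by exact_mod_cast hN
  set F : ℤ → ℝ := fun k =>
    if (N : ℤ) ≤ 4 * |k| ∧ (N : ℤ) ∣ k - m then 1 / (k : ℝ) ^ 2 else 0 with hF
  have hinj : Function.Injective fun p : ℤ => m + N * p := fun p q h => by
    have h' : (N : ℤ) * p = N * q := by simpa using h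
    exact mul_left_cancel₀ (by exact_mod_cast hN.ne') h'
  have hrange : ∀ k, k ∉ Set.range (fun p : ℤ => m + N * p) → F k = 0 := by
    intro k hk
    rw [hF]
    refine if_neg fun h => hk ?_
    obtain ⟨p, hp⟩ := h.2
    exact ⟨p, by simp only; rw [← hp]; ring⟩
  have hF0 : ∀ k, 0 ≤ F k := fun k => by simp only [hF]; split_ifs <;> positivity
  have hle : ∀ p : ℤ, F (m + N * p) ≤ 16 / (N : ℝ) ^ 2 * (1 / (1 + 1 * (p : ℝ) ^ 2)) := by
    intro p
    simp only [hF]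
    split_ifs with h
    · have h1 := h.1
      have key : (N : ℤ) ^ 2 * (1 + p ^ 2) ≤ 16 * (m + N * p) ^ 2 := by
        rcases eq_or_ne p 0 with rfl | hp
        · simp only [mul_zero, add_zero] at h1 ⊢
          rw [← sq_abs m]
          have : (0 : ℤ) ≤ N := by positivity
          nlinarith
        · have hp1 : 1 ≤ |p| := Int.one_le_abs hp
          have h2 : (N : ℤ) * |p| ≤ 2 * |m + N * p| := by
            have h3 : |(N : ℤ) * p| ≤ |m + N * p| + |m| := by
              have := abs_sub (m + N * p) m
              rwa [add_sub_cancel_left] at this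
            rw [abs_mul, Nat.abs_cast] at h3
            have : (0 : ℤ) ≤ N := by positivity
            nlinarith
          have h4 : ((N : ℤ) * |p|) ^ 2 ≤ (2 * |m + N * p|) ^ 2 := by gcongr
          rw [mul_pow, mul_pow, sq_abs, sq_abs] at h4
          have h5 : 1 ≤ p ^ 2 := by rw [← sq_abs]; nlinarith
          nlinarith [sq_nonneg (N : ℤ)]
      have key' : (N : ℝ) ^ 2 * (1 + (p : ℝ) ^ 2) ≤ 16 * ((m + N * p : ℤ) : ℝ) ^ 2 := by
        exact_mod_cast key
      have hpos : 0 < (N : ℝ) ^ 2 * (1 + (p : ℝ) ^ 2) := by positivity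
      rw [div_mul_div_comm, one_mul, mul_one, div_le_div_iff₀ (by linarith) hpos]
      linarith
    · positivity
  have hs1 : Summable fun p : ℤ => 16 / (N : ℝ) ^ 2 * (1 / (1 + 1 * (p : ℝ) ^ 2)) :=
    (summable_one_div_one_add_mul_sq one_pos).mul_left _
  have hs2 : Summable fun p : ℤ => F (m + N * p) :=
    Summable.of_nonneg_of_le (fun p => hF0 _) hle hs1
  refine ⟨(hinj.summable_iff hrange).1 hs2, ?_⟩
  rw [← hinj.tsum_eq (f := F) (fun k hk => by
    by_contra h; exact hk (hrange k h)), ← tsum_mul_left]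
  exact hs2.tsum_le_tsum hle hs1

/-- Each wave number is aliased to one grid mode, the modes `±N/2` counting half each. -/
theorem sum_band_dvd_le (hN : 0 < N) (he : Even N) (k : ℤ) :
    ∑ m ∈ band N, 1 / modeWeight N m * (if (N : ℤ) ∣ k - m then (1 : ℝ) else 0) ≤ 1 := by
  have hcard : ∀ a b : ℤ, b - a ≤ N → ∀ u : Finset ℤ, (∀ m ∈ u, a ≤ m ∧ m < b) →
      ∑ m ∈ u, (if (N : ℤ) ∣ k - m then (1 : ℝ) else 0) ≤ 1 := by
    intro a b hab u hu
    rw [Finset.sum_boole]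
    have : (u.filter fun m => (N : ℤ) ∣ k - m).card ≤ 1 := by
      rw [Finset.card_le_one]
      intro m hm m' hm'
      rw [Finset.mem_filter] at hm hm'
      have h1 := hu m hm.1
      have h2 := hu m' hm'.1
      have hd : (N : ℤ) ∣ m - m' := by
        have := dvd_sub hm'.2 hm.2
        rwa [sub_sub_sub_cancel_left] at this
      have := Int.eq_zero_of_abs_lt_dvd hd (by rw [abs_lt]; omega)
      omega
    exact_mod_cast this
  have h1 := hcard (-((N : ℤ) / 2)) ((N : ℤ) / 2) (by omega)
    (Finset.Ico (-((N : ℤ) / 2)) ((N : ℤ) / 2)) (fun m hm => by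
      rw [Finset.mem_Ico] at hm; omega)
  have h2 := hcard (-((N : ℤ) / 2) + 1) ((N : ℤ) / 2 + 1) (by omega)
    (Finset.Ioc (-((N : ℤ) / 2)) ((N : ℤ) / 2)) (fun m hm => by
      rw [Finset.mem_Ioc] at hm; omega)
  have h3 := sum_band hN he (fun m => ((if (N : ℤ) ∣ k - m then (1 : ℝ) else 0 : ℝ) : ℂ))
  have h4 : ∑ m ∈ band N, 1 / modeWeight N m * (if (N : ℤ) ∣ k - m then (1 : ℝ) else 0) =
      1 / 2 * (∑ m ∈ Finset.Ico (-((N : ℤ) / 2)) ((N : ℤ) / 2),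
        (if (N : ℤ) ∣ k - m then (1 : ℝ) else 0) +
      ∑ m ∈ Finset.Ioc (-((N : ℤ) / 2)) ((N : ℤ) / 2),
        (if (N : ℤ) ∣ k - m then (1 : ℝ) else 0)) := by
    rw [← Complex.ofReal_inj]
    push_cast at h3 ⊢
    exact h3
  rw [h4]
  linarith

/-- The constant of the interpolation error in the energy norm. -/
noncomputable def aliasConst (xL xR σ : ℝ) : ℝ :=
  Real.sqrt (16 * (∑' p : ℤ, 1 / (1 + 1 * (p : ℝ) ^ 2)) * (1 + σ * freq xL xR ^ 2) /
    freq xL xR ^ 2)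

/-- The energy norm of the grid values of the tail of a Fourier series. -/
theorem norm_energyMap_tail_le (hx : xL < xR) (hN : 0 < N) (he : Even N) (hσ : 0 ≤ σ)
    (hr : 0 ≤ r) (hcw : ∀ k, w k = (sobolevWeight xL xR (r + 1) k : ℂ) * c k) {V : Fin N → ℝ}
    (hV : ∀ j, HasSum (fun k : ℤ => (if (N : ℤ) ≤ 4 * |k| then c k else 0) *
      mode xL xR k (node xL xR N j)) (V j : ℂ)) :
    ‖energyMap xL xR σ N V‖ ≤ aliasConst xL xR σ * ‖w‖ * tailGain xL xR r N := by
  have hμ := freq_pos hx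
  have hN' : (0 : ℝ) < N := by exact_mod_cast hN
  have hNC : (N : ℂ) ≠ 0 := by exact_mod_cast hN.ne'
  have hg := tailGain_nonneg (r := r) (N := N) hx
  set S₀ := ∑' p : ℤ, 1 / (1 + 1 * (p : ℝ) ^ 2) with hS₀
  have hS₀0 : 0 ≤ S₀ := tsum_nonneg fun p => by positivity
  have hB : ∀ m : ℤ,
      Summable fun k : ℤ => (if (N : ℤ) ∣ k - m then (1 : ℝ) else 0) * ‖w k‖ ^ 2 := by
    intro m
    refine Summable.of_nonneg_of_le (fun k => ?_) (fun k => ?_) (hasSum_norm_sq w).summable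
    · split_ifs <;> positivity
    · split_ifs
      · rw [one_mul]
      · rw [zero_mul]; positivity
  have hdft : ∀ m ∈ band N, ‖dft xL xR V m‖ ^ 2 ≤ 16 / (N : ℝ) ^ 2 * S₀ *
      (tailGain xL xR r N ^ 2 / freq xL xR ^ 2 *
        ∑' k : ℤ, (if (N : ℤ) ∣ k - m then (1 : ℝ) else 0) * ‖w k‖ ^ 2) := by
    intro m hm
    have h1 : HasSum (fun k : ℤ => (if (N : ℤ) ≤ 4 * |k| ∧ (N : ℤ) ∣ k - m then c k else 0) *
        mode xL xR (k - m) xL) (dft xL xR V m) := by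
      have h2 := (hasSum_sum (s := Finset.univ) fun j _ =>
        (hV j).mul_right (mode xL xR (-m) (node xL xR N j))).mul_left (1 / (N : ℂ))
      rw [dft]
      refine h2.congr_fun fun k => ?_
      have e : ∀ j : Fin N, (if (N : ℤ) ≤ 4 * |k| then c k else 0) *
          mode xL xR k (node xL xR N j) * mode xL xR (-m) (node xL xR N j) =
          (if (N : ℤ) ≤ 4 * |k| then c k else 0) * mode xL xR (k - m) (node xL xR N j) := by
        intro j; rw [sub_eq_add_neg, mode_add]; ring
      simp_rw [e]
      rw [← Finset.mul_sum, sum_mode_node hx hN]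
      by_cases h3 : (N : ℤ) ≤ 4 * |k| <;> by_cases h4 : (N : ℤ) ∣ k - m <;> simp [h3, h4]
      field_simp
    have hal := tsum_alias_le hN (two_mul_abs_le_of_mem_band hm)
    have h5 := summable_and_tsum_sq_le
      (f := fun k : ℤ => ‖(if (N : ℤ) ≤ 4 * |k| ∧ (N : ℤ) ∣ k - m then c k else 0) *
        mode xL xR (k - m) xL‖)
      (F := fun k : ℤ => if (N : ℤ) ≤ 4 * |k| ∧ (N : ℤ) ∣ k - m then 1 / (k : ℝ) ^ 2 else 0)
      (G := fun k : ℤ => tailGain xL xR r N ^ 2 / freq xL xR ^ 2 *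
        ((if (N : ℤ) ∣ k - m then (1 : ℝ) else 0) * ‖w k‖ ^ 2))
      (fun k => norm_nonneg _) (fun k => by split_ifs <;> positivity)
      (fun k => by split_ifs <;> positivity) (fun k => by
        rw [norm_mul, norm_mode, mul_one]
        split_ifs with h h' h'
        · have h6 := symbol_mul_norm_sq_le_of_tail (xL := xL) (xR := xR) hx hN hr h.1 (c k)
          rw [← hcw] at h6
          have hk0 : (k : ℝ) ≠ 0 := by
            rintro h0
            have h0' : k = 0 := by exact_mod_cast h0
            have := h.1
            rw [h0', abs_zero] at this
            omega
          have h7 : (freq xL xR * k) ^ 2 * ‖c k‖ ^ 2 ≤ symbol xL xR 1 k * ‖c k‖ ^ 2 := by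
            gcongr; rw [symbol]; linarith
          have h8 : (0 : ℝ) < (freq xL xR * k) ^ 2 := by positivity
          have h9 : ‖c k‖ ^ 2 ≤ tailGain xL xR r N ^ 2 * ‖w k‖ ^ 2 / (freq xL xR * k) ^ 2 := by
            rw [le_div_iff₀ h8, mul_comm]
            exact h7.trans h6
          refine h9.trans (le_of_eq ?_)
          field_simp
        · exact absurd h.2 h'
        · simp
        · simp)
      hal.1 ((hB m).mul_left _)
    rw [tsum_mul_left] at h5
    have h6 := norm_tsum_le_tsum_norm h5.1
    rw [h1.tsum_eq] at h6
    calc ‖dft xL xR V m‖ ^ 2 ≤ _ := pow_le_pow_left₀ (norm_nonneg _) h6 2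
      _ ≤ _ := h5.2
      _ ≤ _ := by
        gcongr
        exact hal.2
  have hsym : ∀ m ∈ band N, symbol xL xR σ m ≤ (1 + σ * freq xL xR ^ 2) * (N : ℝ) ^ 2 := by
    intro m hm
    have h1 : (2 * |(m : ℝ)|) ≤ N := by exact_mod_cast two_mul_abs_le_of_mem_band hm
    have h2 : (m : ℝ) ^ 2 ≤ (N : ℝ) ^ 2 := by
      rw [← sq_abs]
      have := abs_nonneg (m : ℝ)
      gcongr
      linarith
    have h3 : (1 : ℝ) ≤ (N : ℝ) ^ 2 := one_le_pow₀ (by exact_mod_cast hN)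
    rw [symbol, mul_pow, ← mul_assoc, add_mul, one_mul]
    gcongr
  have hBsum : ∑ m ∈ band N, 1 / modeWeight N m *
      ∑' k : ℤ, (if (N : ℤ) ∣ k - m then (1 : ℝ) else 0) * ‖w k‖ ^ 2 ≤ ‖w‖ ^ 2 := by
    simp_rw [← tsum_mul_left]
    rw [← Summable.tsum_finsetSum fun m _ => (hB m).mul_left _, ← (hasSum_norm_sq w).tsum_eq]
    refine Summable.tsum_le_tsum (fun k => ?_) (summable_sum fun m _ => (hB m).mul_left _)
      (hasSum_norm_sq w).summable
    simp_rw [← mul_assoc]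
    rw [← Finset.sum_mul]
    exact mul_le_of_le_one_left (sq_nonneg _) (sum_band_dvd_le hN he k)
  refine (abs_le_of_sq_le_sq' ?_ (by unfold aliasConst; positivity)).2
  rw [norm_energyMap_sq hσ, mul_pow, mul_pow, aliasConst, ← hS₀, Real.sq_sqrt (by positivity)]
  calc _ ≤ ∑ m ∈ band N, 1 / modeWeight N m * ((1 + σ * freq xL xR ^ 2) * (N : ℝ) ^ 2) *
        (16 / (N : ℝ) ^ 2 * S₀ * (tailGain xL xR r N ^ 2 / freq xL xR ^ 2 *
        ∑' k : ℤ, (if (N : ℤ) ∣ k - m then (1 : ℝ) else 0) * ‖w k‖ ^ 2)) := by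
        refine Finset.sum_le_sum fun m hm => ?_
        have := modeWeight_pos N m
        have := symbol_pos xL xR hσ m
        gcongr
        · exact hsym m hm
        · exact hdft m hm
    _ = 16 * S₀ * (1 + σ * freq xL xR ^ 2) / freq xL xR ^ 2 * tailGain xL xR r N ^ 2 *
        ∑ m ∈ band N, 1 / modeWeight N m *
          ∑' k : ℤ, (if (N : ℤ) ∣ k - m then (1 : ℝ) else 0) * ‖w k‖ ^ 2 := by
        rw [Finset.mul_sum]
        refine Finset.sum_congr rfl fun m _ => ?_
        field_simp
    _ ≤ 16 * S₀ * (1 + σ * freq xL xR ^ 2) / freq xL xR ^ 2 * tailGain xL xR r N ^ 2 *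
        ‖w‖ ^ 2 := by gcongr
    _ = _ := by ring

end Decay

/-! ### Symmetric differences in time -/

section Taylor

variable {E : Type*} [NormedAddCommGroup E] [NormedSpace ℝ E] {S : Set ℝ}

theorem norm_sub_le_of_deriv_le (hS : Convex ℝ S) {g g' : ℝ → E} {B s : ℝ} {n : ℕ} (hB : 0 ≤ B)
    (hs : s ∈ S) (hg : ∀ x ∈ S, HasDerivWithinAt g (g' x) S x)
    (hb : ∀ x ∈ S, ‖g' x‖ ≤ B * |x - s| ^ n) {t : ℝ} (ht : t ∈ S) :
    ‖g t - g s‖ ≤ B * |t - s| ^ (n + 1) := by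
  have hsub : Set.uIcc s t ⊆ S := by
    rw [← segment_eq_uIcc]; exact hS.segment_subset hs ht
  have h := Convex.norm_image_sub_le_of_norm_hasDerivWithin_le (f := g) (f' := g')
    (s := Set.uIcc s t) (C := B * |t - s| ^ n) (fun x hx => (hg x (hsub hx)).mono hsub)
    (fun x hx => (hb x (hsub hx)).trans (by
      have := Set.abs_sub_left_of_mem_uIcc hx
      gcongr))
    (convex_uIcc s t) Set.left_mem_uIcc Set.right_mem_uIcc
  rw [Real.norm_eq_abs] at h
  rw [pow_succ, ← mul_assoc]
  exact h

variable {v v₁ v₂ v₃ : ℝ → E} {M : ℝ}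

/-- First order Taylor expansion with a bounded second derivative. -/
theorem norm_taylor_one_le (hS : Convex ℝ S) (hM : 0 ≤ M)
    (h₁ : ∀ x ∈ S, HasDerivWithinAt v (v₁ x) S x) (h₂ : ∀ x ∈ S, HasDerivWithinAt v₁ (v₂ x) S x)
    (hb : ∀ x ∈ S, ‖v₂ x‖ ≤ M) {s t : ℝ} (hs : s ∈ S) (ht : t ∈ S) :
    ‖v t - v s - (t - s) • v₁ s‖ ≤ M * |t - s| ^ 2 := by
  have h3 : ∀ x ∈ S, ‖v₁ x - v₁ s‖ ≤ M * |x - s| ^ 1 := fun x hx =>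
    norm_sub_le_of_deriv_le (n := 0) hS hM hs h₂ (by simpa using hb) hx
  have h4 := norm_sub_le_of_deriv_le (g := fun x => v x - (x - s) • v₁ s)
    (g' := fun x => v₁ x - v₁ s) hS hM hs (fun x hx => by
      have := (h₁ x hx).fun_sub (((hasDerivWithinAt_id x S).sub_const s).smul_const (v₁ s))
      simpa using this) h3 ht
  simp only [sub_self, zero_smul, sub_zero] at h4
  rwa [sub_right_comm]

/-- Second order Taylor expansion with a bounded third derivative. -/
theorem norm_taylor_two_le (hS : Convex ℝ S) (hM : 0 ≤ M)
    (h₁ : ∀ x ∈ S, HasDerivWithinAt v (v₁ x) S x) (h₂ : ∀ x ∈ S, HasDerivWithinAt v₁ (v₂ x) S x)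
    (h₃ : ∀ x ∈ S, HasDerivWithinAt v₂ (v₃ x) S x)
    (hb : ∀ x ∈ S, ‖v₃ x‖ ≤ M) {s t : ℝ} (hs : s ∈ S) (ht : t ∈ S) :
    ‖v t - v s - (t - s) • v₁ s - ((t - s) ^ 2 / 2) • v₂ s‖ ≤ M * |t - s| ^ 3 := by
  have h3 := fun x hx => norm_taylor_one_le hS hM h₂ h₃ hb hs (t := x) hx
  have h4 := norm_sub_le_of_deriv_le
    (g := fun x => v x - (x - s) • v₁ s - ((x - s) ^ 2 / 2) • v₂ s)
    (g' := fun x => v₁ x - v₁ s - (x - s) • v₂ s) hS hM hs (fun x hx => by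
      have hid := (hasDerivWithinAt_id x S).sub_const s
      have := ((h₁ x hx).fun_sub (hid.smul_const (v₁ s))).fun_sub
        (((hid.fun_pow 2).div_const 2).smul_const (v₂ s))
      simpa using this) h3 ht
  simp only [sub_self, zero_smul, sub_zero] at h4
  convert h4 using 2
  simp only [ne_eq, OfNat.ofNat_ne_zero, not_false_eq_true, zero_pow, zero_div, zero_smul, sub_zero]
  abel

theorem norm_central_difference_le (hS : Convex ℝ S) (hM : 0 ≤ M)
    (h₁ : ∀ x ∈ S, HasDerivWithinAt v (v₁ x) S x) (h₂ : ∀ x ∈ S, HasDerivWithinAt v₁ (v₂ x) S x)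
    (h₃ : ∀ x ∈ S, HasDerivWithinAt v₂ (v₃ x) S x)
    (hb : ∀ x ∈ S, ‖v₃ x‖ ≤ M) {t d : ℝ} (hd : 0 < d) (ht : t ∈ S) (htp : t + d ∈ S)
    (htm : t - d ∈ S) : ‖(1 / (2 * d)) • (v (t + d) - v (t - d)) - v₁ t‖ ≤ M * d ^ 2 := by
  have hp := norm_taylor_two_le hS hM h₁ h₂ h₃ hb ht htp
  have hm := norm_taylor_two_le hS hM h₁ h₂ h₃ hb ht htm
  rw [add_sub_cancel_left, abs_of_pos hd] at hp
  rw [sub_sub_cancel_left, abs_neg, abs_of_pos hd, neg_sq] at hm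
  have e : (1 / (2 * d)) • (v (t + d) - v (t - d)) - v₁ t = (1 / (2 * d)) •
      ((v (t + d) - v t - d • v₁ t - (d ^ 2 / 2) • v₂ t) -
        (v (t - d) - v t - (-d) • v₁ t - (d ^ 2 / 2) • v₂ t)) := by
    have : v₁ t = (1 / (2 * d)) • ((2 * d) • v₁ t) := by
      rw [smul_smul, one_div_mul_cancel (by positivity), one_smul]
    nth_rewrite 1 [this]
    rw [← smul_sub]
    congr 1
    module
  rw [e, norm_smul, Real.norm_of_nonneg (by positivity)]
  calc _ ≤ 1 / (2 * d) * (M * d ^ 3 + M * d ^ 3) := by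
        gcongr
        exact (norm_sub_le _ _).trans (add_le_add hp hm)
    _ = M * d ^ 2 := by field_simp; ring

theorem norm_mean_sub_le (hS : Convex ℝ S) (hM : 0 ≤ M)
    (h₁ : ∀ x ∈ S, HasDerivWithinAt v (v₁ x) S x) (h₂ : ∀ x ∈ S, HasDerivWithinAt v₁ (v₂ x) S x)
    (hb : ∀ x ∈ S, ‖v₂ x‖ ≤ M) {t d : ℝ} (ht : t ∈ S) (htp : t + d ∈ S)
    (htm : t - d ∈ S) : ‖(1 / 2 : ℝ) • (v (t + d) + v (t - d)) - v t‖ ≤ M * d ^ 2 := by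
  have hp := norm_taylor_one_le hS hM h₁ h₂ hb ht htp
  have hm := norm_taylor_one_le hS hM h₁ h₂ hb ht htm
  rw [add_sub_cancel_left, sq_abs] at hp
  rw [sub_sub_cancel_left, abs_neg, sq_abs] at hm
  have e : (1 / 2 : ℝ) • (v (t + d) + v (t - d)) - v t = (1 / 2 : ℝ) •
      ((v (t + d) - v t - d • v₁ t) + (v (t - d) - v t - (-d) • v₁ t)) := by
    module
  rw [e, norm_smul, Real.norm_of_nonneg (by norm_num)]
  calc _ ≤ 1 / 2 * (M * d ^ 2 + M * d ^ 2) := by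
        gcongr
        exact (norm_add_le _ _).trans (add_le_add hp hm)
    _ = M * d ^ 2 := by ring

/-- The derivatives of a `C³` curve on a compact interval, with a common bound. -/
theorem exists_derivs_of_contDiffOn {T : ℝ} (hT : 0 < T) {v : ℝ → E}
    (hv : ContDiffOn ℝ 3 v (Set.Icc 0 T)) : ∃ (v₁ v₂ v₃ : ℝ → E) (M : ℝ), 0 ≤ M ∧
      (∀ x ∈ Set.Icc 0 T, HasDerivWithinAt v (v₁ x) (Set.Icc 0 T) x) ∧
      (∀ x ∈ Set.Icc 0 T, HasDerivWithinAt v₁ (v₂ x) (Set.Icc 0 T) x) ∧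
      (∀ x ∈ Set.Icc 0 T, HasDerivWithinAt v₂ (v₃ x) (Set.Icc 0 T) x) ∧
      ∀ x ∈ Set.Icc 0 T, ‖v x‖ ≤ M ∧ ‖v₁ x‖ ≤ M ∧ ‖v₂ x‖ ≤ M ∧ ‖v₃ x‖ ≤ M := by
  have hu : UniqueDiffOn ℝ (Set.Icc 0 T) := uniqueDiffOn_Icc hT
  have hd : ∀ n : ℕ, n < 3 → ∀ x ∈ Set.Icc 0 T,
      HasDerivWithinAt (iteratedDerivWithin n v (Set.Icc 0 T))
        (iteratedDerivWithin (n + 1) v (Set.Icc 0 T) x) (Set.Icc 0 T) x := by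
    intro n hn x hx
    rw [iteratedDerivWithin_succ]
    exact (hv.differentiableOn_iteratedDerivWithin (by exact_mod_cast hn) hu x hx).hasDerivWithinAt
  have hb : ∀ n : ℕ, n ≤ 3 → ∃ C, ∀ x ∈ Set.Icc 0 T,
      ‖iteratedDerivWithin n v (Set.Icc 0 T) x‖ ≤ C := fun n hn =>
    isCompact_Icc.exists_bound_of_continuousOn
      (hv.continuousOn_iteratedDerivWithin (by exact_mod_cast hn) hu)
  obtain ⟨C₀, h₀⟩ := hb 0 (by norm_num)
  obtain ⟨C₁, h₁⟩ := hb 1 (by norm_num)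
  obtain ⟨C₂, h₂⟩ := hb 2 (by norm_num)
  obtain ⟨C₃, h₃⟩ := hb 3 (by norm_num)
  simp only [iteratedDerivWithin_zero] at h₀
  have hd0 := hd 0 (by norm_num)
  simp only [iteratedDerivWithin_zero] at hd0
  refine ⟨_, _, _, |C₀| + |C₁| + |C₂| + |C₃|, by positivity, hd0, hd 1 (by norm_num),
    hd 2 (by norm_num), fun x hx => ?_⟩
  have := h₀ x hx
  have := h₁ x hx
  have := h₂ x hx
  have := h₃ x hx
  have := le_abs_self C₀
  have := le_abs_self C₁
  have := le_abs_self C₂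
  have := le_abs_self C₃
  have := abs_nonneg C₀
  have := abs_nonneg C₁
  have := abs_nonneg C₂
  have := abs_nonneg C₃
  refine ⟨?_, ?_, ?_, ?_⟩ <;> linarith

end Taylor

/-! ### The equation in Fourier space -/

section ModeEquation

variable {xL xR T a σ γ : ℝ} {u₀ : ℝ → ℝ} {u : ℝ → ℝ → ℝ}

theorem mode_neg_eq_cos_sub_sin (k : ℤ) (x : ℝ) : mode xL xR (-k) x =
    (Real.cos (k * freq xL xR * x) : ℂ) - Complex.I * (Real.sin (k * freq xL xR * x) : ℂ) := by
  rw [mode_neg, mode]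
  have : Complex.I * k * freq xL xR * (x : ℂ) =
      ((k * freq xL xR * x : ℝ) : ℂ) * Complex.I := by push_cast; ring
  rw [this, Complex.exp_mul_I, ← Complex.ofReal_cos, ← Complex.ofReal_sin, map_add, map_mul,
    Complex.conj_ofReal, Complex.conj_ofReal, Complex.conj_I]
  ring

theorem mul_fourierCoeffOn_eq (hx : xL < xR) {g : ℝ → ℝ} (hg : Continuous g) (k : ℤ) :
    ((xR - xL : ℝ) : ℂ) * fourierCoeffOn hx (fun x => (g x : ℂ)) k =
      ((∫ x in xL..xR, g x * Real.cos (k * freq xL xR * x) : ℝ) : ℂ) -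
        Complex.I * ((∫ x in xL..xR, g x * Real.sin (k * freq xL xR * x) : ℝ) : ℂ) := by
  have h0 : ((xR - xL : ℝ) : ℂ) ≠ 0 := by
    rw [Complex.ofReal_ne_zero]; linarith
  rw [fourierCoeffOn_eq, Complex.real_smul, ← mul_assoc, ← Complex.ofReal_mul,
    mul_one_div_cancel (by exact_mod_cast h0), Complex.ofReal_one, one_mul,
    ← intervalIntegral.integral_ofReal, ← intervalIntegral.integral_ofReal,
    ← intervalIntegral.integral_const_mul, ← intervalIntegral.integral_sub]
  · refine intervalIntegral.integral_congr fun x _ => ?_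
    simp only [mode_neg_eq_cos_sub_sin]
    push_cast; ring
  · exact Continuous.intervalIntegrable (by fun_prop) _ _
  · exact Continuous.intervalIntegrable (by fun_prop) _ _

theorem deriv_potential (v : ℝ) : deriv (potential γ) v = γ / 2 * v ^ 2 := by
  have h : HasDerivAt (potential γ) (γ * (3 * v ^ 2) / 6) v := by
    unfold potential
    simpa using ((hasDerivAt_pow 3 v).const_mul γ).div_const 6
  rw [h.deriv]
  ring

theorem hasDerivAt_cos_mul (ω x : ℝ) :
    HasDerivAt (fun x => Real.cos (ω * x)) (-(ω * Real.sin (ω * x))) x := by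
  have h := ((hasDerivAt_id x).const_mul ω).cos
  simp only [id, mul_one] at h
  exact h.congr_deriv (by ring)

theorem hasDerivAt_sin_mul (ω x : ℝ) :
    HasDerivAt (fun x => Real.sin (ω * x)) (ω * Real.cos (ω * x)) x := by
  have h := ((hasDerivAt_id x).const_mul ω).sin
  simp only [id, mul_one] at h
  exact h.congr_deriv (by ring)

theorem freq_mul_length (hx : xL < xR) (k : ℤ) (x : ℝ) :
    k * freq xL xR * (x + (xR - xL)) = k * freq xL xR * x + k * (2 * Real.pi) := by
  have : xR - xL ≠ 0 := by linarith
  unfold freq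
  field_simp

/-- The equation for a Fourier mode: the weak form is tested with `cos (k μ x)` and
`sin (k μ x)`. -/
theorem IsSolution.hasDerivWithinAt_coeff (hx : xL < xR)
    (hu : IsSolution xL xR T a σ γ u₀ u) (hc : ∀ t ∈ Set.Icc 0 T, Continuous fun x => u x t)
    (k : ℤ) {t : ℝ} (ht : t ∈ Set.Icc 0 T) :
    HasDerivWithinAt
      (fun t => (symbol xL xR σ k : ℂ) * fourierCoeffOn hx (fun x => (u x t : ℂ)) k)
      (-(Complex.I * k * freq xL xR) * (a * fourierCoeffOn hx (fun x => (u x t : ℂ)) k +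
        γ / 2 * fourierCoeffOn hx (fun x => ((u x t ^ 2 : ℝ) : ℂ)) k)) (Set.Icc 0 T) t := by
  have h0 : ((xR - xL : ℝ) : ℂ) ≠ 0 := by
    rw [Complex.ofReal_ne_zero]; linarith
  set ω : ℝ := k * freq xL xR with hω
  have hcos' : deriv (fun x => Real.cos (ω * x)) = fun x => -(ω * Real.sin (ω * x)) :=
    funext fun x => (hasDerivAt_cos_mul ω x).deriv
  have hsin' : deriv (fun x => Real.sin (ω * x)) = fun x => ω * Real.cos (ω * x) :=
    funext fun x => (hasDerivAt_sin_mul ω x).deriv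
  have hcos'' : iteratedDeriv 2 (fun x => Real.cos (ω * x)) =
      fun x => -(ω * (ω * Real.cos (ω * x))) := by
    rw [iteratedDeriv_succ, iteratedDeriv_one, hcos']
    exact funext fun x => ((hasDerivAt_sin_mul ω x).const_mul ω).neg.deriv
  have hsin'' : iteratedDeriv 2 (fun x => Real.sin (ω * x)) =
      fun x => ω * (-(ω * Real.sin (ω * x))) := by
    rw [iteratedDeriv_succ, iteratedDeriv_one, hsin']
    exact funext fun x => ((hasDerivAt_cos_mul ω x).const_mul ω).deriv
  have h1 := hu.equation (fun x => Real.cos (ω * x))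
    (Real.contDiff_cos.comp (contDiff_const.mul contDiff_id)) (fun x => by
      simp only [hω]; rw [freq_mul_length hx]; exact Real.cos_add_int_mul_two_pi _ k) t ht
  have h2 := hu.equation (fun x => Real.sin (ω * x))
    (Real.contDiff_sin.comp (contDiff_const.mul contDiff_id)) (fun x => by
      simp only [hω]; rw [freq_mul_length hx]; exact Real.sin_add_int_mul_two_pi _ k) t ht
  rw [hcos', hcos''] at h1
  rw [hsin', hsin''] at h2
  simp only [deriv_potential] at h1 h2
  have h3 := ((h1.ofReal_comp.fun_sub (h2.ofReal_comp.const_mul Complex.I)).const_mul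
    (1 / ((xR - xL : ℝ) : ℂ)))
  have hut := hc t ht
  refine (h3.congr_of_mem (fun t' ht' => ?_) ht).congr_deriv ?_
  · have e := mul_fourierCoeffOn_eq hx (hc t' ht') k
    rw [← hω] at e
    have i1 : ∫ x in xL..xR, u x t' * (Real.cos (ω * x) - σ * -(ω * (ω * Real.cos (ω * x)))) =
        symbol xL xR σ k * ∫ x in xL..xR, u x t' * Real.cos (ω * x) := by
      rw [← intervalIntegral.integral_const_mul]
      refine intervalIntegral.integral_congr fun x _ => ?_
      simp only [symbol, hω]; ring
    have i2 : ∫ x in xL..xR, u x t' * (Real.sin (ω * x) - σ * (ω * -(ω * Real.sin (ω * x)))) =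
        symbol xL xR σ k * ∫ x in xL..xR, u x t' * Real.sin (ω * x) := by
      rw [← intervalIntegral.integral_const_mul]
      refine intervalIntegral.integral_congr fun x _ => ?_
      simp only [symbol, hω]; ring
    rw [i1, i2, one_div, eq_inv_mul_iff_mul_eq₀ h0, mul_left_comm, e]
    push_cast; ring
  · have e1 := mul_fourierCoeffOn_eq hx hut k
    have e2 := mul_fourierCoeffOn_eq hx (g := fun x => u x t ^ 2) (hut.pow 2) k
    rw [← hω] at e1 e2
    have i1 : ∫ x in xL..xR, (a * u x t + γ / 2 * u x t ^ 2) * -(ω * Real.sin (ω * x)) =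
        -ω * (a * (∫ x in xL..xR, u x t * Real.sin (ω * x)) +
          γ / 2 * ∫ x in xL..xR, u x t ^ 2 * Real.sin (ω * x)) := by
      rw [← intervalIntegral.integral_const_mul, ← intervalIntegral.integral_const_mul,
        ← intervalIntegral.integral_add (Continuous.intervalIntegrable (by fun_prop) _ _)
          (Continuous.intervalIntegrable (by fun_prop) _ _),
        ← intervalIntegral.integral_const_mul]
      refine intervalIntegral.integral_congr fun x _ => ?_
      ring
    have i2 : ∫ x in xL..xR, (a * u x t + γ / 2 * u x t ^ 2) * (ω * Real.cos (ω * x)) =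
        ω * (a * (∫ x in xL..xR, u x t * Real.cos (ω * x)) +
          γ / 2 * ∫ x in xL..xR, u x t ^ 2 * Real.cos (ω * x)) := by
      rw [← intervalIntegral.integral_const_mul, ← intervalIntegral.integral_const_mul,
        ← intervalIntegral.integral_add (Continuous.intervalIntegrable (by fun_prop) _ _)
          (Continuous.intervalIntegrable (by fun_prop) _ _),
        ← intervalIntegral.integral_const_mul]
      refine intervalIntegral.integral_congr fun x _ => ?_
      ring
    rw [i1, i2, one_div, inv_mul_eq_iff_eq_mul₀ h0]
    have hω' : (ω : ℂ) = k * freq xL xR := by rw [hω]; push_cast; rfl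
    have : ((xR - xL : ℝ) : ℂ) * (-(Complex.I * k * freq xL xR) *
        (a * fourierCoeffOn hx (fun x => (u x t : ℂ)) k +
        γ / 2 * fourierCoeffOn hx (fun x => ((u x t ^ 2 : ℝ) : ℂ)) k)) =
        -(Complex.I * ω) * (a * (((xR - xL : ℝ) : ℂ) * fourierCoeffOn hx (fun x => (u x t : ℂ)) k) +
        γ / 2 * (((xR - xL : ℝ) : ℂ) *
          fourierCoeffOn hx (fun x => ((u x t ^ 2 : ℝ) : ℂ)) k)) := by
      rw [hω']; ring
    rw [this, e1, e2]
    push_cast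
    linear_combination (ω * (a * ((∫ x in xL..xR, u x t * Real.sin (ω * x) : ℝ) : ℂ) +
      γ / 2 * ((∫ x in xL..xR, u x t ^ 2 * Real.sin (ω * x) : ℝ) : ℂ))) *
        (-Complex.I_sq)

end ModeEquation

/-! ### Truncated Fourier series of the solution on the grid -/

/-- The wave numbers `|k| < N / 4` kept in the comparison function. -/
noncomputable def lowModes (N : ℕ) : Finset ℤ := (band N).filter fun k => 4 * |k| < N

/-- The wave numbers `|k| < N / 2`, strictly inside the band of the grid. -/
noncomputable def innerModes (N : ℕ) : Finset ℤ := (band N).filter fun k => 2 * |k| < N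

theorem mem_lowModes {N : ℕ} {k : ℤ} : k ∈ lowModes N ↔ 4 * |k| < N := by
  rw [lowModes, Finset.mem_filter, and_iff_right_iff_imp]
  intro h
  exact mem_band_of_lt (by have := abs_nonneg k; omega)

theorem mem_innerModes {N : ℕ} {k : ℤ} : k ∈ innerModes N ↔ 2 * |k| < N := by
  rw [innerModes, Finset.mem_filter, and_iff_right_iff_imp]
  exact mem_band_of_lt

/-- The Fourier coefficients of the element of `H_p^s` with weighted coefficients `w`. -/
noncomputable def unweight (xL xR s : ℝ) (w : lp (fun _ : ℤ => ℂ) 2) (k : ℤ) : ℂ :=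
  ((sobolevWeight xL xR s k)⁻¹ : ℝ) * w k

/-- The grid values of the (real part of the) Fourier series, truncated to `|k| < N / 4`, of the
element of `H_p^s` with weighted coefficients `w`. -/
noncomputable def gridTrunc (xL xR s : ℝ) (N : ℕ) :
    lp (fun _ : ℤ => ℂ) 2 →ₗ[ℝ] (Fin N → ℝ) where
  toFun w j := (∑ k ∈ lowModes N, unweight xL xR s w k * mode xL xR k (node xL xR N j)).re
  map_add' w w' := by
    ext j
    simp only [unweight, lp.coeFn_add, Pi.add_apply, mul_add, add_mul, Finset.sum_add_distrib,
      Complex.add_re]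
  map_smul' b w := by
    ext j
    simp only [unweight, lp.coeFn_smul, Pi.smul_apply, Complex.real_smul, RingHom.id_apply,
      smul_eq_mul]
    rw [← Complex.re_ofReal_mul, Finset.mul_sum]
    congr 1
    refine Finset.sum_congr rfl fun k _ => ?_
    ring

section Solution

variable {xL xR T a σ γ r : ℝ} {u₀ : ℝ → ℝ} {u : ℝ → ℝ → ℝ} {N : ℕ}

theorem weight_mul_unweight (s : ℝ) (w : lp (fun _ : ℤ => ℂ) 2) (k : ℤ) :
    w k = (sobolevWeight xL xR s k : ℂ) * unweight xL xR s w k := by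
  have : (sobolevWeight xL xR s k : ℂ) ≠ 0 := by
    exact_mod_cast (sobolevWeight_pos s k).ne'
  rw [unweight]
  push_cast
  field_simp

theorem node_mem_Icc (hx : xL < xR) (hN : 0 < N) (j : Fin N) :
    node xL xR N j ∈ Set.Icc xL xR := by
  have hN' : (0 : ℝ) < N := by exact_mod_cast hN
  have hL : 0 < xR - xL := by linarith
  have hj : (j : ℝ) ≤ N := by exact_mod_cast j.2.le
  have h1 : (j : ℝ) * ((xR - xL) / N) ≤ N * ((xR - xL) / N) := by gcongr
  rw [mul_div_cancel₀ _ hN'.ne'] at h1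
  have h2 : 0 ≤ (j : ℝ) * ((xR - xL) / N) := by positivity
  unfold node
  constructor <;> linarith

theorem norm_energyMap_gridTrunc_le (hx : xL < xR) (hN : 0 < N) (he : Even N) (hσ : 0 ≤ σ)
    (hr : 0 ≤ r) (w : lp (fun _ : ℤ => ℂ) 2) :
    ‖energyMap xL xR σ N (gridTrunc xL xR (r + 1) N w)‖ ≤ Real.sqrt (1 + |σ|) * ‖w‖ :=
  norm_energyMap_sq_le_of_modes hx hN he hσ (fun k hk => by
      have := mem_lowModes.1 hk; have := abs_nonneg k; omega) (unweight xL xR (r + 1) w)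
    (fun _ => rfl) (by positivity) (sum_symbol_mul_norm_sq_le hr (weight_mul_unweight (r + 1) w) _)

variable {v v₁ : ℝ → lp (fun _ : ℤ => ℂ) 2}

/-- The curve in `ℓ²` carries the Fourier coefficients of the solution. -/
theorem unweight_eq (hx : xL < xR) {f : ℝ → ℝ} {w : lp (fun _ : ℤ => ℂ) 2}
    (hw : ∀ k, w k = sobolevCoeff hx (r + 1) f k) (k : ℤ) :
    unweight xL xR (r + 1) w k = fourierCoeffOn hx (fun x => (f x : ℂ)) k := by
  have : (sobolevWeight xL xR (r + 1) k : ℂ) ≠ 0 := by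
    exact_mod_cast (sobolevWeight_pos (r + 1) k).ne'
  have h := weight_mul_unweight (xL := xL) (xR := xR) (r + 1) w k
  rw [hw k, sobolevCoeff] at h
  exact (mul_left_cancel₀ this h).symm

theorem hasSum_unweight (hx : xL < xR) (hr : 0 ≤ r) {f : ℝ → ℝ} {w : lp (fun _ : ℤ => ℂ) 2}
    (hw : ∀ k, w k = sobolevCoeff hx (r + 1) f k) (hf : Continuous f)
    (hp : Function.Periodic f (xR - xL)) (x : ℝ) :
    HasSum (fun k => unweight xL xR (r + 1) w k * mode xL xR k x) (f x) := by
  have hs := (summable_norm_coeff hx hr (weight_mul_unweight (r + 1) w)).1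
  simp_rw [unweight_eq hx hw] at hs ⊢
  exact hasSum_fourierCoeffOn hx hf hp hs x

theorem ofReal_gridTrunc (hx : xL < xR) {f : ℝ → ℝ} {w : lp (fun _ : ℤ => ℂ) 2}
    (hw : ∀ k, w k = sobolevCoeff hx (r + 1) f k) (j : Fin N) :
    (gridTrunc xL xR (r + 1) N w j : ℂ) =
      ∑ k ∈ lowModes N, unweight xL xR (r + 1) w k * mode xL xR k (node xL xR N j) := by
  refine ofReal_re_truncation (fun k => ?_) (fun k hk => ?_) _
  · rw [unweight_eq hx hw, unweight_eq hx hw, conj_fourierCoeffOn]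
  · rw [mem_lowModes] at *
    rwa [abs_neg]

theorem abs_sub_gridTrunc_le (hx : xL < xR) (hN : 0 < N) (hr : 0 ≤ r) {f : ℝ → ℝ}
    {w : lp (fun _ : ℤ => ℂ) 2} (hw : ∀ k, w k = sobolevCoeff hx (r + 1) f k) (hf : Continuous f)
    (hp : Function.Periodic f (xR - xL)) (j : Fin N) :
    |f (node xL xR N j) - gridTrunc xL xR (r + 1) N w j| ≤
      sobolevConst xL xR 1 * ‖w‖ * tailGain xL xR r N := by
  rw [← Real.norm_eq_abs, ← Complex.norm_real, Complex.ofReal_sub, ofReal_gridTrunc hx hw]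
  exact (norm_sub_truncation_le (summable_norm_coeff hx hr (weight_mul_unweight (r + 1) w)).1
    (hasSum_unweight hx hr hw hf hp) _ _).trans
    (tsum_norm_coeff_tail_le hx hN hr (weight_mul_unweight (r + 1) w) fun k => mem_lowModes)

/-- The interpolation error in the energy norm. -/
theorem norm_energyMap_sub_gridTrunc_le (hx : xL < xR) (hN : 0 < N) (he : Even N) (hσ : 0 ≤ σ)
    (hr : 0 ≤ r) {f : ℝ → ℝ} {w : lp (fun _ : ℤ => ℂ) 2}
    (hw : ∀ k, w k = sobolevCoeff hx (r + 1) f k) (hf : Continuous f)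
    (hp : Function.Periodic f (xR - xL)) :
    ‖energyMap xL xR σ N ((fun j => f (node xL xR N j)) - gridTrunc xL xR (r + 1) N w)‖ ≤
      aliasConst xL xR σ * ‖w‖ * tailGain xL xR r N := by
  refine norm_energyMap_tail_le hx hN he hσ hr (weight_mul_unweight (r + 1) w) fun j => ?_
  have h1 := hasSum_unweight hx hr hw hf hp (node xL xR N j)
  have h2 : HasSum (fun k => if k ∈ lowModes N then unweight xL xR (r + 1) w k *
      mode xL xR k (node xL xR N j) else 0) (gridTrunc xL xR (r + 1) N w j : ℂ) := by
    rw [ofReal_gridTrunc hx hw, ← Finset.sum_congr rfl fun k hk => if_pos hk]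
    exact hasSum_sum_of_ne_finset_zero fun k hk => if_neg hk
  rw [Pi.sub_apply, Complex.ofReal_sub]
  refine (h1.sub h2).congr_fun fun k => ?_
  simp only [mem_lowModes]
  split_ifs with h h' h'
  · omega
  · simp
  · simp
  · omega

/-- The mode equations, in terms of the derivative of the curve in `ℓ²`. -/
theorem IsSolution.symbol_mul_unweight_deriv (hx : xL < xR) (hT : 0 < T)
    (hu : IsSolution xL xR T a σ γ u₀ u) (hc : ∀ t ∈ Set.Icc 0 T, Continuous fun x => u x t)
    (hv : ∀ t ∈ Set.Icc 0 T, ∀ k : ℤ, v t k = sobolevCoeff hx (r + 1) (fun x => u x t) k)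
    (hd : ∀ t ∈ Set.Icc 0 T, HasDerivWithinAt v (v₁ t) (Set.Icc 0 T) t) {t : ℝ}
    (ht : t ∈ Set.Icc 0 T) (k : ℤ) :
    symbol xL xR σ k * unweight xL xR (r + 1) (v₁ t) k = -(Complex.I * k * freq xL xR) *
      (a * unweight xL xR (r + 1) (v t) k +
        γ / 2 * fourierCoeffOn hx (fun x => ((u x t ^ 2 : ℝ) : ℂ)) k) := by
  have h1 : HasDerivWithinAt (fun t => v t k) (v₁ t k) (Set.Icc 0 T) t :=
    (lp.evalCLM ℝ (fun _ : ℤ => ℂ) 2 k).hasFDerivAt.comp_hasDerivWithinAt t (hd t ht)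
  have h2 : HasDerivWithinAt (fun t => (symbol xL xR σ k : ℂ) *
      fourierCoeffOn hx (fun x => (u x t : ℂ)) k)
      (symbol xL xR σ k * unweight xL xR (r + 1) (v₁ t) k) (Set.Icc 0 T) t := by
    refine HasDerivWithinAt.congr_of_mem ((h1.const_mul
      (((sobolevWeight xL xR (r + 1) k)⁻¹ : ℝ) : ℂ)).const_mul _) (fun t' ht' => ?_) ht
    rw [← unweight_eq hx (hv t' ht')]
    rfl
  have h3 := hu.hasDerivWithinAt_coeff hx hc k ht
  rw [unweight_eq hx (hv t ht)]
  exact (uniqueDiffOn_Icc hT t ht).eq_deriv _ h2 h3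

/-- The spatial consistency constant of the truncated Fourier series, for a bound `M` of the
solution and its time derivative in `H_p^{r+1}`. -/
noncomputable def consistencyConst (xL xR a σ γ M : ℝ) : ℝ :=
  γ / 2 / Real.sqrt σ * (2 * (sobolevConst xL xR 1 * M) * (sobolevConst xL xR 1 * M)) +
    Real.sqrt (1 + |σ|) * M + a / Real.sqrt σ * (Real.sqrt (1 + |σ|) * M)

theorem IsSolution.abs_weakForm_gridTrunc_le (hx : xL < xR) (hT : 0 < T) (hN : 0 < N)
    (he : Even N) (hσ : 0 < σ) (ha : 0 ≤ a) (hγ : 0 ≤ γ) (hr : 0 ≤ r)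
    (hu : IsSolution xL xR T a σ γ u₀ u) (hc : ∀ t ∈ Set.Icc 0 T, Continuous fun x => u x t)
    (hv : ∀ t ∈ Set.Icc 0 T, ∀ k : ℤ, v t k = sobolevCoeff hx (r + 1) (fun x => u x t) k)
    (hd : ∀ t ∈ Set.Icc 0 T, HasDerivWithinAt v (v₁ t) (Set.Icc 0 T) t) {t : ℝ}
    (ht : t ∈ Set.Icc 0 T) {M : ℝ} (hM : ‖v t‖ ≤ M) (hM₁ : ‖v₁ t‖ ≤ M) (η : Fin N → ℝ) :
    |inner ℝ (energyMap xL xR σ N (gridTrunc xL xR (r + 1) N (v₁ t))) (energyMap xL xR σ N η) +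
        advForm xL xR a γ (gridTrunc xL xR (r + 1) N (v t)) (gridTrunc xL xR (r + 1) N (v t)) η| ≤
      consistencyConst xL xR a σ γ M * tailGain xL xR r N * ‖energyMap xL xR σ N η‖ := by
  have hM0 : 0 ≤ M := (norm_nonneg _).trans hM
  have hg := tailGain_nonneg (r := r) (N := N) hx
  have hS : 0 ≤ sobolevConst xL xR 1 := Real.sqrt_nonneg _
  have hw := weight_mul_unweight (xL := xL) (xR := xR) (r + 1) (v t)
  have hw₁ := weight_mul_unweight (xL := xL) (xR := xR) (r + 1) (v₁ t)
  have hsum := hasSum_unweight hx hr (hv t ht) (hc t ht) (hu.periodic t ht)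
  have hA := summable_norm_coeff hx hr hw
  have htail := tsum_norm_coeff_tail_le (N := N) hx hN hr hw fun k => mem_lowModes
  have hdiff : ∀ k ∈ innerModes N \ lowModes N, (N : ℤ) ≤ 4 * |k| := fun k hk => by
    rw [Finset.mem_sdiff, mem_lowModes] at hk; omega
  have h := abs_weakForm_le_of_modes hx hN he hσ ha hγ (fun k => mem_lowModes)
    (fun k => mem_innerModes) (unweight xL xR (r + 1) (v t)) (unweight xL xR (r + 1) (v₁ t))
    (fourierCoeffOn hx fun x => ((u x t ^ 2 : ℝ) : ℂ)) _ (ofReal_gridTrunc hx (hv t ht))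
    (W' := gridTrunc xL xR (r + 1) N (v₁ t)) (fun _ => rfl) (fun m => rfl)
    (hu.symbol_mul_unweight_deriv hx hT hc hv hd ht)
    (ε₀ := 2 * (sobolevConst xL xR 1 * M) * (sobolevConst xL xR 1 * M * tailGain xL xR r N))
    (ε₁ := Real.sqrt (1 + |σ|) * M * tailGain xL xR r N)
    (ε₂ := Real.sqrt (1 + |σ|) * M * tailGain xL xR r N)
    (by positivity) (by positivity) (by positivity)
    (sum_norm_sq_fourierCoeffOn_sq_sub_le hx (hc t ht) hA.1 hsum _ _
      (hA.2.trans (by gcongr)) (htail.trans (by gcongr)))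
    ((sum_symbol_mul_norm_sq_le_of_tail hx hN hr hw₁ hdiff).trans (by gcongr))
    (by
      refine le_trans (Finset.sum_le_sum fun k _ => ?_)
        ((sum_symbol_mul_norm_sq_le_of_tail (σ := σ) hx hN hr hw hdiff).trans (by gcongr))
      exact le_mul_of_one_le_left (sq_nonneg _) (one_le_symbol xL xR hσ.le k)) η
  refine h.trans (le_of_eq ?_)
  unfold consistencyConst
  ring

end Solution

/-! ### Convergence of the scheme -/

section Convergence

variable {xL xR T a σ γ r : ℝ} {u₀ : ℝ → ℝ} {u : ℝ → ℝ → ℝ} {N : ℕ}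
  {v v₁ v₂ v₃ : ℝ → lp (fun _ : ℤ => ℂ) 2}

/-- The consistency error of a step of half length `d` about the time `t`. -/
theorem IsSolution.abs_stepResidual_gridTrunc_le (hx : xL < xR) (hT : 0 < T) (hN : 0 < N)
    (he : Even N) (hσ : 0 < σ) (ha : 0 ≤ a) (hγ : 0 ≤ γ) (hr : 0 ≤ r)
    (hu : IsSolution xL xR T a σ γ u₀ u) (hc : ∀ t ∈ Set.Icc 0 T, Continuous fun x => u x t)
    (hv : ∀ t ∈ Set.Icc 0 T, ∀ k : ℤ, v t k = sobolevCoeff hx (r + 1) (fun x => u x t) k)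
    (hd₁ : ∀ t ∈ Set.Icc 0 T, HasDerivWithinAt v (v₁ t) (Set.Icc 0 T) t)
    (hd₂ : ∀ t ∈ Set.Icc 0 T, HasDerivWithinAt v₁ (v₂ t) (Set.Icc 0 T) t)
    (hd₃ : ∀ t ∈ Set.Icc 0 T, HasDerivWithinAt v₂ (v₃ t) (Set.Icc 0 T) t) {M : ℝ}
    (hM : ∀ t ∈ Set.Icc 0 T, ‖v t‖ ≤ M ∧ ‖v₁ t‖ ≤ M ∧ ‖v₂ t‖ ≤ M ∧ ‖v₃ t‖ ≤ M) {t d : ℝ}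
    (hd : 0 < d) (ht : t ∈ Set.Icc 0 T) (htp : t + d ∈ Set.Icc 0 T) (htm : t - d ∈ Set.Icc 0 T)
    {Z : Fin N → ℝ} (hZ : Z = gridTrunc xL xR (r + 1) N (v t) ∨
      Z = (1 / 2 : ℝ) • (gridTrunc xL xR (r + 1) N (v (t + d)) +
        gridTrunc xL xR (r + 1) N (v (t - d)))) (η : Fin N → ℝ) :
    |stepResidual (energyMap xL xR σ N) (advForm xL xR a γ) (2 * d) Z
      (gridTrunc xL xR (r + 1) N (v (t + d))) (gridTrunc xL xR (r + 1) N (v (t - d))) η| ≤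
      (consistencyConst xL xR a σ γ M * tailGain xL xR r N + Real.sqrt (1 + |σ|) * M * d ^ 2 +
        advConst xL xR a σ γ * (1 + 2 * (Real.sqrt (1 + |σ|) * M)) *
          (Real.sqrt (1 + |σ|) * M * d ^ 2)) * ‖energyMap xL xR σ N η‖ := by
  have hM0 : 0 ≤ M := (norm_nonneg _).trans (hM t ht).1
  have hS : Convex ℝ (Set.Icc 0 T) := convex_Icc 0 T
  have hJ := fun w => norm_energyMap_gridTrunc_le (r := r) hx hN he hσ.le hr w
  have hbound : ∀ t ∈ Set.Icc 0 T, ‖energyMap xL xR σ N (gridTrunc xL xR (r + 1) N (v t))‖ ≤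
      Real.sqrt (1 + |σ|) * M := fun t ht => (hJ _).trans (by
    have := (hM t ht).1
    gcongr)
  have hmean : ‖energyMap xL xR σ N ((1 / 2 : ℝ) • (gridTrunc xL xR (r + 1) N (v (t + d)) +
        gridTrunc xL xR (r + 1) N (v (t - d))) - gridTrunc xL xR (r + 1) N (v t))‖ ≤
      Real.sqrt (1 + |σ|) * M * d ^ 2 := by
    rw [← map_add, ← map_smul, ← map_sub, mul_assoc]
    refine (hJ _).trans ?_
    have := norm_mean_sub_le hS hM0 hd₁ hd₂ (fun x hx => (hM x hx).2.2.1) ht htp htm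
    gcongr
  have hdiff : ‖energyMap xL xR σ N ((1 / (2 * d)) • (gridTrunc xL xR (r + 1) N (v (t + d)) -
        gridTrunc xL xR (r + 1) N (v (t - d))) - gridTrunc xL xR (r + 1) N (v₁ t))‖ ≤
      Real.sqrt (1 + |σ|) * M * d ^ 2 := by
    rw [← map_sub, ← map_smul, ← map_sub, mul_assoc]
    refine (hJ _).trans ?_
    have := norm_central_difference_le hS hM0 hd₁ hd₂ hd₃ (fun x hx => (hM x hx).2.2.2) hd ht
      htp htm
    gcongr
  refine (isAdvectionForm_advForm hx hN he hσ ha hγ).abs_stepResidual_le (hbound t ht) ?_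
    (fun η => hu.abs_weakForm_gridTrunc_le hx hT hN he hσ ha hγ hr hc hv hd₁ ht (hM t ht).1
      (hM t ht).2.1 η) hdiff hmean ?_ η
  · rcases hZ with rfl | rfl
    · exact hbound t ht
    · rw [map_smul, map_add, norm_smul, Real.norm_of_nonneg (by norm_num)]
      have h1 := norm_add_le (energyMap xL xR σ N (gridTrunc xL xR (r + 1) N (v (t + d))))
        (energyMap xL xR σ N (gridTrunc xL xR (r + 1) N (v (t - d))))
      linarith [hbound _ htp, hbound _ htm]
  · rcases hZ with rfl | rfl
    · rw [sub_self, map_zero, norm_zero]; positivity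
    · exact hmean

/-- The constant of the time discretization error, for a bound `B` of the solution and its time
derivatives in the energy norm. -/
noncomputable def timeConst (xL xR a σ γ B : ℝ) : ℝ :=
  B + advConst xL xR a σ γ * (1 + 2 * B) * B

/-- The error of the scheme in the energy norm, against the truncated Fourier series of the
solution. -/
theorem IsLLFMP.norm_energyMap_error_le (hx : xL < xR) (hT : 0 < T) (hN : 0 < N)
    (he : Even N) (hσ : 0 < σ) (ha : 0 ≤ a) (hγ : 0 ≤ γ) (hr : 0 ≤ r)
    (hu : IsSolution xL xR T a σ γ u₀ u) (hc : ∀ t ∈ Set.Icc 0 T, Continuous fun x => u x t)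
    (hv : ∀ t ∈ Set.Icc 0 T, ∀ k : ℤ, v t k = sobolevCoeff hx (r + 1) (fun x => u x t) k)
    (hd₁ : ∀ t ∈ Set.Icc 0 T, HasDerivWithinAt v (v₁ t) (Set.Icc 0 T) t)
    (hd₂ : ∀ t ∈ Set.Icc 0 T, HasDerivWithinAt v₁ (v₂ t) (Set.Icc 0 T) t)
    (hd₃ : ∀ t ∈ Set.Icc 0 T, HasDerivWithinAt v₂ (v₃ t) (Set.Icc 0 T) t) {M B : ℝ}
    (hM : ∀ t ∈ Set.Icc 0 T, ‖v t‖ ≤ M ∧ ‖v₁ t‖ ≤ M ∧ ‖v₂ t‖ ≤ M ∧ ‖v₃ t‖ ≤ M)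
    (hB : B = Real.sqrt (1 + |σ|) * M) {Nt : ℕ} (hNt : 0 < Nt) {τ : ℝ} (hτ : 0 < τ)
    (hτT : Nt * τ = T) {U : ℕ → Fin N → ℝ} (hU : IsLLFMP xL xR a σ γ u₀ N Nt τ U) {n : ℕ}
    (hn : n ≤ Nt) :
    ‖energyMap xL xR σ N (U n - gridTrunc xL xR (r + 1) N (v (n * τ)))‖ ≤
      Real.exp (2 * advConst xL xR a σ γ * B * T) *
        (4 * (aliasConst xL xR σ * M * tailGain xL xR r N) +
          4 * T * (consistencyConst xL xR a σ γ M * tailGain xL xR r N +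
            timeConst xL xR a σ γ B * τ ^ 2) +
          2 * advConst xL xR a σ γ ^ 2 * B ^ 3 * τ ^ 2) := by
  have h00 : (0 : ℝ) ∈ Set.Icc 0 T := ⟨le_rfl, hT.le⟩
  have hM0 : 0 ≤ M := (norm_nonneg _).trans (hM 0 h00).1
  have hadv := isAdvectionForm_advForm (σ := σ) hx hN he hσ ha hγ
  have hK0 := hadv.nonneg
  have hB0 : 0 ≤ B := by rw [hB]; positivity
  have hg0 : 0 ≤ tailGain xL xR r N := tailGain_nonneg hx
  have hA0 : 0 ≤ aliasConst xL xR σ := Real.sqrt_nonneg _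
  have hG0 : 0 ≤ consistencyConst xL xR a σ γ M := by
    have : 0 ≤ sobolevConst xL xR 1 := Real.sqrt_nonneg _
    unfold consistencyConst; positivity
  have hP0 : 0 ≤ timeConst xL xR a σ γ B := by unfold timeConst; positivity
  have htn : ∀ m : ℕ, m ≤ Nt → (m * τ : ℝ) ∈ Set.Icc 0 T := by
    intro m hm
    refine ⟨by positivity, ?_⟩
    rw [← hτT]
    have : (m : ℝ) ≤ Nt := by exact_mod_cast hm
    gcongr
  have hcons : ∀ {t d : ℝ}, 0 < d → d ≤ τ → t ∈ Set.Icc 0 T → t + d ∈ Set.Icc 0 T →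
      t - d ∈ Set.Icc 0 T → ∀ {Z : Fin N → ℝ}, (Z = gridTrunc xL xR (r + 1) N (v t) ∨
      Z = (1 / 2 : ℝ) • (gridTrunc xL xR (r + 1) N (v (t + d)) +
        gridTrunc xL xR (r + 1) N (v (t - d)))) → ∀ η : Fin N → ℝ,
      |stepResidual (energyMap xL xR σ N) (advForm xL xR a γ) (2 * d) Z
        (gridTrunc xL xR (r + 1) N (v (t + d))) (gridTrunc xL xR (r + 1) N (v (t - d))) η| ≤
        (consistencyConst xL xR a σ γ M * tailGain xL xR r N +
          timeConst xL xR a σ γ B * τ ^ 2) * ‖energyMap xL xR σ N η‖ := by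
    intro t d hd hdτ ht htp htm Z hZ η
    refine (hu.abs_stepResidual_gridTrunc_le hx hT hN he hσ ha hγ hr hc hv
      hd₁ hd₂ hd₃ hM hd ht htp htm hZ η).trans (mul_le_mul_of_nonneg_right ?_ (norm_nonneg _))
    have h1 : timeConst xL xR a σ γ B * d ^ 2 ≤ timeConst xL xR a σ γ B * τ ^ 2 := by gcongr
    rw [← hB]
    refine le_trans (le_of_eq ?_) (add_le_add_right h1 _)
    unfold timeConst
    ring
  have hbound := hadv.error_bound (τ := τ) (T := T) (M := B) hτ
    (by positivity : 0 ≤ consistencyConst xL xR a σ γ M * tailGain xL xR r N +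
      timeConst xL xR a σ γ B * τ ^ 2) hNt hτT.le (U := U)
    (W := fun m : ℕ => gridTrunc xL xR (r + 1) N (v (m * τ)))
    (stepResidual_eq_zero hx hN he hσ.le hU.first)
    (fun m h1 h2 => stepResidual_eq_zero hx hN he hσ.le (hU.step m h1 h2))
    (fun η => by
      have h1 := htn 1 hNt
      rw [Nat.cast_one, one_mul] at h1
      have e1 : τ / 2 + τ / 2 = ((1 : ℕ) : ℝ) * τ := by push_cast; ring
      have e0 : τ / 2 - τ / 2 = ((0 : ℕ) : ℝ) * τ := by push_cast; ring
      have e2 : 2 * (τ / 2) = τ := by ring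
      -- The Crank-Nicolson step is centred at `τ / 2`.
      have h := hcons (t := τ / 2) (d := τ / 2) (by positivity) (by linarith)
        ⟨by positivity, by linarith [h1.2]⟩ (by rw [e1]; exact htn 1 hNt)
        (by rw [e0]; exact htn 0 (Nat.zero_le _)) (Or.inr rfl) η
      rw [e1, e0, e2] at h
      exact h)
    (fun m h1 h2 η => by
      have e1 : (m : ℝ) * τ + τ = ((m + 1 : ℕ) : ℝ) * τ := by push_cast; ring
      have e0 : (m : ℝ) * τ - τ = ((m - 1 : ℕ) : ℝ) * τ := by push_cast [h1]; ring
      have h := hcons (t := m * τ) (d := τ) hτ le_rfl (htn m h2.le)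
        (by rw [e1]; exact htn _ h2) (by rw [e0]; exact htn _ (by omega)) (Or.inl rfl) η
      rw [e1, e0] at h
      exact h)
    (fun m hm => (norm_energyMap_gridTrunc_le hx hN he hσ.le hr _).trans (by
      rw [hB]
      exact mul_le_mul_of_nonneg_left (hM _ (htn m hm)).1 (Real.sqrt_nonneg _)))
    n hn
  refine hbound.trans ?_
  have hinit : ‖energyMap xL xR σ N (U 0 - gridTrunc xL xR (r + 1) N (v ((0 : ℕ) * τ)))‖ ≤
      aliasConst xL xR σ * M * tailGain xL xR r N := by
    have e : U 0 = fun j => u (node xL xR N j) 0 := funext fun j => by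
      rw [hU.initial, hu.initial _ (node_mem_Icc hx hN j)]
    rw [e, Nat.cast_zero, zero_mul]
    refine (norm_energyMap_sub_gridTrunc_le hx hN he hσ.le hr (hv 0 h00)
      (hc 0 h00) (hu.periodic 0 h00)).trans ?_
    have := (hM 0 h00).1
    gcongr
  gcongr

end Convergence

end RLW

theorem theorem4p3 (xL xR T a σ γ r : ℝ) (hx : xL < xR) (hT : 0 < T)
    (ha : 0 < a) (hσ : 0 < σ) (hγ : 0 < γ) (hr : 1 / 2 < r)
    (u₀ : ℝ → ℝ) (u : ℝ → ℝ → ℝ)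
    (hu : RLW.IsSolution xL xR T a σ γ u₀ u)
    (hreg : RLW.IsC3Sobolev hx T (r + 1) u) :
    ∃ C : ℝ, 0 < C ∧ ∀ N : ℕ, 0 < N → Even N → ∀ Nt : ℕ, 0 < Nt →
      ∀ U : ℕ → Fin N → ℝ, RLW.IsLLFMP xL xR a σ γ u₀ N Nt (T / Nt) U →
        ∀ n : ℕ, n ≤ Nt →
          RLW.maxNorm (fun j => u (RLW.node xL xR N j) (n * (T / Nt)) - U n j) ≤
            C * ((T / Nt) ^ 2 + (N : ℝ) ^ (-r)) := by
  open RLW in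
  have hr0 : 0 ≤ r := by linarith
  have hμ := freq_pos hx
  obtain ⟨v, hvC, hv⟩ := hreg.contDiff
  obtain ⟨v₁, v₂, v₃, M, hM0, hd₁, hd₂, hd₃, hM⟩ := exists_derivs_of_contDiffOn hT hvC
  -- Apart from `tailGain = (μ / 4)⁻ʳ N⁻ʳ`, all the constants are independent of the discretization.
  have key : ∃ c₁ c₂ : ℝ, 0 ≤ c₁ ∧ 0 ≤ c₂ ∧ ∀ N : ℕ, 0 < N → Even N → ∀ Nt : ℕ, 0 < Nt →
      ∀ U : ℕ → Fin N → ℝ, IsLLFMP xL xR a σ γ u₀ N Nt (T / Nt) U → ∀ n : ℕ, n ≤ Nt →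
        ∀ j, |u (node xL xR N j) (n * (T / Nt)) - U n j| ≤
          c₁ * tailGain xL xR r N + c₂ * (T / Nt) ^ 2 := by
    obtain ⟨B, hB⟩ : ∃ B, B = Real.sqrt (1 + |σ|) * M := ⟨_, rfl⟩
    have hB0 : 0 ≤ B := by rw [hB]; positivity
    have hS0 : ∀ s, 0 ≤ sobolevConst xL xR s := fun s => Real.sqrt_nonneg _
    have hA0 : 0 ≤ aliasConst xL xR σ := Real.sqrt_nonneg _
    have hK0 : 0 ≤ advConst xL xR a σ γ := by
      have := hS0 σ; unfold advConst; positivity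
    have hG0 : 0 ≤ consistencyConst xL xR a σ γ M := by
      have := hS0 1; unfold consistencyConst; positivity
    have hP0 : 0 ≤ timeConst xL xR a σ γ B := by unfold timeConst; positivity
    have hσ0 := hS0 σ
    have h10 := hS0 1
    refine ⟨sobolevConst xL xR 1 * M + sobolevConst xL xR σ *
        (Real.exp (2 * advConst xL xR a σ γ * B * T) * (4 * (aliasConst xL xR σ * M) +
          4 * T * consistencyConst xL xR a σ γ M)),
      sobolevConst xL xR σ * (Real.exp (2 * advConst xL xR a σ γ * B * T) *
        (4 * T * timeConst xL xR a σ γ B + 2 * advConst xL xR a σ γ ^ 2 * B ^ 3)),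
      by positivity, by positivity, ?_⟩
    intro N hN he Nt hNt U hU n hn j
    have hNt' : (0 : ℝ) < Nt := by exact_mod_cast hNt
    have hτT : Nt * (T / Nt) = T := by field_simp
    have htn : (n * (T / Nt) : ℝ) ∈ Set.Icc 0 T := by
      refine ⟨by positivity, ?_⟩
      have : (n : ℝ) ≤ Nt := by exact_mod_cast hn
      calc _ ≤ Nt * (T / Nt) := by gcongr
        _ = T := hτT
    have h1 := abs_sub_gridTrunc_le hx hN hr0 (hv _ htn) (hreg.continuous _ htn)
      (hreg.periodic _ htn) j
    have h2 := abs_le_energy hx hN he hσ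
      (U n - gridTrunc xL xR (r + 1) N (v (n * (T / Nt)))) j
    have h3 := hU.norm_energyMap_error_le hx hT hN he hσ ha.le hγ.le hr0 hu hreg.continuous hv
      hd₁ hd₂ hd₃ hM hB hNt (by positivity) hτT hn
    have h4 : sobolevConst xL xR 1 * ‖v (n * (T / Nt))‖ * tailGain xL xR r N ≤
        sobolevConst xL xR 1 * M * tailGain xL xR r N := by
      have := (hM _ htn).1
      have := tailGain_nonneg (r := r) (N := N) hx
      gcongr
    have h5 := mul_le_mul_of_nonneg_left h3 hσ0
    have e : u (node xL xR N j) (n * (T / Nt)) - U n j =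
        (u (node xL xR N j) (n * (T / Nt)) -
          gridTrunc xL xR (r + 1) N (v (n * (T / Nt))) j) -
          (U n - gridTrunc xL xR (r + 1) N (v (n * (T / Nt)))) j := by
      rw [Pi.sub_apply]; ring
    rw [e]
    refine (abs_sub _ _).trans ((add_le_add (h1.trans h4) (h2.trans h5)).trans (le_of_eq ?_))
    ring
  obtain ⟨c₁, c₂, hc₁, hc₂, h⟩ := key
  refine ⟨c₁ * (freq xL xR / 4) ^ (-r) + c₂ + 1, by positivity, ?_⟩
  intro N hN he Nt hNt U hU n hn
  have : Nonempty (Fin N) := ⟨⟨0, hN⟩⟩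
  refine ciSup_le fun j => (h N hN he Nt hNt U hU n hn j).trans ?_
  have hNr : 0 ≤ (N : ℝ) ^ (-r) := by positivity
  have hD : 0 ≤ c₁ * (freq xL xR / 4) ^ (-r) := by positivity
  have hτ2 := sq_nonneg (T / (Nt : ℝ))
  rw [tailGain, ← mul_assoc]
  nlinarith [mul_nonneg hD hτ2, mul_nonneg hc₂ hNr]
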